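/- Let $d\ge 2$ be an integer. For $s>0$ put $\phi_s(r)=\sqrt{s^2+r^2}$ and $D=\sqrt{-\Delta_x}$ on $\mathbb R^d$. With $\widehat f(\xi)=\int_{\mathbb R^d}e^{-ix\cdot\xi}f(x)\,dx$, let $e^{it\phi_s(D)}f$ be the function whose spatial Fourier transform is $e^{it\phi_s(|\xi|)}\widehat f(\xi)$, and $$\|\phi_s(D)^\alpha f\|_{L^2(\mathbb R^d)}=\Big((2\pi)^{-d}\int_{\mathbb R^d}\phi_s(|\xi|)^{2\alpha}|\widehat f(\xi)|^2\,d\xi\Big)^{1/2}.$$ Let $|\square|^\beta$ be the space-time Fourier multiplier on $\mathbb R\times\mathbb R^d$ with symbol $|\tau^2-|\xi|^2|^\beta$. Let $\beta\ge\frac{2-d}{4}$ with $(d,\beta)\ne(2,0)$. Then there is a constant $C>0$, depending only on $d$ and $\beta$, such that for every $s>0$ the estimate $$\big\||\square|^\beta\big(e^{it\phi_s(D)}f\;\overline{e^{it\phi_s(D)}g}\big)\big\|_{L^2(\mathbb R^{d+1})}\le C\,\|\phi_s(D)^{\frac{d-1}{4}+\beta}f\|_{L^2(\mathbb R^d)}\,\|\phi_s(D)^{\frac{d-1}{4}+\beta}g\|_{L^2(\mathbb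 R^d)}\qquad(*)$$ holds for all radially symmetric $f,g\in L^2(\mathbb R^d)$ for which the two norms on the right are finite. Moreover, if $\beta\in[\frac{2-d}{4},\frac{3-d}{4}]\cup[\frac{5-d}{4},\infty)$, then for every $s>0$ the smallest constant $C\ge 0$ for which $(*)$ holds for all such radially symmetric $f,g$ is $\mathbf F(\beta,d)^{1/2}$, where $$\mathbf F(\beta,d)=2^{d-3+4\beta}\,\pi^{-\frac d2}\,\frac{\Gamma(\frac d2)\,\Gamma(\frac{d-1}{2}+2\beta)}{(d-2+2\beta)\,\Gamma(\frac{3d-5}{2}+2\beta)},$$ and there is no pair of such radially symmetric functions $f,g$, both non-zero, for which equality holds in $(*)$ with $C=\mathbf F(\beta,d)^{1/2}$. -/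

import Mathlib

open MeasureTheory
open scoped FourierTransform SchwartzMap ENNReal ComplexConjugate

noncomputable section

/- Mathlib normalises the Fourier transform as `𝓕 f ζ = ∫ exp (-2πi ⟪x, ζ⟫) f x`.  The transform
`∫ exp (-i ⟪x, ξ⟫) f x` at the frequency `ξ = 2π ζ` is therefore `𝓕 f ζ`, and a Fourier multiplier
with symbol `m ξ` is multiplication of `𝓕 f ζ` by `m (2π ζ)`. -/

namespace KleinGordon

/-- `ℝᵈ` with the Euclidean norm. -/
abbrev Space (d : ℕ) : Type := EuclideanSpace ℝ (Fin d)

/-- `ℝ × ℝᵈ` with the Euclidean norm; the first component is time. -/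
abbrev Spacetime (d : ℕ) : Type := WithLp 2 (ℝ × Space d)

/-- Complex-valued `L²(ℝᵈ)`. -/
abbrev L2 (d : ℕ) : Type := Lp (α := Space d) ℂ 2

/-- Complex-valued `L²(ℝ × ℝᵈ)`. -/
abbrev SpacetimeL2 (d : ℕ) : Type := Lp (α := Spacetime d) ℂ 2 (volume : Measure (Spacetime d))

/-- `φ_s(r) = √(s² + r²)`. -/
def phi (s r : ℝ) : ℝ := √(s ^ 2 + r ^ 2)

/-- The symbol of `exp (i t φ_s(D))` as a function of `ζ = ξ / 2π`. -/
def propSymbol (d : ℕ) (s t : ℝ) (ζ : Space d) : ℂ :=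
  Complex.exp (((t * phi s (2 * Real.pi * ‖ζ‖) : ℝ) : ℂ) * Complex.I)

theorem continuous_propSymbol (d : ℕ) (s t : ℝ) : Continuous (propSymbol d s t) := by
  unfold propSymbol phi
  fun_prop

theorem norm_propSymbol (d : ℕ) (s t : ℝ) (ζ : Space d) : ‖propSymbol d s t ζ‖ = 1 :=
  Complex.norm_exp_ofReal_mul_I _

theorem memLp_propSymbol_mul {d : ℕ} (s t : ℝ) (h : L2 d) :
    MemLp (fun ζ => propSymbol d s t ζ * h ζ) 2 volume := by
  refine (Lp.memLp h).congr_norm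
    ((continuous_propSymbol d s t).aestronglyMeasurable.mul (Lp.aestronglyMeasurable h)) ?_
  filter_upwards with ζ
  rw [norm_mul, norm_propSymbol, one_mul]

/-- The Klein–Gordon propagator `exp (i t φ_s(D)) f` on `L²(ℝᵈ)`. -/
def propagator {d : ℕ} (s t : ℝ) (f : L2 d) : L2 d :=
  𝓕⁻ ((memLp_propSymbol_mul s t (𝓕 f)).toLp _)

/-- `‖φ_s(D)^α f‖_{L²(ℝᵈ)} ∈ [0, ∞]`, that is
`((2π)^{-d} ∫ φ_s(|ξ|)^{2α} |f̂(ξ)|² dξ)^{1/2}`, written in the variable `ζ = ξ / 2π`. -/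
def sobolevNorm {d : ℕ} (s α : ℝ) (f : L2 d) : ℝ≥0∞ :=
  eLpNorm (fun ζ : Space d =>
    ((phi s (2 * Real.pi * ‖ζ‖) ^ α : ℝ) : ℂ) * (𝓕 f : L2 d) ζ) 2 volume

/-- `f` is radially symmetric (almost everywhere). -/
def IsRadial {d : ℕ} (f : L2 d) : Prop :=
  ∃ f₀ : ℝ → ℂ, ∀ᵐ x ∂(volume : Measure (Space d)), f x = f₀ ‖x‖

/-- The function `(t, x) ↦ exp (i t φ_s(D)) f (x) · conj (exp (i t φ_s(D)) g (x))`; each time slice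
is determined up to a null set. -/
def product {d : ℕ} (s : ℝ) (f g : L2 d) (t : ℝ) (x : Space d) : ℂ :=
  propagator s t f x * conj (propagator s t g x)

/-- The space-time Fourier transform, in the sense of tempered distributions, of the function
`(t, x) ↦ F t x` is the locally integrable function `G`.  The pairing with a test function is an
iterated integral, so only the almost everywhere classes of the slices `F t` matter. -/
def IsSpacetimeFourier {d : ℕ} (F : ℝ → Space d → ℂ) (G : Spacetime d → ℂ) : Prop :=
  LocallyIntegrable G ∧ (∀ t, Integrable (F t)) ∧
  ∀ ψ : 𝓢(Spacetime d, ℂ),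
    Integrable (fun ζ => G ζ * ψ ζ) ∧
    Integrable (fun t => ∫ x, F t x * (𝓕 ψ : 𝓢(Spacetime d, ℂ)) (WithLp.toLp 2 (t, x))) ∧
    ∫ ζ, G ζ * ψ ζ =
      ∫ t, ∫ x, F t x * (𝓕 ψ : 𝓢(Spacetime d, ℂ)) (WithLp.toLp 2 (t, x))

/-- `H ∈ L²(ℝ × ℝᵈ)` is `|□|^β F`, where `|□|^β` has the symbol
`||τ| - |ξ||^β ||τ| + |ξ||^β = |τ² - |ξ|²|^β` (here `(τ, ξ) = 2π ζ`). -/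
def IsBoxPow {d : ℕ} (β : ℝ) (F : ℝ → Space d → ℂ) (H : SpacetimeL2 d) : Prop :=
  ∃ G : Spacetime d → ℂ, IsSpacetimeFourier F G ∧
    ∀ᵐ ζ ∂(volume : Measure (Spacetime d)),
      (𝓕 H : SpacetimeL2 d) ζ =
        (((|(2 * Real.pi * ζ.fst) ^ 2 - (2 * Real.pi * ‖ζ.snd‖) ^ 2|) ^ β : ℝ) : ℂ) * G ζ

/-- `‖|□|^β F‖_{L²(ℝ × ℝᵈ)} ∈ [0, ∞]`; it is `∞` when `|□|^β F` is not in `L²`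
(there is at most one `H` to take the infimum over). -/
def boxNorm {d : ℕ} (β : ℝ) (F : ℝ → Space d → ℂ) : ℝ≥0∞ :=
  ⨅ (H : SpacetimeL2 d) (_ : IsBoxPow β F H), ‖H‖ₑ

/-- The constant `𝐅(β, d)`. -/
def constF (β : ℝ) (d : ℕ) : ℝ :=
  2 ^ ((d : ℝ) - 3 + 4 * β) * Real.pi ^ (-(d : ℝ) / 2) *
    (Real.Gamma ((d : ℝ) / 2) * Real.Gamma (((d : ℝ) - 1) / 2 + 2 * β) /
      (((d : ℝ) - 2 + 2 * β) * Real.Gamma ((3 * (d : ℝ) - 5) / 2 + 2 * β)))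

/-- `f` is radially symmetric and `φ_s(D)^α f ∈ L²`, i.e. `f` is radial data in `H^α`. -/
def IsRadialData {d : ℕ} (s α : ℝ) (f : L2 d) : Prop :=
  IsRadial f ∧ sobolevNorm s α f < ∞

/-- The null-form estimate with constant `C` for all radial data `f`, `g`:
`‖|□|^β (e^{itφ_s(D)} f · conj (e^{itφ_s(D)} g))‖ ≤ C ‖φ_s(D)^α f‖ ‖φ_s(D)^α g‖`
with `α = (d - 1)/4 + β`. -/
def RadialEstimate (d : ℕ) (s β C : ℝ) : Prop :=
  ∀ f g : L2 d, IsRadialData s (((d : ℝ) - 1) / 4 + β) f →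
    IsRadialData s (((d : ℝ) - 1) / 4 + β) g →
    boxNorm β (product s f g) ≤
      ENNReal.ofReal C * sobolevNorm s (((d : ℝ) - 1) / 4 + β) f *
        sobolevNorm s (((d : ℝ) - 1) / 4 + β) g

end KleinGordon

end

/-! Write `d = n + 2` and `m = s / 2π`. For radial data `𝓕 f` and `𝓕 g` are functions `F₁`, `F₂` of
the energy `E = √(m² + |η|²)`. The space-time Fourier transform of the product at `(τ, ξ)` vanishes
unless `|τ| < |ξ|`, and there it is the integral of `F₁(E₁) conj F₂(E₂)` over the fiber of pairs of
points of the mass shell with `p₁ - p₂ = (τ, ξ)` (`isSpacetimeFourier_product`).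

Cauchy–Schwarz on each fiber, with the weights `E₁/E₂` and `E₂/E₁` (`sq_fibInt_le`), bounds the
square of the left side by `nullForm`, a positive integral over quadruples with `p₁ - p₂ = p₃ - p₄`
whose weight is `|F₁(E₁)|² (E₁/E₂) |F₂(E₄)|² (E₄/E₃)`. The constraint also reads `p₁ + p₄ = p₂ +
p₃`, and the data involve only `p₁` and `p₄`. So `p₂` and `p₃` may be integrated first; the factors
`1/E₂`, `1/E₃` make this integral Lorentz invariant, and in the center-of-mass frame it runs over a
sphere. The result (`thetaSec_eq_thetaCom`, `nullForm_eq`) is an explicit kernel `kern` of `X = p₁ ·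
p₄`, times an angular constant.

The kernel is strictly below `kap n * X ^ b` with `b = n/2 + 2β - 1/2` (`kern_lt`). Since the data
are radial, only the average over the angle between `p₁` and `p₄` matters. With `X = E₁E₄(1 - ν cos
θ)` and `0 ≤ ν < 1`, the average of `X ^ b` is `(E₁E₄)^b` times `angB n b ν`. That integral is
bounded in `ν`, which gives the estimate for every admissible `β`. When `r ↦ r ^ b` is convex, that
is for `b ≤ 0` or `b ≥ 1`, its largest value is at `ν = 1` (`angB_le_of_convex`); these are the two
ranges of `β` in the sharp statement. The Beta integrals then give `constF` (`sph_mul_angInt`), and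
strictness of the kernel bound excludes extremizers (`boxNorm_lt`).

For optimality take `𝓕 f = exp (-a E) / E`. It gives equality in Cauchy–Schwarz on every fiber,
because `E₁ F(E₁)` and `E₂ F(E₂)` are proportional where `E₁ - E₂` is constant
(`sq_fibInt_testProfile`). As `a → 0` its energy tends to infinity and escapes to high energies
(`tendsto_tailEnergy`), where `ν → 1` and the kernel bound becomes an asymptotic equality
(`eventually_lt_angAvg_kern`). Hence no smaller constant works (`constF_le_sq`). -/

noncomputable section

namespace KleinGordon

/-! ### Radial and axial coordinates in Euclidean space -/

open Set Filter Topology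

/-- The area of the unit sphere of `ℝⁿ⁺¹`. -/
def sph (n : ℕ) : ℝ≥0∞ := ((n + 1 : ℕ) : ℝ≥0∞) * volume (Metric.ball (0 : Space (n + 1)) 1)

theorem lintegral_fun_norm {n : ℕ} {f : ℝ → ℝ≥0∞} (hf : Measurable f) :
    ∫⁻ x : Space (n + 1), f ‖x‖ = sph n * ∫⁻ ρ in Ioi (0 : ℝ), ENNReal.ofReal (ρ ^ n) * f ρ := by
  have hdim : Module.finrank ℝ (Space (n + 1)) = n + 1 := by simp
  calc
    ∫⁻ x : Space (n + 1), f ‖x‖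
      = ∫⁻ x in ({0}ᶜ : Set (Space (n + 1))), f ‖x‖ := by rw [restrict_compl_singleton]
    _ = ∫⁻ x : ({0}ᶜ : Set (Space (n + 1))), f ‖(x : Space (n + 1))‖
          ∂(Measure.comap Subtype.val volume) := by
        rw [lintegral_subtype_comap (measurableSet_singleton _).compl (fun x => f ‖x‖)]
    _ = ∫⁻ p : (Metric.sphere (0 : Space (n + 1)) 1) × Ioi (0 : ℝ), f (p.2 : ℝ)
          ∂((volume : Measure (Space (n + 1))).toSphere.prod (Measure.volumeIoiPow n)) := by
        have := (volume : Measure (Space (n + 1))).measurePreserving_homeomorphUnitSphereProd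
        rw [hdim] at this
        rw [Nat.add_sub_cancel] at this
        rw [← this.lintegral_comp_emb (Homeomorph.measurableEmbedding _)
          (fun p => f (p.2 : ℝ))]
        simp only [homeomorphUnitSphereProd_apply_snd_coe]
    _ = sph n * ∫⁻ ρ in Ioi (0 : ℝ), ENNReal.ofReal (ρ ^ n) * f ρ := by
        rw [lintegral_prod _ (by fun_prop)]
        simp only []
        rw [lintegral_const, Measure.toSphere_apply_univ, hdim,
          mul_comm, Measure.volumeIoiPow, lintegral_withDensity_eq_lintegral_mul _ (by fun_prop)
            (by fun_prop), ← lintegral_subtype_comap measurableSet_Ioi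
              (fun ρ => ENNReal.ofReal (ρ ^ n) * f ρ)]
        rfl

theorem sph_pos (n : ℕ) : sph n ≠ 0 := by
  unfold sph
  exact mul_ne_zero (by simp) (Metric.measure_ball_pos _ _ one_pos).ne'

theorem sph_ne_top (n : ℕ) : sph n ≠ ∞ := by
  unfold sph
  exact ENNReal.mul_ne_top (by simp) measure_ball_lt_top.ne

/-- Splitting off the first coordinate. -/
def headTail (n : ℕ) : Space (n + 1) ≃ᵐ ℝ × Space n :=
  (MeasurableEquiv.toLp 2 (Fin (n + 1) → ℝ)).symm.trans
    ((MeasurableEquiv.piFinSuccAbove (fun _ => ℝ) 0).trans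
      ((MeasurableEquiv.refl ℝ).prodCongr (MeasurableEquiv.toLp 2 (Fin n → ℝ))))

theorem measurePreserving_headTail (n : ℕ) :
    MeasurePreserving (headTail n) volume volume := by
  unfold headTail
  refine ((MeasurePreserving.id volume).prod (PiLp.volume_preserving_toLp (Fin n))).comp
    ((volume_preserving_piFinSuccAbove (fun _ => ℝ) 0).comp (PiLp.volume_preserving_ofLp _))

theorem norm_sq_headTail {n : ℕ} (x : Space (n + 1)) :
    ‖x‖ ^ 2 = (headTail n x).1 ^ 2 + ‖(headTail n x).2‖ ^ 2 := by
  rw [EuclideanSpace.norm_sq_eq, EuclideanSpace.norm_sq_eq, Fin.sum_univ_succ]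
  simp only [Real.norm_eq_abs, sq_abs]
  rfl

theorem inner_headTail {n : ℕ} (x y : Space (n + 1)) :
    inner ℝ x y = (headTail n x).1 * (headTail n y).1 +
      inner ℝ (headTail n x).2 (headTail n y).2 := by
  rw [PiLp.inner_apply, PiLp.inner_apply, Fin.sum_univ_succ]
  simp only [RCLike.inner_apply, conj_trivial]
  rw [mul_comm]
  rfl

theorem lintegral_headTail {n : ℕ} {F : ℝ → Space n → ℝ≥0∞} (hF : Measurable (Function.uncurry F)) :
    ∫⁻ x : Space (n + 1), F (headTail n x).1 (headTail n x).2 = ∫⁻ y, ∫⁻ t, F t y := by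
  have h := (measurePreserving_headTail n).lintegral_comp hF
  rw [Measure.volume_eq_prod, lintegral_prod_symm _ hF.aemeasurable] at h
  exact h

/-- A linear isometry moving a given vector to the first coordinate axis. -/
theorem exists_isometry_axis {n : ℕ} (w : Space (n + 1)) :
    ∃ R : Space (n + 1) ≃ₗᵢ[ℝ] Space (n + 1), R w = ‖w‖ • EuclideanSpace.single 0 1 := by
  -- The two vectors have equal norm, so reflecting in the hyperplane orthogonal to their difference
  -- exchanges them.
  refine ⟨(ℝ ∙ (w - ‖w‖ • EuclideanSpace.single (0 : Fin (n + 1)) (1 : ℝ)))ᗮ.reflection, ?_⟩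
  apply Submodule.reflection_sub
  simp [norm_smul]

theorem headTail_single {n : ℕ} (c : ℝ) :
    headTail n (c • EuclideanSpace.single 0 1) = (c, 0) := by
  ext i
  · change (c • EuclideanSpace.single (0 : Fin (n + 1)) (1 : ℝ) : Space (n + 1)) 0 = c
    simp
  · change (c • EuclideanSpace.single (0 : Fin (n + 1)) (1 : ℝ) : Space (n + 1)) (Fin.succ i) = 0
    simp

theorem lintegral_comp_isometry {n : ℕ} (R : Space n ≃ₗᵢ[ℝ] Space n) (f : Space n → ℝ≥0∞) :
    ∫⁻ x, f (R x) = ∫⁻ x, f x :=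
  R.measurePreserving.lintegral_comp_emb R.toHomeomorph.measurableEmbedding f

/-- Integration of axially symmetric functions in cylindrical coordinates. -/
theorem lintegral_axial {n : ℕ} (w : Space (n + 2)) {F : ℝ → ℝ → ℝ≥0∞}
    (hF : Measurable (Function.uncurry F)) :
    ∫⁻ x : Space (n + 2), F ‖x‖ (inner ℝ w x) =
      sph n * ∫⁻ ρ in Ioi (0 : ℝ), ENNReal.ofReal (ρ ^ n) *
        ∫⁻ t : ℝ, F (√(t ^ 2 + ρ ^ 2)) (‖w‖ * t) := by
  obtain ⟨R, hR⟩ := exists_isometry_axis w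
  have h1 : ∀ x : Space (n + 2), F ‖x‖ (inner ℝ w x) =
      F (√((headTail (n + 1) (R x)).1 ^ 2 + ‖(headTail (n + 1) (R x)).2‖ ^ 2))
        (‖w‖ * (headTail (n + 1) (R x)).1) := by
    intro x
    rw [← norm_sq_headTail, Real.sqrt_sq (norm_nonneg _), R.norm_map, ← R.inner_map_map w x, hR,
      inner_headTail, headTail_single]
    simp
  simp_rw [h1]
  rw [lintegral_comp_isometry R (fun x => F (√((headTail (n + 1) x).1 ^ 2 +
    ‖(headTail (n + 1) x).2‖ ^ 2)) (‖w‖ * (headTail (n + 1) x).1)),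
    lintegral_headTail (F := fun t y => F (√(t ^ 2 + ‖y‖ ^ 2)) (‖w‖ * t)),
    lintegral_fun_norm (f := fun ρ => ∫⁻ t : ℝ, F (√(t ^ 2 + ρ ^ 2)) (‖w‖ * t))]
  · apply Measurable.lintegral_prod_right' (f := fun p : ℝ × ℝ => F (√(p.2 ^ 2 + p.1 ^ 2)) (‖w‖ * p.2))
    exact hF.comp (by fun_prop : Measurable fun p : ℝ × ℝ => (√(p.2 ^ 2 + p.1 ^ 2), ‖w‖ * p.2))
  · exact hF.comp (by fun_prop :
      Measurable fun p : ℝ × Space (n + 1) => (√(p.1 ^ 2 + ‖p.2‖ ^ 2), ‖w‖ * p.1))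

theorem lintegral_upperHalfPlane_polar {f : ℝ → ℝ → ℝ≥0∞} (hf : Measurable (Function.uncurry f)) :
    ∫⁻ ρ in Ioi (0 : ℝ), ∫⁻ t : ℝ, f t ρ =
      ∫⁻ r in Ioi (0 : ℝ), ∫⁻ θ in Ioo 0 Real.pi,
        ENNReal.ofReal r * f (r * Real.cos θ) (r * Real.sin θ) := by
  let g : ℝ × ℝ → ℝ≥0∞ := fun p => (Ioi (0 : ℝ)).indicator (fun ρ => f p.1 ρ) p.2
  have hg' : g = (Prod.snd ⁻¹' Ioi (0 : ℝ)).indicator (Function.uncurry f) := by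
    ext p
    by_cases hp : 0 < p.2 <;> simp [g, indicator, hp, Function.uncurry]
  have hg : Measurable g := by
    rw [hg']
    exact hf.indicator (measurable_snd measurableSet_Ioi)
  have h := lintegral_comp_polarCoord_symm g
  rw [Measure.volume_eq_prod, lintegral_prod_symm _ hg.aemeasurable] at h
  have e1 : ∫⁻ ρ in Ioi (0 : ℝ), ∫⁻ t : ℝ, f t ρ = ∫⁻ y, ∫⁻ x, g (x, y) := by
    rw [← lintegral_indicator measurableSet_Ioi]
    refine lintegral_congr fun ρ => ?_
    by_cases hp : 0 < ρ <;> simp [g, indicator, hp]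
  rw [e1, ← h, polarCoord_target, ← Measure.prod_restrict, lintegral_prod]
  · refine lintegral_congr_ae ?_
    filter_upwards [ae_restrict_mem measurableSet_Ioi] with r hr
    -- The polar angle runs over `(-π, π)`; angles in `(-π, 0]` lie outside the open upper half
    -- plane and contribute nothing.
    rw [← Ioc_union_Ioo_eq_Ioo (neg_nonpos.2 Real.pi_pos.le) Real.pi_pos,
      lintegral_union measurableSet_Ioo (by
        rw [Set.disjoint_left]; intro x hx hx'; exact absurd hx.2 (not_le.2 hx'.1))]
    rw [setLIntegral_congr_fun (g := fun _ => 0) measurableSet_Ioc, lintegral_zero, zero_add]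
    · refine setLIntegral_congr_fun measurableSet_Ioo fun θ hθ => ?_
      have : 0 < r * Real.sin θ := mul_pos hr (Real.sin_pos_of_mem_Ioo hθ)
      simp [g, polarCoord_symm_apply, this]
    · intro θ hθ
      have : r * Real.sin θ ≤ 0 := mul_nonpos_of_nonneg_of_nonpos (le_of_lt hr)
        (Real.sin_nonpos_of_nonpos_of_neg_pi_le hθ.2 hθ.1.le)
      simp [g, polarCoord_symm_apply, this]
  · refine (Measurable.smul (ENNReal.measurable_ofReal.comp measurable_fst) (hg.comp ?_)).aemeasurable
    exact continuous_polarCoord_symm.measurable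

/-- Integration of axially symmetric functions in polar coordinates. -/
theorem lintegral_axial_polar {n : ℕ} (w : Space (n + 2)) {F : ℝ → ℝ → ℝ≥0∞}
    (hF : Measurable (Function.uncurry F)) :
    ∫⁻ x : Space (n + 2), F ‖x‖ (inner ℝ w x) =
      sph n * ∫⁻ r in Ioi (0 : ℝ), ∫⁻ θ in Ioo 0 Real.pi,
        ENNReal.ofReal (r ^ (n + 1)) * ENNReal.ofReal (Real.sin θ ^ n) *
          F r (‖w‖ * (r * Real.cos θ)) := by
  rw [lintegral_axial w hF]
  congr 1
  have hm : Measurable (Function.uncurry fun t ρ : ℝ =>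
      ENNReal.ofReal (ρ ^ n) * F (√(t ^ 2 + ρ ^ 2)) (‖w‖ * t)) := by
    refine Measurable.mul (by fun_prop) (hF.comp
      (by fun_prop : Measurable fun p : ℝ × ℝ => (√(p.1 ^ 2 + p.2 ^ 2), ‖w‖ * p.1)))
  have e : ∀ ρ : ℝ, ENNReal.ofReal (ρ ^ n) * ∫⁻ t : ℝ, F (√(t ^ 2 + ρ ^ 2)) (‖w‖ * t) =
      ∫⁻ t : ℝ, ENNReal.ofReal (ρ ^ n) * F (√(t ^ 2 + ρ ^ 2)) (‖w‖ * t) := fun ρ => by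
    rw [lintegral_const_mul' _ _ ENNReal.ofReal_ne_top]
  simp_rw [e]
  rw [lintegral_upperHalfPlane_polar hm]
  refine setLIntegral_congr_fun measurableSet_Ioi fun r hr => ?_
  refine setLIntegral_congr_fun measurableSet_Ioo fun θ hθ => ?_
  have hr : 0 < r := hr
  have hs := Real.sin_pos_of_mem_Ioo hθ
  have e1 : (r * Real.cos θ) ^ 2 + (r * Real.sin θ) ^ 2 = r ^ 2 := by
    linear_combination r ^ 2 * Real.cos_sq_add_sin_sq θ
  rw [e1, Real.sqrt_sq hr.le, ← mul_assoc, ← ENNReal.ofReal_mul hr.le,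
    ← ENNReal.ofReal_mul (by positivity)]
  congr 2
  ring

/-! ### Hyperbolas: the invariant measure and the fibers of the energy difference -/

section OneDim

/-- The energy of the point of the hyperbola `E² = q + t²` on the line `τ E - a t = c`. -/
def lineE (a τ q c : ℝ) : ℝ :=
  (a * √((a ^ 2 - τ ^ 2) * q + c ^ 2) - τ * c) / (a ^ 2 - τ ^ 2)

/-- The momentum of the point of the hyperbola `E² = q + t²` on the line `τ E - a t = c`. -/
def lineT (a τ q c : ℝ) : ℝ :=
  (τ * √((a ^ 2 - τ ^ 2) * q + c ^ 2) - a * c) / (a ^ 2 - τ ^ 2)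

variable {a τ q : ℝ}

theorem sq_sub_sq_pos_of_abs_lt (h : |τ| < a) : 0 < a ^ 2 - τ ^ 2 := by
  have := sq_lt_sq' (abs_lt.1 h).1 (abs_lt.1 h).2
  linarith

theorem abs_lt_sqrt_add_sq {c p : ℝ} (hp : 0 < p) : |c| < √(p + c ^ 2) := by
  rw [← Real.sqrt_sq_eq_abs]
  exact Real.sqrt_lt_sqrt (sq_nonneg _) (by linarith)

theorem mul_lt_mul_of_abs_lt {x y : ℝ} (h : |τ| < a) (hxy : |x| < y) : τ * x < a * y := by
  have h1 : τ * x ≤ |τ| * |x| := by rw [← abs_mul]; exact le_abs_self _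
  have h2 : |τ| * |x| ≤ |τ| * y := by gcongr
  have h3 : |τ| * y < a * y := by
    have : 0 < y := (abs_nonneg x).trans_lt hxy
    gcongr
  linarith

theorem lineE_pos (h : |τ| < a) (hq : 0 < q) (c : ℝ) : 0 < lineE a τ q c := by
  have hv := sq_sub_sq_pos_of_abs_lt h
  have := mul_lt_mul_of_abs_lt h (abs_lt_sqrt_add_sq (c := c) (mul_pos hv hq))
  exact div_pos (by linarith) hv

theorem sqrt_add_lineT_sq (h : |τ| < a) (hq : 0 < q) (c : ℝ) :
    √(q + lineT a τ q c ^ 2) = lineE a τ q c := by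
  have hv := sq_sub_sq_pos_of_abs_lt h
  rw [Real.sqrt_eq_iff_eq_sq (by positivity) (lineE_pos h hq c).le]
  have hs : √((a ^ 2 - τ ^ 2) * q + c ^ 2) ^ 2 = (a ^ 2 - τ ^ 2) * q + c ^ 2 :=
    Real.sq_sqrt (by positivity)
  unfold lineE lineT
  generalize √((a ^ 2 - τ ^ 2) * q + c ^ 2) = S at *
  rw [div_pow, div_pow]
  field_simp
  linear_combination (τ ^ 2 - a ^ 2) * hs

theorem lineE_lineT (h : |τ| < a) (c : ℝ) :
    τ * lineE a τ q c - a * lineT a τ q c = c := by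
  have hv := sq_sub_sq_pos_of_abs_lt h
  unfold lineE lineT
  field_simp
  ring

/-- The coordinate `c = τE - at` is strictly monotone along the hyperbola because `|τ| < a` and `|t|
< E`. The identity behind the inversion is `(a² - τ²)q + (τE - at)² = (aE - τt)²`, with `aE - τt >
0`. -/
theorem lineT_of_line (h : |τ| < a) (hq : 0 < q) (t : ℝ) :
    lineT a τ q (τ * √(q + t ^ 2) - a * t) = t := by
  have hv := sq_sub_sq_pos_of_abs_lt h
  have hE : √(q + t ^ 2) ^ 2 = q + t ^ 2 := Real.sq_sqrt (by positivity)
  have hlt := mul_lt_mul_of_abs_lt h (abs_lt_sqrt_add_sq (c := t) hq)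
  have e : √((a ^ 2 - τ ^ 2) * q + (τ * √(q + t ^ 2) - a * t) ^ 2) = a * √(q + t ^ 2) - τ * t := by
    rw [Real.sqrt_eq_iff_eq_sq (by positivity) (by linarith)]
    linear_combination (τ ^ 2 - a ^ 2) * hE
  unfold lineT
  rw [e]
  field_simp
  ring

/-- The derivative carries a factor `E`, which cancels the `1 / E` of the invariant measure and
leaves `dc / √((a² - τ²)q + c²)`. -/
theorem hasDerivAt_lineT (h : |τ| < a) (hq : 0 < q) (c : ℝ) :
    HasDerivAt (lineT a τ q) (-(lineE a τ q c / √((a ^ 2 - τ ^ 2) * q + c ^ 2))) c := by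
  have hv := sq_sub_sq_pos_of_abs_lt h
  have hp : 0 < (a ^ 2 - τ ^ 2) * q + c ^ 2 := by positivity
  have h1 : HasDerivAt (fun c : ℝ => (a ^ 2 - τ ^ 2) * q + c ^ 2) (2 * c) c := by
    simpa using ((hasDerivAt_id c).pow 2).const_add ((a ^ 2 - τ ^ 2) * q)
  have h2 := ((h1.sqrt hp.ne').const_mul τ).sub ((hasDerivAt_id c).const_mul a)
  have h3 := h2.div_const (a ^ 2 - τ ^ 2)
  refine h3.congr_deriv ?_
  have hS := Real.sqrt_pos.2 hp
  unfold lineE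
  field_simp
  ring

/-- The invariant measure of a hyperbola in the coordinate `τ E - a t`. -/
theorem lintegral_hyperbola (h : |τ| < a) (hq : 0 < q) (H : ℝ → ℝ → ℝ≥0∞) :
    ∫⁻ t : ℝ, ENNReal.ofReal (1 / √(q + t ^ 2)) * H (√(q + t ^ 2)) t =
      ∫⁻ c : ℝ, ENNReal.ofReal (1 / √((a ^ 2 - τ ^ 2) * q + c ^ 2)) *
        H (lineE a τ q c) (lineT a τ q c) := by
  have hv := sq_sub_sq_pos_of_abs_lt h
  have himg : lineT a τ q '' univ = univ := by
    rw [image_univ]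
    exact range_eq_univ.2 fun t => ⟨_, lineT_of_line h hq t⟩
  have hinj : InjOn (lineT a τ q) univ := by
    intro c _ c' _ hcc
    rw [← lineE_lineT (q := q) h c, ← lineE_lineT (q := q) h c', ← sqrt_add_lineT_sq h hq,
      ← sqrt_add_lineT_sq h hq, hcc]
  have := lintegral_image_eq_lintegral_abs_deriv_mul MeasurableSet.univ
    (fun c _ => (hasDerivAt_lineT h hq c).hasDerivWithinAt) hinj
    (fun t => ENNReal.ofReal (1 / √(q + t ^ 2)) * H (√(q + t ^ 2)) t)
  rw [himg, Measure.restrict_univ] at this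
  rw [this]
  refine lintegral_congr fun c => ?_
  have hE := lineE_pos h hq c
  rw [sqrt_add_lineT_sq h hq, ← mul_assoc, ← ENNReal.ofReal_mul (abs_nonneg _), abs_neg,
    abs_of_nonneg (by positivity)]
  congr 2
  field_simp

/-- `√(1 + 4q / (a² - τ²))`. -/
def fibS (a τ q : ℝ) : ℝ := √(1 + 4 * q / (a ^ 2 - τ ^ 2))

/-- The larger-index energy on the fiber `E₁ - E₂ = τ`, `t₁ - t₂ = a`. -/
def fibE (a τ q : ℝ) : ℝ := (τ + a * fibS a τ q) / 2

/-- The momentum `t₁` on the fiber `E₁ - E₂ = τ`, `t₁ - t₂ = a`. -/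
def fibT (a τ q : ℝ) : ℝ := (a + τ * fibS a τ q) / 2

/-- The density of the fiber measure. -/
def fibDens (a τ q : ℝ) : ℝ :=
  2 * (fibE a τ q * (fibE a τ q - τ)) / ((a ^ 2 - τ ^ 2) * fibS a τ q)

theorem fibS_sq (h : |τ| < a) (hq : 0 < q) : fibS a τ q ^ 2 = 1 + 4 * q / (a ^ 2 - τ ^ 2) := by
  have hv := sq_sub_sq_pos_of_abs_lt h
  exact Real.sq_sqrt (by positivity)

theorem one_lt_fibS (h : |τ| < a) (hq : 0 < q) : 1 < fibS a τ q := by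
  have hv := sq_sub_sq_pos_of_abs_lt h
  unfold fibS
  rw [Real.lt_sqrt zero_le_one]
  have : 0 < 4 * q / (a ^ 2 - τ ^ 2) := by positivity
  linarith

theorem fibE_pos (h : |τ| < a) (hq : 0 < q) : 0 < fibE a τ q := by
  have := one_lt_fibS h hq
  have h1 := abs_lt.1 h
  have h2 : 0 < a := (abs_nonneg _).trans_lt h
  unfold fibE
  nlinarith

theorem fibE_sub_pos (h : |τ| < a) (hq : 0 < q) : 0 < fibE a τ q - τ := by
  have := one_lt_fibS h hq
  have h1 := abs_lt.1 h
  have h2 : 0 < a := (abs_nonneg _).trans_lt h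
  unfold fibE
  nlinarith

/-- On the fiber `E₁² - E₂² = t₁² - t₂²` reads `τ(E₁ + E₂) = a(t₁ + t₂)`, so `E₁ + E₂ = aS` and `t₁
+ t₂ = τS` for some `S`. The mass-shell condition then fixes `(a² - τ²)S² = a² - τ² + 4q`. -/
theorem sqrt_add_fibT_sq (h : |τ| < a) (hq : 0 < q) :
    √(q + fibT a τ q ^ 2) = fibE a τ q := by
  have hv := sq_sub_sq_pos_of_abs_lt h
  rw [Real.sqrt_eq_iff_eq_sq (by positivity) (fibE_pos h hq).le]
  have hS := fibS_sq h hq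
  have : (a ^ 2 - τ ^ 2) * fibS a τ q ^ 2 = (a ^ 2 - τ ^ 2) + 4 * q := by
    rw [hS]; field_simp
  unfold fibT fibE
  linear_combination -this / 4

theorem sqrt_add_fibT_sub_sq (h : |τ| < a) (hq : 0 < q) :
    √(q + (fibT a τ q - a) ^ 2) = fibE a τ q - τ := by
  have hv := sq_sub_sq_pos_of_abs_lt h
  rw [Real.sqrt_eq_iff_eq_sq (by positivity) (fibE_sub_pos h hq).le]
  have hS := fibS_sq h hq
  have : (a ^ 2 - τ ^ 2) * fibS a τ q ^ 2 = (a ^ 2 - τ ^ 2) + 4 * q := by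
    rw [hS]; field_simp
  unfold fibT fibE
  linear_combination -this / 4

theorem fibDens_pos (h : |τ| < a) (hq : 0 < q) : 0 < fibDens a τ q := by
  have hv := sq_sub_sq_pos_of_abs_lt h
  have h1 := fibE_pos h hq
  have h2 := fibE_sub_pos h hq
  have h3 := one_lt_fibS h hq
  unfold fibDens
  positivity

/-- The fiber density is the Jacobian of `τ ↦ t₁` at fixed `a` and `q`. -/
theorem hasDerivAt_fibT (h : |τ| < a) (hq : 0 < q) :
    HasDerivAt (fun τ => fibT a τ q) (fibDens a τ q) τ := by
  have hv := sq_sub_sq_pos_of_abs_lt h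
  have h1 : HasDerivAt (fun τ : ℝ => a ^ 2 - τ ^ 2) (-(2 * τ)) τ := by
    simpa using ((hasDerivAt_id τ).pow 2).const_sub (a ^ 2)
  have h2 : HasDerivAt (fun τ : ℝ => 1 + 4 * q / (a ^ 2 - τ ^ 2))
      (4 * q * (2 * τ) / (a ^ 2 - τ ^ 2) ^ 2) τ := by
    refine (((hasDerivAt_const τ (4 * q)).div h1 hv.ne').const_add 1).congr_deriv ?_
    ring
  have hp : 0 < 1 + 4 * q / (a ^ 2 - τ ^ 2) := by positivity
  have h3 := ((((hasDerivAt_id τ).mul (h2.sqrt hp.ne')).const_add a).div_const 2)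
  refine h3.congr_deriv ?_
  have hS := fibS_sq h hq
  have hS1 := one_lt_fibS h hq
  have this : (a ^ 2 - τ ^ 2) * fibS a τ q ^ 2 = (a ^ 2 - τ ^ 2) + 4 * q := by
    rw [hS]; field_simp
  change (1 * fibS a τ q + id τ * (_ / (2 * fibS a τ q))) / 2 = _
  unfold fibDens fibE
  simp only [id]
  generalize fibS a τ q = S at *
  have hS0 : S ≠ 0 := by linarith
  field_simp
  linear_combination (-τ ^ 2) * this

theorem abs_sqrt_sub_sqrt_lt (ha : 0 < a) (hq : 0 < q) (t : ℝ) :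
    |√(q + t ^ 2) - √(q + (t - a) ^ 2)| < a := by
  have h1 : √(q + t ^ 2) ^ 2 = q + t ^ 2 := Real.sq_sqrt (by positivity)
  have h2 : √(q + (t - a) ^ 2) ^ 2 = q + (t - a) ^ 2 := Real.sq_sqrt (by positivity)
  have h3 := abs_lt.1 (abs_lt_sqrt_add_sq (c := t) hq)
  have h4 := abs_lt.1 (abs_lt_sqrt_add_sq (c := t - a) hq)
  rw [abs_lt]
  constructor <;> nlinarith

theorem fibT_of_sub (ha : 0 < a) (hq : 0 < q) (t : ℝ) :
    fibT a (√(q + t ^ 2) - √(q + (t - a) ^ 2)) q = t := by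
  have hlt := abs_sqrt_sub_sqrt_lt ha hq t
  have hv := sq_sub_sq_pos_of_abs_lt hlt
  have h1 : √(q + t ^ 2) ^ 2 = q + t ^ 2 := Real.sq_sqrt (by positivity)
  have h2 : √(q + (t - a) ^ 2) ^ 2 = q + (t - a) ^ 2 := Real.sq_sqrt (by positivity)
  have p1 : 0 < √(q + t ^ 2) := Real.sqrt_pos.2 (by positivity)
  have p2 : 0 < √(q + (t - a) ^ 2) := Real.sqrt_pos.2 (by positivity)
  generalize √(q + t ^ 2) = A at *
  generalize √(q + (t - a) ^ 2) = B at *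
  -- The sum of the two energies is `aS`, as on every fiber.
  have hS : fibS a (A - B) q = (A + B) / a := by
    unfold fibS
    rw [Real.sqrt_eq_iff_eq_sq (by positivity) (by positivity)]
    rw [div_pow, eq_div_iff (by positivity), ← sub_eq_zero]
    have : q = (A ^ 2 + B ^ 2 - t ^ 2 - (t - a) ^ 2) / 2 := by linarith
    have ht : t = (A ^ 2 - B ^ 2 + a ^ 2) / (2 * a) := by
      field_simp; linarith
    rw [this]
    field_simp
    rw [ht]
    field_simp
    ring
  unfold fibT
  rw [hS]
  field_simp
  linear_combination h1 - h2

/-- Change of variables `t ↦ τ = √(q + t²) - √(q + (t - a)²)`. -/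
theorem lintegral_fiber (ha : 0 < a) (hq : 0 < q) (K : ℝ → ℝ → ℝ≥0∞) :
    ∫⁻ t : ℝ, K (√(q + t ^ 2)) (√(q + (t - a) ^ 2)) =
      ∫⁻ τ in Ioo (-a) a, ENNReal.ofReal (fibDens a τ q) * K (fibE a τ q) (fibE a τ q - τ) := by
  have hmem : ∀ τ ∈ Ioo (-a) a, |τ| < a := fun τ h => abs_lt.2 h
  have himg : (fun τ => fibT a τ q) '' Ioo (-a) a = univ := by
    refine eq_univ_of_forall fun t => ⟨_, abs_lt.1 (abs_sqrt_sub_sqrt_lt ha hq t),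
      fibT_of_sub ha hq t⟩
  have hinj : InjOn (fun τ => fibT a τ q) (Ioo (-a) a) := by
    intro c hc c' hc' hcc
    simp only at hcc
    have e : ∀ c ∈ Ioo (-a) a, c = √(q + fibT a c q ^ 2) - √(q + (fibT a c q - a) ^ 2) := by
      intro c hc
      rw [sqrt_add_fibT_sq (hmem c hc) hq, sqrt_add_fibT_sub_sq (hmem c hc) hq]
      ring
    rw [e c hc, e c' hc', hcc]
  have := lintegral_image_eq_lintegral_abs_deriv_mul measurableSet_Ioo
    (fun c hc => (hasDerivAt_fibT (hmem c hc) hq).hasDerivWithinAt) hinj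
    (fun t => K (√(q + t ^ 2)) (√(q + (t - a) ^ 2)))
  rw [himg, Measure.restrict_univ] at this
  rw [this]
  refine setLIntegral_congr_fun measurableSet_Ioo fun τ hτ => ?_
  rw [sqrt_add_fibT_sq (hmem τ hτ) hq, sqrt_add_fibT_sub_sq (hmem τ hτ) hq,
    abs_of_pos (fibDens_pos (hmem τ hτ) hq)]

end OneDim

/-! ### The mass shell: Minkowski products, disintegration and Lorentz boosts -/

section MassShell

variable {n d : ℕ} {m : ℝ}

/-- The energy `√(m² + |η|²)`. -/
def en (m : ℝ) (η : Space d) : ℝ := phi m ‖η‖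

/-- The Minkowski product of the points of the mass shell above `η` and `ζ`. -/
def mdot (m : ℝ) (η ζ : Space d) : ℝ := en m η * en m ζ - inner ℝ η ζ

theorem phi_pos (hm : 0 < m) (r : ℝ) : 0 < phi m r :=
  Real.sqrt_pos.2 (add_pos_of_pos_of_nonneg (pow_pos hm 2) (sq_nonneg r))

theorem en_pos (hm : 0 < m) (η : Space d) : 0 < en m η := phi_pos hm _

theorem en_sq (η : Space d) : en m η ^ 2 = m ^ 2 + ‖η‖ ^ 2 := Real.sq_sqrt (by positivity)

theorem norm_lt_en (hm : 0 < m) (η : Space d) : ‖η‖ < en m η := by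
  have := abs_lt_sqrt_add_sq (c := ‖η‖) (pow_pos hm 2)
  rwa [abs_of_nonneg (norm_nonneg _)] at this

theorem le_en (η : Space d) : m ≤ en m η := by
  refine Real.le_sqrt_of_sq_le ?_
  have := sq_nonneg ‖η‖
  linarith

theorem mdot_comm (η ζ : Space d) : mdot m η ζ = mdot m ζ η := by
  unfold mdot
  rw [mul_comm, real_inner_comm]

@[fun_prop]
theorem continuous_phi (m : ℝ) : Continuous (phi m) := by unfold phi; fun_prop

@[fun_prop]
theorem continuous_en (m : ℝ) : Continuous (en m : Space d → ℝ) := by unfold en; fun_prop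

theorem continuous_mdot (m : ℝ) : Continuous fun p : Space d × Space d => mdot m p.1 p.2 := by
  unfold mdot; fun_prop

/-- The reversed Cauchy–Schwarz inequality for two timelike vectors of mass `m`; at the level of
norms the slack in the squares is `m²(|η| - |ζ|)²`. -/
theorem sq_le_mdot (hm : 0 < m) (η ζ : Space d) : m ^ 2 ≤ mdot m η ζ := by
  have h1 := en_sq (m := m) η
  have h2 := en_sq (m := m) ζ
  have p1 := en_pos hm η
  have p2 := en_pos hm ζ
  have h3 : m ^ 2 + ‖η‖ * ‖ζ‖ ≤ en m η * en m ζ := by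
    refine abs_le_of_sq_le_sq' ?_ (by positivity) |>.2
    rw [mul_pow, h1, h2]
    nlinarith [sq_nonneg (m * (‖η‖ - ‖ζ‖))]
  have h4 := real_inner_le_norm η ζ
  unfold mdot
  linarith

/-- Expands the Minkowski square of `p₁ - p₂`. It makes the symbol of `□` on a fiber a function of
the Minkowski product alone. -/
theorem sq_norm_sub_sub_sq (η ζ : Space d) :
    ‖η - ζ‖ ^ 2 - (en m η - en m ζ) ^ 2 = 2 * (mdot m η ζ - m ^ 2) := by
  have h1 := en_sq (m := m) η
  have h2 := en_sq (m := m) ζ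
  rw [norm_sub_sq_real]
  unfold mdot
  linear_combination -h1 - h2

theorem abs_en_sub_lt (hm : 0 < m) {η ζ : Space d} (h : η ≠ ζ) :
    |en m η - en m ζ| < ‖η - ζ‖ := by
  have h1 := en_sq (m := m) η
  have h2 := en_sq (m := m) ζ
  have p1 := norm_lt_en hm η
  have p2 := norm_lt_en hm ζ
  have hpos : 0 < ‖η - ζ‖ := norm_pos_iff.2 (sub_ne_zero.2 h)
  have h3 : |‖η‖ - ‖ζ‖| ≤ ‖η - ζ‖ := abs_norm_sub_norm_le η ζ
  have h4 := abs_le.1 h3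
  have n1 := norm_nonneg η
  have n2 := norm_nonneg ζ
  rw [abs_lt]
  constructor <;> nlinarith

/-- The integral over the fiber `p₁ - p₂ = (τ, ξ)`, `|ξ| = a`, of a function of the energies. -/
def fibInt (n : ℕ) (m a τ : ℝ) (F : ℝ → ℝ → ℝ≥0∞) : ℝ≥0∞ :=
  sph n * ∫⁻ ρ in Ioi (0 : ℝ), ENNReal.ofReal (ρ ^ n) *
    (ENNReal.ofReal (fibDens a τ (m ^ 2 + ρ ^ 2)) *
      F (fibE a τ (m ^ 2 + ρ ^ 2)) (fibE a τ (m ^ 2 + ρ ^ 2) - τ))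

@[fun_prop]
theorem measurable_fibE {α : Type*} [MeasurableSpace α] {f g h : α → ℝ} (hf : Measurable f)
    (hg : Measurable g) (hh : Measurable h) : Measurable fun x => fibE (f x) (g x) (h x) := by
  unfold fibE fibS; fun_prop

@[fun_prop]
theorem measurable_fibDens {α : Type*} [MeasurableSpace α] {f g h : α → ℝ} (hf : Measurable f)
    (hg : Measurable g) (hh : Measurable h) : Measurable fun x => fibDens (f x) (g x) (h x) := by
  unfold fibDens fibS; fun_prop

/-- Disintegration of `dη₁ dη₂` along `(E₁ - E₂, η₁ - η₂)`. -/
theorem lintegral_pair_fiber (hm : 0 < m) {K : ℝ → ℝ → Space (n + 2) → ℝ≥0∞}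
    (hK : Measurable fun p : ℝ × ℝ × Space (n + 2) => K p.1 p.2.1 p.2.2) :
    ∫⁻ η : Space (n + 2), ∫⁻ ζ : Space (n + 2), K (en m η) (en m ζ) (η - ζ) =
      ∫⁻ ξ : Space (n + 2), ∫⁻ τ in Ioo (-‖ξ‖) ‖ξ‖, fibInt n m ‖ξ‖ τ fun x y => K x y ξ := by
  have e1 : ∀ η : Space (n + 2), ∫⁻ ζ : Space (n + 2), K (en m η) (en m ζ) (η - ζ) =
      ∫⁻ ξ : Space (n + 2), K (en m η) (en m (η - ξ)) ξ := by
    intro η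
    rw [← lintegral_sub_left_eq_self _ η]
    simp
  simp_rw [e1]
  rw [lintegral_lintegral_swap]
  swap
  · refine (hK.comp (f := fun p : Space (n + 2) × Space (n + 2) =>
      (en m p.1, en m (p.1 - p.2), p.2)) ?_).aemeasurable
    fun_prop
  have h0 : ∀ᵐ ξ : Space (n + 2), ξ ≠ 0 := by
    simp [ae_iff, measure_singleton]
  refine lintegral_congr_ae ?_
  filter_upwards [h0] with ξ hξ
  have ha : 0 < ‖ξ‖ := norm_pos_iff.2 hξ
  have e2 : ∀ η : Space (n + 2), K (en m η) (en m (η - ξ)) ξ =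
      K (phi m ‖η‖) (√(m ^ 2 + (‖η‖ ^ 2 - 2 * inner ℝ ξ η + ‖ξ‖ ^ 2))) ξ := by
    intro η
    have : en m (η - ξ) = √(m ^ 2 + (‖η‖ ^ 2 - 2 * inner ℝ ξ η + ‖ξ‖ ^ 2)) := by
      unfold en phi
      rw [norm_sub_sq_real, real_inner_comm]
    rw [this]
    rfl
  simp_rw [e2]
  -- In cylindrical coordinates about `ξ` the transverse radius `ρ` enters only through `q = m² +
  -- ρ²`, so what remains is the one-dimensional change of variables `t ↦ τ`.
  rw [lintegral_axial ξ (F := fun r s => K (phi m r) (√(m ^ 2 + (r ^ 2 - 2 * s + ‖ξ‖ ^ 2))) ξ)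
    (hK.comp (f := fun p : ℝ × ℝ =>
      (phi m p.1, √(m ^ 2 + (p.1 ^ 2 - 2 * p.2 + ‖ξ‖ ^ 2)), ξ)) (by fun_prop))]
  unfold fibInt
  rw [lintegral_const_mul' _ _ (sph_ne_top n), lintegral_lintegral_swap]
  · congr 1
    refine setLIntegral_congr_fun measurableSet_Ioi fun ρ hρ => ?_
    simp only []
    rw [lintegral_const_mul' _ _ ENNReal.ofReal_ne_top]
    congr 1
    have hq : 0 < m ^ 2 + ρ ^ 2 := by positivity
    rw [← lintegral_fiber ha hq (fun x y => K x y ξ)]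
    refine lintegral_congr fun t => ?_
    have hs : √(t ^ 2 + ρ ^ 2) ^ 2 = t ^ 2 + ρ ^ 2 := Real.sq_sqrt (by positivity)
    unfold phi
    rw [hs]
    congr 2 <;> ring
  · refine Measurable.aemeasurable ?_
    refine Measurable.mul (by fun_prop) (Measurable.mul (by fun_prop) ?_)
    refine hK.comp (f := fun p : ℝ × ℝ => (fibE ‖ξ‖ p.1 (m ^ 2 + p.2 ^ 2),
      fibE ‖ξ‖ p.1 (m ^ 2 + p.2 ^ 2) - p.1, ξ)) ?_
    fun_prop

/-- The section of the mass shell by the plane `p · (τ, ξ) = c` with `|τ| < |ξ|`. -/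
theorem lintegral_massShell_section (hm : 0 < m) (ξ : Space (n + 2)) {τ : ℝ} (h : |τ| < ‖ξ‖)
    {H : ℝ → ℝ → ℝ≥0∞} (hH : Measurable (Function.uncurry H)) :
    ∫⁻ η : Space (n + 2), ENNReal.ofReal (1 / en m η) * H (en m η) (τ * en m η - inner ℝ ξ η) =
      ∫⁻ c : ℝ, sph n * ∫⁻ ρ in Ioi (0 : ℝ), ENNReal.ofReal (ρ ^ n) *
        (ENNReal.ofReal (1 / √((‖ξ‖ ^ 2 - τ ^ 2) * (m ^ 2 + ρ ^ 2) + c ^ 2)) *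
          H (lineE ‖ξ‖ τ (m ^ 2 + ρ ^ 2) c) c) := by
  have hmeas : Measurable (Function.uncurry fun r s : ℝ =>
      ENNReal.ofReal (1 / phi m r) * H (phi m r) (τ * phi m r - s)) :=
    Measurable.mul (by fun_prop)
      (hH.comp (f := fun p : ℝ × ℝ => (phi m p.1, τ * phi m p.1 - p.2)) (by fun_prop))
  have := lintegral_axial ξ hmeas
  unfold en
  rw [this, lintegral_const_mul' _ _ (sph_ne_top n), lintegral_lintegral_swap]
  · congr 1
    refine setLIntegral_congr_fun measurableSet_Ioi fun ρ hρ => ?_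
    rw [lintegral_const_mul' _ _ ENNReal.ofReal_ne_top]
    congr 1
    have hq : 0 < m ^ 2 + ρ ^ 2 := by positivity
    have e := lintegral_hyperbola h hq (fun E t => H E (τ * E - ‖ξ‖ * t))
    simp only [lineE_lineT h] at e
    rw [← e]
    refine lintegral_congr fun t => ?_
    have hs : √(t ^ 2 + ρ ^ 2) ^ 2 = t ^ 2 + ρ ^ 2 := Real.sq_sqrt (by positivity)
    unfold phi
    rw [hs, show m ^ 2 + (t ^ 2 + ρ ^ 2) = m ^ 2 + ρ ^ 2 + t ^ 2 by ring]
  · refine Measurable.aemeasurable ?_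
    refine Measurable.mul (by fun_prop) (Measurable.mul (by fun_prop) ?_)
    refine hH.comp (f := fun p : ℝ × ℝ => (lineE ‖ξ‖ τ (m ^ 2 + p.2 ^ 2) p.1, p.1)) ?_
    unfold lineE
    fun_prop

/-- Lorentz invariance of `dt / E` in one space dimension: the case `a = ch`, `τ = sh` of
`lintegral_hyperbola`, read at `c = -t`. -/
theorem lintegral_hyperbola_boost {q ch sh : ℝ} (hq : 0 < q) (h : |sh| < ch)
    (hcs : ch ^ 2 - sh ^ 2 = 1) (H : ℝ → ℝ → ℝ≥0∞) :
    ∫⁻ t : ℝ, ENNReal.ofReal (1 / √(q + t ^ 2)) * H (√(q + t ^ 2)) t =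
      ∫⁻ t : ℝ, ENNReal.ofReal (1 / √(q + t ^ 2)) *
        H (ch * √(q + t ^ 2) + sh * t) (sh * √(q + t ^ 2) + ch * t) := by
  rw [lintegral_hyperbola h hq, ← lintegral_neg_eq_self]
  refine lintegral_congr fun t => ?_
  unfold lineE lineT
  rw [hcs]
  simp [sub_neg_eq_add]

theorem en_headTail (m : ℝ) (η : Space (n + 1)) :
    en m η = √(m ^ 2 + ‖(headTail n η).2‖ ^ 2 + (headTail n η).1 ^ 2) := by
  unfold en phi
  rw [norm_sq_headTail]
  congr 1
  ring

/-- Passing to the center-of-mass frame of two points of the mass shell. -/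
theorem exists_centerOfMass (hm : 0 < m) (η ζ : Space (n + 1)) :
    ∃ u : Space (n + 1), ‖u‖ ^ 2 = (mdot m η ζ - m ^ 2) / 2 ∧
      ∀ K : ℝ → ℝ → ℝ≥0∞, Measurable (Function.uncurry K) →
        ∫⁻ x : Space (n + 1), ENNReal.ofReal (1 / en m x) * K (mdot m η x) (mdot m ζ x) =
          ∫⁻ x : Space (n + 1), ENNReal.ofReal (1 / en m x) *
            K (√(2 * m ^ 2 + 2 * mdot m η ζ) / 2 * en m x + inner ℝ u x)
              (√(2 * m ^ 2 + 2 * mdot m η ζ) / 2 * en m x - inner ℝ u x) := by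
  -- With the total momentum on the first axis, the transverse momenta of the two points are
  -- opposite and a boost along that axis suffices.
  obtain ⟨R, hR⟩ := exists_isometry_axis (η + ζ)
  have hX := sq_le_mdot hm η ζ
  have hM2 : √(2 * m ^ 2 + 2 * mdot m η ζ) ^ 2 = 2 * m ^ 2 + 2 * mdot m η ζ :=
    Real.sq_sqrt (by nlinarith [sq_nonneg m])
  have hM0 : 0 < √(2 * m ^ 2 + 2 * mdot m η ζ) := Real.sqrt_pos.2 (by nlinarith [pow_pos hm 2])
  set M := √(2 * m ^ 2 + 2 * mdot m η ζ) with hM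
  have hsum : headTail n (R η) + headTail n (R ζ) = (‖η + ζ‖, 0) := by
    rw [← headTail_single, ← hR, map_add]
    rfl
  have hin := R.inner_map_map η ζ
  have hen1 : en m (R η) = en m η := by unfold en; rw [R.norm_map]
  have hen2 : en m (R ζ) = en m ζ := by unfold en; rw [R.norm_map]
  have hE1 := en_sq (m := m) (R η)
  have hE2 := en_sq (m := m) (R ζ)
  rw [norm_sq_headTail, hen1] at hE1
  rw [norm_sq_headTail, hen2] at hE2
  rw [inner_headTail] at hin
  have hdot : mdot m η ζ = en m η * en m ζ - inner ℝ η ζ := rfl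
  have hin1 : ∀ x, mdot m η x = en m η * en m (R x) - ((headTail n (R η)).1 * (headTail n (R x)).1
      + inner ℝ (headTail n (R η)).2 (headTail n (R x)).2) := by
    intro x
    rw [← inner_headTail, R.inner_map_map]
    unfold mdot en; rw [R.norm_map]
  have hin2 : ∀ x, mdot m ζ x = en m ζ * en m (R x) - ((headTail n (R ζ)).1 * (headTail n (R x)).1
      + inner ℝ (headTail n (R ζ)).2 (headTail n (R x)).2) := by
    intro x
    rw [← inner_headTail, R.inner_map_map]
    unfold mdot en; rw [R.norm_map]
  have hp := norm_add_le η ζ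
  have hl1 := norm_lt_en hm η
  have hl2 := norm_lt_en hm ζ
  generalize headTail n (R η) = A at *
  generalize headTail n (R ζ) = B at *
  obtain ⟨x1, y1⟩ := A
  obtain ⟨x2, y2⟩ := B
  simp only [Prod.mk_add_mk, Prod.mk.injEq] at hsum
  obtain ⟨hs1, hs2⟩ := hsum
  have hy : y2 = -y1 := eq_neg_of_add_eq_zero_right hs2
  subst hy
  simp only [inner_neg_left, inner_neg_right, norm_neg, real_inner_self_eq_norm_sq] at *
  set P := ‖η + ζ‖ with hP
  set E1 := en m η with hE1d
  set E2 := en m ζ with hE2d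
  have hMM : M ^ 2 = (E1 + E2) ^ 2 - P ^ 2 := by
    rw [hM2, hdot]
    have : P ^ 2 = (x1 + x2) ^ 2 := by rw [hs1]
    rw [this]
    linear_combination 2 * hin - hE1 - hE2
  -- The boost to the rest frame of the pair has hyperbolic cosine `(E₁ + E₂) / M` and hyperbolic
  -- sine `P / M`. In that frame both energies are `M / 2`.
  have hcs : ((E1 + E2) / M) ^ 2 - (P / M) ^ 2 = 1 := by
    field_simp
    linarith
  have hlt : |P / M| < (E1 + E2) / M := by
    rw [abs_of_nonneg (by positivity)]
    gcongr
    linarith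
  have c1 : E1 * ((E1 + E2) / M) - x1 * (P / M) = M / 2 := by
    field_simp
    rw [hM2, hdot, ← hs1]
    linear_combination 2 * hE1 - 2 * hin
  have c2 : E2 * ((E1 + E2) / M) - x2 * (P / M) = M / 2 := by
    field_simp
    rw [hM2, hdot, ← hs1]
    linear_combination 2 * hE2 - 2 * hin
  have c3 : E2 * (P / M) - x2 * ((E1 + E2) / M) = -(E1 * (P / M) - x1 * ((E1 + E2) / M)) := by
    field_simp
    rw [← hs1]
    ring
  -- The witness is minus the boosted momentum of the first point, the sign matching `p · x = (M/2)
  -- E + ⟨u, x⟩`.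
  refine ⟨(headTail n).symm (E1 * (P / M) - x1 * ((E1 + E2) / M), -y1), ?_, ?_⟩
  · rw [norm_sq_headTail]
    simp only [MeasurableEquiv.apply_symm_apply, norm_neg]
    have : (mdot m η ζ - m ^ 2) / 2 = (M / 2) ^ 2 - m ^ 2 := by
      rw [div_pow, hM2]; ring
    rw [this, ← c1]
    have hE1' : E1 ^ 2 - x1 ^ 2 = m ^ 2 + ‖y1‖ ^ 2 := by linarith
    linear_combination -hE1' + (x1 ^ 2 - E1 ^ 2) * hcs
  · intro K hK
    have hmeas : ∀ α β α' β' : ℝ, ∀ y y' : Space n,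
        Measurable (Function.uncurry fun (t : ℝ) (w : Space n) =>
          ENNReal.ofReal (1 / √(m ^ 2 + ‖w‖ ^ 2 + t ^ 2)) *
            K (α * √(m ^ 2 + ‖w‖ ^ 2 + t ^ 2) - (β * t + inner ℝ y w))
              (α' * √(m ^ 2 + ‖w‖ ^ 2 + t ^ 2) - (β' * t + inner ℝ y' w))) := by
      intro α β α' β' y y'
      refine Measurable.mul (by fun_prop) (hK.comp (f := fun p : ℝ × Space n =>
        (α * √(m ^ 2 + ‖p.2‖ ^ 2 + p.1 ^ 2) - (β * p.1 + inner ℝ y p.2),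
          α' * √(m ^ 2 + ‖p.2‖ ^ 2 + p.1 ^ 2) - (β' * p.1 + inner ℝ y' p.2))) ?_)
      fun_prop
    have hL := lintegral_headTail (hmeas E1 x1 E2 x2 y1 (-y1))
    have hRr := lintegral_headTail (hmeas (M / 2) (-(E1 * (P / M) - x1 * ((E1 + E2) / M))) (M / 2)
      (E1 * (P / M) - x1 * ((E1 + E2) / M)) y1 (-y1))
    have hLr := lintegral_comp_isometry R (fun x => ENNReal.ofReal (1 / en m x) *
      K (E1 * en m x - (x1 * (headTail n x).1 + inner ℝ y1 (headTail n x).2))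
        (E2 * en m x - (x2 * (headTail n x).1 + -inner ℝ y1 (headTail n x).2)))
    have henR : ∀ x, en m (R x) = en m x := fun x => by unfold en; rw [R.norm_map]
    simp only [inner_neg_left] at hL hRr
    calc _ = ∫⁻ x, ENNReal.ofReal (1 / en m (R x)) *
          K (E1 * en m (R x) - (x1 * (headTail n (R x)).1 + inner ℝ y1 (headTail n (R x)).2))
          (E2 * en m (R x) - (x2 * (headTail n (R x)).1 + -inner ℝ y1 (headTail n (R x)).2)) := by
          refine lintegral_congr fun x => ?_
          rw [hin1, hin2, ← henR x]
      _ = ∫⁻ w : Space n, ∫⁻ t : ℝ, ENNReal.ofReal (1 / √(m ^ 2 + ‖w‖ ^ 2 + t ^ 2)) *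
            K (E1 * √(m ^ 2 + ‖w‖ ^ 2 + t ^ 2) - (x1 * t + inner ℝ y1 w))
              (E2 * √(m ^ 2 + ‖w‖ ^ 2 + t ^ 2) - (x2 * t + -inner ℝ y1 w)) := by
          rw [hLr, ← hL]
          simp only [en_headTail]
      _ = ∫⁻ w : Space n, ∫⁻ t : ℝ, ENNReal.ofReal (1 / √(m ^ 2 + ‖w‖ ^ 2 + t ^ 2)) *
            K (M / 2 * √(m ^ 2 + ‖w‖ ^ 2 + t ^ 2) -
                (-(E1 * (P / M) - x1 * ((E1 + E2) / M)) * t + inner ℝ y1 w))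
              (M / 2 * √(m ^ 2 + ‖w‖ ^ 2 + t ^ 2) -
                ((E1 * (P / M) - x1 * ((E1 + E2) / M)) * t + -inner ℝ y1 w)) := by
          refine lintegral_congr fun w => ?_
          have hq : 0 < m ^ 2 + ‖w‖ ^ 2 := by positivity
          have := lintegral_hyperbola_boost hq hlt hcs (fun E t =>
            K (E1 * E - (x1 * t + inner ℝ y1 w)) (E2 * E - (x2 * t + -inner ℝ y1 w)))
          rw [this]
          refine lintegral_congr fun t => ?_
          congr 2
          · rw [← c1]; ring
          · rw [← c2]
            linear_combination t * c3
      _ = _ := by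
          rw [← hRr]
          refine lintegral_congr fun x => ?_
          simp only [← en_headTail, inner_headTail, MeasurableEquiv.apply_symm_apply,
            inner_neg_left]
          congr 2; ring

end MassShell

/-! ### Two foliations of the triples `(p₁, p₂, p₄)` -/

section Exchange

variable {n : ℕ} {m : ℝ}

/-- The total energy of two points of the mass shell in their center-of-mass frame. -/
def comM (m : ℝ) (η ζ : Space n) : ℝ := √(2 * m ^ 2 + 2 * mdot m η ζ)

/-- The momentum of two points of the mass shell in their center-of-mass frame. -/
def comK (m : ℝ) (η ζ : Space n) : ℝ := √((mdot m η ζ - m ^ 2) / 2)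

/-- The momentum `√((M / 2 - c / M)² - m²)`. -/
def massR (m M c : ℝ) : ℝ := √((M / 2 - c / M) ^ 2 - m ^ 2)

@[fun_prop]
theorem measurable_mdot (m : ℝ) : Measurable fun p : Space n × Space n => mdot m p.1 p.2 :=
  (continuous_mdot m).measurable

theorem measurable_mdot_right (m : ℝ) (η : Space n) : Measurable fun x : Space n => mdot m η x :=
  (measurable_mdot m).comp (f := fun x : Space n => (η, x)) (by fun_prop)

theorem comM_sq (hm : 0 < m) (η ζ : Space n) : comM m η ζ ^ 2 = 2 * m ^ 2 + 2 * mdot m η ζ :=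
  Real.sq_sqrt (by nlinarith [sq_le_mdot hm η ζ, sq_nonneg m])

theorem comK_sq (hm : 0 < m) (η ζ : Space n) : comK m η ζ ^ 2 = (mdot m η ζ - m ^ 2) / 2 :=
  Real.sq_sqrt (by linarith [sq_le_mdot hm η ζ])

theorem comM_pos (hm : 0 < m) (η ζ : Space n) : 0 < comM m η ζ :=
  Real.sqrt_pos.2 (by nlinarith [sq_le_mdot hm η ζ, pow_pos hm 2])

theorem two_mul_le_comM (hm : 0 < m) (η ζ : Space n) : 2 * m ≤ comM m η ζ :=
  Real.le_sqrt_of_sq_le (by nlinarith [sq_le_mdot hm η ζ])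

/-- With `E = φ(r)` one has `r dr = E dE`, and `c = M²/2 - ME` gives `|dc| = M dE`. So `r^(k+1) dr /
E` becomes `r^k dc / M`. -/
theorem lintegral_energy_shift {M : ℝ} (hm : 0 < m) (hM : 0 < M) (k : ℕ) (G : ℝ → ℝ → ℝ≥0∞) :
    ∫⁻ r in Ioi (0 : ℝ), ENNReal.ofReal (r ^ (k + 1) / phi m r) * G r (M ^ 2 / 2 - M * phi m r) =
      ∫⁻ c in Iio (M ^ 2 / 2 - M * m), ENNReal.ofReal (massR m M c ^ k / M) * G (massR m M c) c := by
  have hE : ∀ c ∈ Iio (M ^ 2 / 2 - M * m), m < M / 2 - c / M := by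
    intro c hc
    have hc : c < M ^ 2 / 2 - M * m := hc
    have : M / 2 - c / M - m = (M ^ 2 / 2 - M * m - c) / M := by field_simp; ring
    have h2 : 0 < (M ^ 2 / 2 - M * m - c) / M := div_pos (by linarith) hM
    linarith
  have hpos : ∀ c ∈ Iio (M ^ 2 / 2 - M * m), 0 < (M / 2 - c / M) ^ 2 - m ^ 2 := by
    intro c hc
    nlinarith [hE c hc]
  have hR : ∀ c ∈ Iio (M ^ 2 / 2 - M * m), 0 < massR m M c := fun c hc =>
    Real.sqrt_pos.2 (hpos c hc)
  have hphi : ∀ c ∈ Iio (M ^ 2 / 2 - M * m), phi m (massR m M c) = M / 2 - c / M := by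
    intro c hc
    unfold phi massR
    rw [Real.sq_sqrt (hpos c hc).le, add_sub_cancel, Real.sqrt_sq (by linarith [hE c hc])]
  have hback : ∀ c ∈ Iio (M ^ 2 / 2 - M * m), M ^ 2 / 2 - M * phi m (massR m M c) = c := by
    intro c hc
    rw [hphi c hc]; field_simp; ring
  have himg : massR m M '' Iio (M ^ 2 / 2 - M * m) = Ioi 0 := by
    ext r
    constructor
    · rintro ⟨c, hc, rfl⟩
      exact hR c hc
    · intro hr
      have hr : 0 < r := hr
      refine ⟨M ^ 2 / 2 - M * phi m r, ?_, ?_⟩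
      · have : m < phi m r := by
          unfold phi
          rw [Real.lt_sqrt hm.le]
          nlinarith
        simp only [mem_Iio]
        nlinarith
      · unfold massR
        have e : M / 2 - (M ^ 2 / 2 - M * phi m r) / M = phi m r := by field_simp; ring
        rw [e]
        unfold phi
        rw [Real.sq_sqrt (by positivity), add_sub_cancel_left, Real.sqrt_sq hr.le]
  have hinj : InjOn (massR m M) (Iio (M ^ 2 / 2 - M * m)) := by
    intro c hc c' hc' h
    rw [← hback c hc, ← hback c' hc', h]
  have hder : ∀ c ∈ Iio (M ^ 2 / 2 - M * m), HasDerivWithinAt (massR m M)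
      (-((M / 2 - c / M) / (M * massR m M c))) (Iio (M ^ 2 / 2 - M * m)) c := by
    intro c hc
    have h1 : HasDerivAt (fun c : ℝ => M / 2 - c / M) (-(1 / M)) c :=
      ((hasDerivAt_id c).div_const M).const_sub (M / 2)
    have h2 := ((h1.pow 2).sub_const (m ^ 2)).sqrt (hpos c hc).ne'
    refine (h2.congr_deriv ?_).hasDerivWithinAt
    have := hR c hc
    change _ / (2 * massR m M c) = _
    simp only [Nat.cast_ofNat, Nat.add_one_sub_one, pow_one]
    generalize M / 2 - c / M = E
    field_simp
  have := lintegral_image_eq_lintegral_abs_deriv_mul measurableSet_Iio hder hinj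
    (fun r => ENNReal.ofReal (r ^ (k + 1) / phi m r) * G r (M ^ 2 / 2 - M * phi m r))
  rw [himg] at this
  rw [this]
  refine setLIntegral_congr_fun measurableSet_Iio fun c hc => ?_
  have h1 := hR c hc
  have h2 := hE c hc
  have h3 : 0 < M / 2 - c / M := by linarith
  rw [hback c hc, hphi c hc, ← mul_assoc, ← ENNReal.ofReal_mul (abs_nonneg _), abs_neg,
    abs_of_nonneg (by positivity)]
  congr 2
  generalize M / 2 - c / M = E at *
  field_simp
  ring

/-- The energy of the point of the fiber over `p₁ - p₂`, shifted by `c`. -/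
def secE (m : ℝ) (η : Space n) (c : ℝ) (p : Space n × ℝ) : ℝ :=
  lineE ‖η - p.1‖ (en m η - en m p.1) (m ^ 2 + p.2 ^ 2) (mdot m η p.1 - m ^ 2 + c)

/-- The density of the fiber over `p₁ - p₂`, shifted by `c`. -/
def secDens (k : ℕ) (m : ℝ) (η : Space n) (c : ℝ) (p : Space n × ℝ) : ℝ :=
  1 / en m p.1 * (p.2 ^ k * (1 / √((‖η - p.1‖ ^ 2 - (en m η - en m p.1) ^ 2) *
    (m ^ 2 + p.2 ^ 2) + (mdot m η p.1 - m ^ 2 + c) ^ 2)))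

/-- Integration over `p₂` and over the fiber over `p₁ - p₂`, shifted by `c`. -/
def thetaSec (m : ℝ) (η : Space (n + 2)) (F : ℝ → ℝ → ℝ≥0∞) (c : ℝ) : ℝ≥0∞ :=
  sph n * ∫⁻ p, ENNReal.ofReal (secDens n m η c p) * F (mdot m η p.1 - m ^ 2) (secE m η c p)
    ∂((volume : Measure (Space (n + 2))).prod (volume.restrict (Ioi (0 : ℝ))))

open Classical in
/-- The density of the energy shell of `p₁ + p₄`, shifted by `c`. -/
def comDens (k : ℕ) (m : ℝ) (η : Space n) (c : ℝ) (p : Space n × ℝ) : ℝ :=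
  if c < comM m η p.1 ^ 2 / 2 - comM m η p.1 * m then
    1 / en m p.1 * (massR m (comM m η p.1) c ^ k / comM m η p.1 * Real.sin p.2 ^ k) else 0

/-- Half of the squared momentum transfer on the energy shell of `p₁ + p₄`, shifted by `c`. -/
def comY (m : ℝ) (η : Space n) (c : ℝ) (p : Space n × ℝ) : ℝ :=
  comM m η p.1 ^ 2 / 4 - c / 2 +
    comK m η p.1 * (massR m (comM m η p.1) c * Real.cos p.2) - m ^ 2

/-- Integration over `p₄` and over the energy shell of `p₁ + p₄`, shifted by `c`. -/
def thetaCom (m : ℝ) (η : Space (n + 2)) (F : ℝ → ℝ → ℝ≥0∞) (c : ℝ) : ℝ≥0∞ :=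
  sph n * ∫⁻ p, ENNReal.ofReal (comDens n m η c p) * F (comY m η c p) (en m p.1)
    ∂((volume : Measure (Space (n + 2))).prod (volume.restrict (Ioo 0 Real.pi)))

theorem measurable_secE (m : ℝ) (η : Space n) :
    Measurable fun p : ℝ × (Space n × ℝ) => secE m η p.1 p.2 := by
  have := measurable_mdot_right m η
  unfold secE lineE
  fun_prop

theorem measurable_secDens (k : ℕ) (m : ℝ) (η : Space n) :
    Measurable fun p : ℝ × (Space n × ℝ) => secDens k m η p.1 p.2 := by
  have := measurable_mdot_right m η
  unfold secDens
  fun_prop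

theorem measurable_comM (m : ℝ) (η : Space n) : Measurable fun x => comM m η x := by
  have := measurable_mdot_right m η
  unfold comM
  fun_prop

theorem measurable_comK (m : ℝ) (η : Space n) : Measurable fun x => comK m η x := by
  have := measurable_mdot_right m η
  unfold comK
  fun_prop

theorem measurable_comDens (k : ℕ) (m : ℝ) (η : Space n) :
    Measurable fun p : ℝ × (Space n × ℝ) => comDens k m η p.1 p.2 := by
  have := measurable_comM m η
  unfold comDens massR
  refine Measurable.ite (measurableSet_lt (by fun_prop) (by fun_prop)) ?_ (by fun_prop)
  fun_prop

theorem measurable_comY (m : ℝ) (η : Space n) :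
    Measurable fun p : ℝ × (Space n × ℝ) => comY m η p.1 p.2 := by
  have := measurable_comM m η
  have := measurable_comK m η
  unfold comY massR
  fun_prop

theorem ae_ne (η : Space (n + 1)) : ∀ᵐ x : Space (n + 1), x ≠ η := by
  simp [ae_iff, measure_singleton]

/-- The parameter `c` is the defect `m² + p₁·p₄ - p₁·p₂ - p₂·p₄`, half of `(p₁ + p₄ - p₂)² - m²`;
thus `c = 0` says that `p₃ = p₁ + p₄ - p₂` has mass `m`. For fixed `p₁` and `p₂` it equals `p₄·(p₁ -
p₂) - (p₁·p₂ - m²)`, so its level sets are plane sections of the shell of `p₄`. -/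
theorem lintegral_mul_thetaSec (hm : 0 < m) (η : Space (n + 2)) {F : ℝ → ℝ → ℝ≥0∞}
    (hF : Measurable (Function.uncurry F)) {χ : ℝ → ℝ≥0∞} (hχ : Measurable χ) :
    ∫⁻ c, χ c * thetaSec m η F c =
      ∫⁻ ζ : Space (n + 2), ∫⁻ x : Space (n + 2), ENNReal.ofReal (1 / en m ζ) *
        (ENNReal.ofReal (1 / en m x) * (F (mdot m η ζ - m ^ 2) (en m x) *
          χ (m ^ 2 + mdot m η x - (mdot m η ζ + mdot m x ζ)))) := by
  have hmd := measurable_mdot_right m η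
  have hsE := measurable_secE m η
  have hsD := measurable_secDens n m η
  have hmeas : Measurable fun p : ℝ × (Space (n + 2) × ℝ) =>
      ENNReal.ofReal (secDens n m η p.1 p.2) * F (mdot m η p.2.1 - m ^ 2) (secE m η p.1 p.2) := by
    refine Measurable.mul (by fun_prop) (hF.comp (f := fun p : ℝ × (Space (n + 2) × ℝ) =>
      (mdot m η p.2.1 - m ^ 2, secE m η p.1 p.2)) (by fun_prop))
  have e1 : ∀ c, χ c * thetaSec m η F c = ∫⁻ ζ : Space (n + 2), χ c * (sph n *
      ∫⁻ ρ in Ioi (0 : ℝ), ENNReal.ofReal (secDens n m η c (ζ, ρ)) *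
        F (mdot m η ζ - m ^ 2) (secE m η c (ζ, ρ))) := by
    intro c
    have hmc : Measurable fun p : Space (n + 2) × ℝ =>
      ENNReal.ofReal (secDens n m η c p) * F (mdot m η p.1 - m ^ 2) (secE m η c p) :=
      hmeas.comp (f := fun p : Space (n + 2) × ℝ => (c, p)) (by fun_prop)
    unfold thetaSec
    rw [lintegral_prod _ hmc.aemeasurable, lintegral_const_mul _ (by fun_prop),
      lintegral_const_mul]
    exact hmc.lintegral_prod_right'
  simp_rw [e1]
  rw [lintegral_lintegral_swap]
  · refine lintegral_congr_ae ?_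
    filter_upwards [ae_ne η] with ζ hζ
    have hlt := abs_en_sub_lt hm hζ.symm
    have hsec := lintegral_massShell_section hm (η - ζ) hlt (H := fun E c =>
      ENNReal.ofReal (1 / en m ζ) *
        (F (mdot m η ζ - m ^ 2) E * χ (c - (mdot m η ζ - m ^ 2)))) (by
        refine Measurable.mul (by fun_prop) (Measurable.mul ?_ ?_)
        · exact hF.comp (f := fun p : ℝ × ℝ => (mdot m η ζ - m ^ 2, p.1)) (by fun_prop)
        · exact hχ.comp (by fun_prop))
    rw [← lintegral_add_right_eq_self _ (mdot m η ζ - m ^ 2)] at hsec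
    have e2 : ∀ x : Space (n + 2), ENNReal.ofReal (1 / en m ζ) *
        (ENNReal.ofReal (1 / en m x) * (F (mdot m η ζ - m ^ 2) (en m x) *
          χ (m ^ 2 + mdot m η x - (mdot m η ζ + mdot m x ζ)))) =
        ENNReal.ofReal (1 / en m x) * (ENNReal.ofReal (1 / en m ζ) * (F (mdot m η ζ - m ^ 2)
          (en m x) * χ ((en m η - en m ζ) * en m x - inner ℝ (η - ζ) x -
            (mdot m η ζ - m ^ 2)))) := by
      intro x
      rw [mul_left_comm]
      congr 4
      rw [mdot_comm x ζ, inner_sub_left]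
      unfold mdot
      ring
    simp_rw [e2]
    rw [hsec]
    refine lintegral_congr fun c => ?_
    rw [mul_left_comm]
    congr 1
    have hmρ : Measurable fun ρ : ℝ => ENNReal.ofReal (secDens n m η c (ζ, ρ)) *
        F (mdot m η ζ - m ^ 2) (secE m η c (ζ, ρ)) :=
      hmeas.comp (f := fun ρ : ℝ => (c, ((ζ, ρ) : Space (n + 2) × ℝ))) (by fun_prop)
    rw [← lintegral_const_mul _ hmρ]
    refine setLIntegral_congr_fun measurableSet_Ioi fun ρ hρ => ?_
    have hρ : 0 < ρ := hρ
    have hen := en_pos hm ζ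
    unfold secDens secE
    simp only []
    rw [ENNReal.ofReal_mul (by positivity), ENNReal.ofReal_mul (by positivity),
      add_comm c (mdot m η ζ - m ^ 2), add_sub_cancel_left]
    ring
  · refine Measurable.aemeasurable ?_
    have h1 : Measurable fun q : (ℝ × Space (n + 2)) × ℝ =>
        ENNReal.ofReal (secDens n m η q.1.1 (q.1.2, q.2)) *
          F (mdot m η q.1.2 - m ^ 2) (secE m η q.1.1 (q.1.2, q.2)) :=
      hmeas.comp (f := fun q : (ℝ × Space (n + 2)) × ℝ => (q.1.1, (q.1.2, q.2))) (by fun_prop)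
    exact (hχ.comp measurable_fst).mul (h1.lintegral_prod_right'.const_mul _)

/-- For fixed `p₁` and `p₄` the same defect is `M²/2 - p₂·(p₁ + p₄)`, which is `M²/2 - M E₂` in the
center-of-mass frame. Its level sets are spheres in the shell of `p₂`. The right side agrees with
that of `lintegral_mul_thetaSec` up to the order of integration. -/
theorem lintegral_mul_thetaCom (hm : 0 < m) (η : Space (n + 2)) {F : ℝ → ℝ → ℝ≥0∞}
    (hF : Measurable (Function.uncurry F)) {χ : ℝ → ℝ≥0∞} (hχ : Measurable χ) :
    ∫⁻ c, χ c * thetaCom m η F c =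
      ∫⁻ x : Space (n + 2), ∫⁻ ζ : Space (n + 2), ENNReal.ofReal (1 / en m ζ) *
        (ENNReal.ofReal (1 / en m x) * (F (mdot m η ζ - m ^ 2) (en m x) *
          χ (m ^ 2 + mdot m η x - (mdot m η ζ + mdot m x ζ)))) := by
  have hcD := measurable_comDens n m η
  have hcY := measurable_comY m η
  have hmeas : Measurable fun p : ℝ × (Space (n + 2) × ℝ) =>
      ENNReal.ofReal (comDens n m η p.1 p.2) * F (comY m η p.1 p.2) (en m p.2.1) := by
    refine Measurable.mul (by fun_prop) (hF.comp (f := fun p : ℝ × (Space (n + 2) × ℝ) =>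
      (comY m η p.1 p.2, en m p.2.1)) (by fun_prop))
  have e1 : ∀ c, χ c * thetaCom m η F c = ∫⁻ x : Space (n + 2), χ c * (sph n *
      ∫⁻ θ in Ioo 0 Real.pi, ENNReal.ofReal (comDens n m η c (x, θ)) *
        F (comY m η c (x, θ)) (en m x)) := by
    intro c
    have hmc : Measurable fun p : Space (n + 2) × ℝ =>
      ENNReal.ofReal (comDens n m η c p) * F (comY m η c p) (en m p.1) :=
      hmeas.comp (f := fun p : Space (n + 2) × ℝ => (c, p)) (by fun_prop)
    unfold thetaCom
    rw [lintegral_prod _ hmc.aemeasurable, lintegral_const_mul _ (by fun_prop),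
      lintegral_const_mul]
    exact hmc.lintegral_prod_right'
  simp_rw [e1]
  rw [lintegral_lintegral_swap]
  · refine lintegral_congr fun x => ?_
    have hM := comM_pos hm η x
    obtain ⟨u, hu, hcom⟩ := exists_centerOfMass hm η x
    have huk : ‖u‖ = comK m η x := by
      rw [comK, ← hu, Real.sqrt_sq (norm_nonneg _)]
    have hMsq := comM_sq hm η x
    have h1 := hcom (fun a b => ENNReal.ofReal (1 / en m x) * (F (a - m ^ 2) (en m x) *
      χ (m ^ 2 + mdot m η x - (a + b)))) (by
        refine Measurable.mul (by fun_prop) (Measurable.mul ?_ ?_)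
        · exact hF.comp (f := fun p : ℝ × ℝ => (p.1 - m ^ 2, en m x)) (by fun_prop)
        · exact hχ.comp (by fun_prop))
    rw [h1]
    change _ = ∫⁻ ζ : Space (n + 2), ENNReal.ofReal (1 / en m ζ) *
      (ENNReal.ofReal (1 / en m x) * (F (comM m η x / 2 * en m ζ + inner ℝ u ζ - m ^ 2) (en m x) *
        χ (m ^ 2 + mdot m η x - (comM m η x / 2 * en m ζ + inner ℝ u ζ +
          (comM m η x / 2 * en m ζ - inner ℝ u ζ)))))
    have h2 := lintegral_axial_polar u (F := fun r s => ENNReal.ofReal (1 / phi m r) *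
      (ENNReal.ofReal (1 / en m x) * (F (comM m η x / 2 * phi m r + s - m ^ 2) (en m x) *
        χ (m ^ 2 + mdot m η x - (comM m η x / 2 * phi m r + s + (comM m η x / 2 * phi m r - s))))))
      (by
        refine Measurable.mul (by fun_prop) (Measurable.mul (by fun_prop) (Measurable.mul ?_ ?_))
        · exact hF.comp (f := fun p : ℝ × ℝ => (comM m η x / 2 * phi m p.1 + p.2 - m ^ 2, en m x))
            (by fun_prop)
        · exact hχ.comp (by fun_prop))
    have h3 := lintegral_energy_shift hm hM n (fun r c => ∫⁻ θ in Ioo 0 Real.pi,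
      ENNReal.ofReal (Real.sin θ ^ n) * (ENNReal.ofReal (1 / en m x) *
        (F (comM m η x ^ 2 / 4 - c / 2 + comK m η x * (r * Real.cos θ) - m ^ 2) (en m x) * χ c)))
    refine Eq.trans ?_ h2.symm
    have hsin : ∀ θ ∈ Ioo 0 Real.pi, 0 ≤ Real.sin θ := fun θ hθ =>
      (Real.sin_pos_of_mem_Ioo hθ).le
    have hen := en_pos hm x
    have hχn : ∀ c, Measurable fun θ => ENNReal.ofReal (comDens n m η c (x, θ)) *
        F (comY m η c (x, θ)) (en m x) := fun c =>
      hmeas.comp (f := fun θ : ℝ => (c, ((x, θ) : Space (n + 2) × ℝ))) (by fun_prop)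
    have e3 : ∀ c, χ c * (sph n * ∫⁻ θ in Ioo 0 Real.pi, ENNReal.ofReal (comDens n m η c (x, θ)) *
        F (comY m η c (x, θ)) (en m x)) = sph n *
        (Iio (comM m η x ^ 2 / 2 - comM m η x * m)).indicator (fun c =>
          ENNReal.ofReal (massR m (comM m η x) c ^ n / comM m η x) * ∫⁻ θ in Ioo 0 Real.pi,
          ENNReal.ofReal (Real.sin θ ^ n) * (ENNReal.ofReal (1 / en m x) *
          (F (comM m η x ^ 2 / 4 - c / 2 + comK m η x * (massR m (comM m η x) c * Real.cos θ) -
            m ^ 2) (en m x) * χ c))) c := by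
      intro c
      rw [mul_left_comm]
      congr 1
      by_cases hc : c < comM m η x ^ 2 / 2 - comM m η x * m
      · rw [indicator_of_mem (by exact hc), ← lintegral_const_mul _ (hχn c),
          ← lintegral_const_mul' _ _ ENNReal.ofReal_ne_top]
        refine setLIntegral_congr_fun measurableSet_Ioo fun θ hθ => ?_
        have := hsin θ hθ
        have hR : 0 ≤ massR m (comM m η x) c := Real.sqrt_nonneg _
        unfold comDens comY
        simp only [hc, if_true]
        rw [ENNReal.ofReal_mul (by positivity), ENNReal.ofReal_mul (by positivity)]
        ring
      · rw [indicator_of_notMem (by exact hc)]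
        unfold comDens
        simp [hc]
    simp_rw [e3]
    rw [lintegral_const_mul' _ _ (sph_ne_top n), lintegral_indicator measurableSet_Iio, ← h3]
    congr 1
    refine setLIntegral_congr_fun measurableSet_Ioi fun r hr => ?_
    have hr : 0 < r := hr
    have hphi := phi_pos hm r
    rw [← lintegral_const_mul' _ _ ENNReal.ofReal_ne_top]
    refine setLIntegral_congr_fun measurableSet_Ioo fun θ hθ => ?_
    rw [huk, div_eq_mul_one_div, ENNReal.ofReal_mul (by positivity),
      show comM m η x ^ 2 / 4 - (comM m η x ^ 2 / 2 - comM m η x * phi m r) / 2 =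
        comM m η x / 2 * phi m r by ring,
      show m ^ 2 + mdot m η x - (comM m η x / 2 * phi m r + comK m η x * (r * Real.cos θ) +
        (comM m η x / 2 * phi m r - comK m η x * (r * Real.cos θ))) =
        comM m η x ^ 2 / 2 - comM m η x * phi m r by rw [hMsq]; ring]
    ring
  · refine Measurable.aemeasurable ?_
    have h1 : Measurable fun q : (ℝ × Space (n + 2)) × ℝ =>
        ENNReal.ofReal (comDens n m η q.1.1 (q.1.2, q.2)) *
          F (comY m η q.1.1 (q.1.2, q.2)) (en m q.1.2) :=
      hmeas.comp (f := fun q : (ℝ × Space (n + 2)) × ℝ => (q.1.1, (q.1.2, q.2))) (by fun_prop)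
    exact (hχ.comp measurable_fst).mul (h1.lintegral_prod_right'.const_mul _)

end Exchange

/-! ### Exchange of the order of integration for test functions -/

section Exchange

variable {n : ℕ} {m : ℝ}

/-- If `A 0 < B 0`, two levels strictly in between separate `A` from `B` on a small interval about
`0`, against the equality of integrals. This turns an identity for almost every `c` into one at `c =
0`. -/
theorem le_of_forall_setLIntegral_eq {A B : ℝ → ℝ≥0∞} (hA : ContinuousAt A 0)
    (hB : ContinuousAt B 0) (h : ∀ ε : ℝ, 0 < ε → ∫⁻ c in Ioo (-ε) ε, A c = ∫⁻ c in Ioo (-ε) ε, B c) :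
    B 0 ≤ A 0 := by
  by_contra! hlt
  obtain ⟨x, hx1, hx2⟩ := exists_between hlt
  obtain ⟨y, hy1, hy2⟩ := exists_between hx2
  have e1 : ∀ᶠ c in 𝓝 (0 : ℝ), A c < x := hA.eventually_lt_const hx1
  have e2 : ∀ᶠ c in 𝓝 (0 : ℝ), y < B c := hB.eventually_const_lt hy2
  obtain ⟨ε, hε, hball⟩ := Metric.eventually_nhds_iff_ball.1 (e1.and e2)
  rw [Real.ball_eq_Ioo, zero_sub, zero_add] at hball
  have hvol : volume (Ioo (-ε) ε) = ENNReal.ofReal (2 * ε) := by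
    rw [Real.volume_Ioo]; ring_nf
  have h1 : ∫⁻ c in Ioo (-ε) ε, A c ≤ x * ENNReal.ofReal (2 * ε) := by
    rw [← hvol, ← setLIntegral_const]
    exact setLIntegral_mono' measurableSet_Ioo fun c hc => (hball c hc).1.le
  have h2 : y * ENNReal.ofReal (2 * ε) ≤ ∫⁻ c in Ioo (-ε) ε, B c := by
    rw [← hvol, ← setLIntegral_const]
    exact setLIntegral_mono' measurableSet_Ioo fun c hc => (hball c hc).2.le
  have h3 : x * ENNReal.ofReal (2 * ε) < y * ENNReal.ofReal (2 * ε) :=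
    (ENNReal.mul_lt_mul_iff_left (by simpa using hε) ENNReal.ofReal_ne_top).2 hy1
  rw [h ε hε] at h1
  exact absurd (h2.trans h1) (not_le.2 h3)

theorem exists_bound_of_hasCompactSupport {K : ℝ × ℝ → ℝ} (hK : Continuous K)
    (hs : HasCompactSupport K) :
    ∃ B R : ℝ, 0 < B ∧ 0 < R ∧ (∀ p, K p ≤ B) ∧ ∀ y e, K (y, e) ≠ 0 → |y| ≤ R ∧ |e| ≤ R := by
  obtain ⟨B, hB⟩ := hK.bounded_above_of_compact_support hs
  obtain ⟨R, hR⟩ := hs.isCompact.isBounded.exists_norm_le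
  refine ⟨max B 1, max R 1, by positivity, by positivity, fun p => ?_, fun y e h => ?_⟩
  · exact (le_abs_self _).trans ((hB p).trans (le_max_left _ _))
  · have := hR (y, e) (subset_tsupport _ h)
    rw [Prod.norm_def] at this
    simp only [Real.norm_eq_abs] at this
    exact ⟨(le_max_left _ _).trans (this.trans (le_max_left _ _)),
      (le_max_right _ _).trans (this.trans (le_max_left _ _))⟩

theorem ae_prod_fst_ne {ν : Measure ℝ} [SFinite ν] (η : Space (n + 1)) :
    ∀ᵐ p ∂((volume : Measure (Space (n + 1))).prod ν), p.1 ≠ η :=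
  Measure.quasiMeasurePreserving_fst.ae (ae_ne η)

theorem ae_prod_snd_mem {s : Set ℝ} (hs : MeasurableSet s) :
    ∀ᵐ p ∂((volume : Measure (Space n)).prod (volume.restrict s)), p.2 ∈ s :=
  Measure.quasiMeasurePreserving_snd.ae (ae_restrict_mem hs)

theorem sq_lt_mdot (hm : 0 < m) {η ζ : Space n} (h : ζ ≠ η) : m ^ 2 < mdot m η ζ := by
  have h1 := abs_en_sub_lt hm h.symm
  have h2 := sq_norm_sub_sub_sq (m := m) η ζ
  have h3 := sq_sub_sq_pos_of_abs_lt h1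
  linarith

theorem mdot_lower (hm : 0 < m) (η ζ : Space n) :
    (en m η - ‖η‖) * en m ζ ≤ mdot m η ζ := by
  have h1 := real_inner_le_norm η ζ
  have h2 := norm_lt_en hm ζ
  have h3 := norm_nonneg η
  unfold mdot
  nlinarith

theorem mdot_upper (hm : 0 < m) (η ζ : Space n) : mdot m η ζ ≤ 2 * (en m η * en m ζ) := by
  have h1 := neg_le_of_abs_le (abs_real_inner_le_norm η ζ)
  have h2 := norm_lt_en hm ζ
  have h3 := norm_lt_en hm η
  have h4 : ‖η‖ * ‖ζ‖ ≤ en m η * en m ζ :=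
    mul_le_mul h3.le h2.le (norm_nonneg _) (en_pos hm η).le
  unfold mdot
  linarith

theorem lintegral_indicator_bound_ne_top {s : Set (Space n)} {t : Set ℝ} {ν : Measure ℝ} [SFinite ν]
    (hs : MeasurableSet s) (hs' : volume s ≠ ∞) (ht : MeasurableSet t) (ht' : ν t ≠ ∞) (C : ℝ) :
    ∫⁻ p, (s ×ˢ t).indicator (fun _ => ENNReal.ofReal C) p
      ∂((volume : Measure (Space n)).prod ν) ≠ ∞ := by
  rw [lintegral_indicator (hs.prod ht), setLIntegral_const, Measure.prod_prod]
  exact ENNReal.mul_ne_top ENNReal.ofReal_ne_top (ENNReal.mul_ne_top hs' ht')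

theorem volume_en_le_ne_top (R : ℝ) : volume {x : Space n | en m x ≤ R} ≠ ∞ := by
  refine ne_top_of_le_ne_top (measure_closedBall_lt_top (x := (0 : Space n)) (r := R)).ne
    (measure_mono fun x hx => ?_)
  simp only [mem_ofPred_eq] at hx
  rw [mem_closedBall_zero_iff]
  refine le_trans ?_ hx
  exact Real.le_sqrt_of_sq_le (by nlinarith [sq_nonneg m])

theorem measurableSet_en_le (R : ℝ) : MeasurableSet {x : Space n | en m x ≤ R} :=
  measurableSet_le (by fun_prop) (by fun_prop)

/-- The density is singular only at `p₂ = p₁`, where it is at most of order `y ^ (-1/2)` for `y =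
p₁·p₂ - m²`; the weight `y` absorbs this. The support of `K` confines `y`, hence `p₂`, and also
`secE ≥ ρ`, hence `ρ`. The bound does not depend on `c`. -/
theorem exists_bound_thetaSec (hm : 0 < m) (η : Space (n + 2)) {K : ℝ × ℝ → ℝ} (hK : Continuous K)
    (hs : HasCompactSupport K) (h0 : ∀ p, 0 ≤ K p) :
    ∃ b : Space (n + 2) × ℝ → ℝ≥0∞,
      (∀ c, ∀ᵐ p ∂((volume : Measure (Space (n + 2))).prod (volume.restrict (Ioi (0 : ℝ)))),
        ENNReal.ofReal (secDens n m η c p) *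
          ENNReal.ofReal ((mdot m η p.1 - m ^ 2) * K (mdot m η p.1 - m ^ 2, secE m η c p)) ≤ b p) ∧
      ∫⁻ p, b p ∂((volume : Measure (Space (n + 2))).prod (volume.restrict (Ioi (0 : ℝ)))) ≠ ∞ := by
  obtain ⟨B, R, hB, hR, hKB, hKR⟩ := exists_bound_of_hasCompactSupport hK hs
  have hgap : 0 < en m η - ‖η‖ := sub_pos.2 (norm_lt_en hm η)
  -- From `(E₁ - |η|) E₂ ≤ p₁·p₂ ≤ R + m²`, see `mdot_lower`.
  set R1 := (R + m ^ 2) / (en m η - ‖η‖) with hR1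
  refine ⟨({x : Space (n + 2) | en m x ≤ R1} ×ˢ Icc 0 R).indicator
      fun _ => ENNReal.ofReal (1 / m * R ^ n * (√R / m) * B), ?_, ?_⟩
  · intro c
    filter_upwards [ae_prod_fst_ne η, ae_prod_snd_mem measurableSet_Ioi] with p hp hρ
    have hρ : 0 < p.2 := hρ
    have hen := en_pos hm p.1
    have hy : 0 < mdot m η p.1 - m ^ 2 := sub_pos.2 (sq_lt_mdot hm hp)
    have hlt := abs_en_sub_lt hm hp.symm
    have hv := sq_sub_sq_pos_of_abs_lt hlt
    have hvy := sq_norm_sub_sub_sq (m := m) η p.1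
    have hsd : 0 ≤ secDens n m η c p := by unfold secDens; positivity
    rw [← ENNReal.ofReal_mul hsd]
    by_cases h : K (mdot m η p.1 - m ^ 2, secE m η c p) = 0
    · rw [h]; simp
    obtain ⟨hy', he'⟩ := hKR _ _ h
    rw [abs_of_pos hy] at hy'
    have hmem : p ∈ {x : Space (n + 2) | en m x ≤ R1} ×ˢ Icc 0 R := by
      refine ⟨?_, hρ.le, ?_⟩
      · simp only [mem_ofPred_eq]
        rw [hR1, le_div_iff₀ hgap]
        have := mdot_lower hm η p.1
        linarith
      · have hq : 0 < m ^ 2 + p.2 ^ 2 := by positivity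
        have := sqrt_add_lineT_sq hlt hq (mdot m η p.1 - m ^ 2 + c)
        have h2 : p.2 ≤ secE m η c p := by
          unfold secE
          rw [← this]
          refine Real.le_sqrt_of_sq_le ?_
          nlinarith [sq_nonneg m, sq_nonneg (lineT ‖η - p.1‖ (en m η - en m p.1) (m ^ 2 + p.2 ^ 2)
            (mdot m η p.1 - m ^ 2 + c))]
        exact h2.trans ((le_abs_self _).trans he')
    rw [indicator_of_mem hmem]
    refine ENNReal.ofReal_le_ofReal ?_
    unfold secDens
    rw [hvy]
    set y := mdot m η p.1 - m ^ 2
    -- Only the term `y m²` under the root is kept.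
    have hsq : √y * m ≤ √(2 * y * (m ^ 2 + p.2 ^ 2) + (y + c) ^ 2) := by
      refine Real.le_sqrt_of_sq_le ?_
      rw [mul_pow, Real.sq_sqrt hy.le]
      nlinarith [mul_pos hy (pow_pos hm 2), mul_nonneg hy.le (sq_nonneg p.2), sq_nonneg (y + c)]
    have hsy : 0 < √y := Real.sqrt_pos.2 hy
    have h3 : 1 / √(2 * y * (m ^ 2 + p.2 ^ 2) + (y + c) ^ 2) * y ≤ √R / m := by
      have h4 : 1 / √(2 * y * (m ^ 2 + p.2 ^ 2) + (y + c) ^ 2) * y ≤ 1 / (√y * m) * y := by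
        gcongr
      have h5 : 1 / (√y * m) * y = √y / m := by
        have := Real.sq_sqrt hy.le
        field_simp
        exact this.symm
      rw [h5] at h4
      refine h4.trans ?_
      gcongr
    have h6 : 1 / en m p.1 ≤ 1 / m := one_div_le_one_div_of_le hm (le_en _)
    have h7 : p.2 ^ n ≤ R ^ n := pow_le_pow_left₀ hρ.le hmem.2.2 n
    calc _ = 1 / en m p.1 * p.2 ^ n * (1 / √(2 * y * (m ^ 2 + p.2 ^ 2) + (y + c) ^ 2) * y) *
          K (y, secE m η c p) := by ring
      _ ≤ _ := by
          gcongr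
          · exact h0 _
          · exact hKB _
  · refine lintegral_indicator_bound_ne_top (measurableSet_en_le R1) (volume_en_le_ne_top R1)
      measurableSet_Icc (ne_top_of_le_ne_top ?_ (Measure.restrict_apply_le _ _)) _
    simp

theorem continuousAt_thetaSec (hm : 0 < m) (η : Space (n + 2)) {K : ℝ × ℝ → ℝ} (hK : Continuous K)
    (hs : HasCompactSupport K) (h0 : ∀ p, 0 ≤ K p) :
    ContinuousAt (thetaSec m η fun y e => ENNReal.ofReal (y * K (y, e))) 0 := by
  obtain ⟨b, hb, hb'⟩ := exists_bound_thetaSec hm η hK hs h0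
  have hmd := measurable_mdot_right m η
  have hsE := measurable_secE m η
  have hsD := measurable_secDens n m η
  refine ENNReal.Tendsto.const_mul ?_ (Or.inr (sph_ne_top n))
  refine tendsto_lintegral_filter_of_dominated_convergence b ?_ (Eventually.of_forall hb) hb' ?_
  · refine Eventually.of_forall fun c => ?_
    have h1 : Measurable fun p : Space (n + 2) × ℝ => secE m η c p :=
      hsE.comp (f := fun p : Space (n + 2) × ℝ => (c, p)) (by fun_prop)
    have h2 : Measurable fun p : Space (n + 2) × ℝ => secDens n m η c p :=
      hsD.comp (f := fun p : Space (n + 2) × ℝ => (c, p)) (by fun_prop)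
    have := hK.measurable
    fun_prop
  · filter_upwards [ae_prod_fst_ne η, ae_prod_snd_mem measurableSet_Ioi] with p hp hρ
    have hρ : 0 < p.2 := hρ
    have hen := en_pos hm p.1
    have hy : 0 < mdot m η p.1 - m ^ 2 := sub_pos.2 (sq_lt_mdot hm hp)
    have hlt := abs_en_sub_lt hm hp.symm
    have hv := sq_sub_sq_pos_of_abs_lt hlt
    have hsd : ∀ c, 0 ≤ secDens n m η c p := fun c => by unfold secDens; positivity
    simp_rw [← ENNReal.ofReal_mul (hsd _)]
    refine (ENNReal.continuous_ofReal.tendsto _).comp ?_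
    have c1 : Continuous fun c => secDens n m η c p := by
      unfold secDens
      have : ∀ c, √((‖η - p.1‖ ^ 2 - (en m η - en m p.1) ^ 2) * (m ^ 2 + p.2 ^ 2) +
        (mdot m η p.1 - m ^ 2 + c) ^ 2) ≠ 0 := fun c => (Real.sqrt_pos.2 (by positivity)).ne'
      fun_prop (disch := assumption)
    have c2 : Continuous fun c => secE m η c p := by
      unfold secE lineE
      fun_prop
    have : Continuous fun c => secDens n m η c p * ((mdot m η p.1 - m ^ 2) *
      K (mdot m η p.1 - m ^ 2, secE m η c p)) := by fun_prop
    exact this.tendsto 0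

theorem continuousAt_thetaCom (hm : 0 < m) (η : Space (n + 2)) {K : ℝ × ℝ → ℝ} (hK : Continuous K)
    (hs : HasCompactSupport K) (h0 : ∀ p, 0 ≤ K p) :
    ContinuousAt (thetaCom m η fun y e => ENNReal.ofReal (y * K (y, e))) 0 := by
  obtain ⟨B, R, hB, hR, hKB, hKR⟩ := exists_bound_of_hasCompactSupport hK hs
  have hcY := measurable_comY m η
  have hcD := measurable_comDens n m η
  have hE := en_pos hm η
  refine ENNReal.Tendsto.const_mul ?_ (Or.inr (sph_ne_top n))
  -- `Q` bounds `M`: on the support `M² ≤ 2m² + 4E₁R`, and `2M ≤ M² + 1`.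
  set Q := 2 * m ^ 2 + 4 * (en m η * R) + 1 with hQ
  refine tendsto_lintegral_filter_of_dominated_convergence
    (({x : Space (n + 2) | en m x ≤ R} ×ˢ univ).indicator
      fun _ => ENNReal.ofReal (1 / m * ((Q / 2 + 1 / (2 * m)) ^ n / (2 * m)) * (R * B))) ?_ ?_ ?_ ?_
  · refine Eventually.of_forall fun c => ?_
    have h1 : Measurable fun p : Space (n + 2) × ℝ => comY m η c p :=
      hcY.comp (f := fun p : Space (n + 2) × ℝ => (c, p)) (by fun_prop)
    have h2 : Measurable fun p : Space (n + 2) × ℝ => comDens n m η c p :=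
      hcD.comp (f := fun p : Space (n + 2) × ℝ => (c, p)) (by fun_prop)
    have := hK.measurable
    fun_prop
  · have hc1 : ∀ᶠ c in 𝓝 (0 : ℝ), |c| < 1 := by
      have := (continuous_abs (G := ℝ)).tendsto 0
      rw [abs_zero] at this
      exact this.eventually_lt_const one_pos
    filter_upwards [hc1] with c hc
    filter_upwards [ae_prod_snd_mem measurableSet_Ioo] with p hθ
    have hen := en_pos hm p.1
    have hM := comM_pos hm η p.1
    have hsin : 0 ≤ Real.sin p.2 := (Real.sin_pos_of_mem_Ioo hθ).le
    have hR0 : 0 ≤ massR m (comM m η p.1) c := Real.sqrt_nonneg _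
    have hsd : 0 ≤ comDens n m η c p := by
      unfold comDens
      split_ifs
      · positivity
      · rfl
    rw [← ENNReal.ofReal_mul hsd]
    by_cases h : K (comY m η c p, en m p.1) = 0
    · rw [h]; simp
    obtain ⟨hy', he'⟩ := hKR _ _ h
    rw [abs_of_pos hen] at he'
    have hmem : p ∈ {x : Space (n + 2) | en m x ≤ R} ×ˢ (univ : Set ℝ) := ⟨he', mem_univ _⟩
    rw [indicator_of_mem hmem]
    refine ENNReal.ofReal_le_ofReal ?_
    have hM2 := two_mul_le_comM hm η p.1
    have hMQ : comM m η p.1 ≤ Q := by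
      have h1 := comM_sq hm η p.1
      have h2 := mdot_upper hm η p.1
      have h3 : en m η * en m p.1 ≤ en m η * R := by gcongr
      nlinarith [sq_nonneg (comM m η p.1 - 1)]
    have hQ0 : 0 < Q := by positivity
    have hr : massR m (comM m η p.1) c ≤ Q / 2 + 1 / (2 * m) := by
      have h1 : massR m (comM m η p.1) c ≤ |comM m η p.1 / 2 - c / comM m η p.1| := by
        unfold massR
        rw [← Real.sqrt_sq_eq_abs]
        exact Real.sqrt_le_sqrt (by nlinarith [sq_nonneg m])
      refine h1.trans ((abs_sub _ _).trans ?_)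
      rw [abs_of_pos (by positivity), abs_div, abs_of_pos hM]
      gcongr
    have hd : comDens n m η c p ≤ 1 / m * ((Q / 2 + 1 / (2 * m)) ^ n / (2 * m)) := by
      unfold comDens
      split_ifs
      · have h1 : Real.sin p.2 ^ n ≤ 1 := pow_le_one₀ hsin (Real.sin_le_one _)
        have h6 : 1 / en m p.1 ≤ 1 / m := one_div_le_one_div_of_le hm (le_en _)
        calc _ ≤ 1 / m * ((Q / 2 + 1 / (2 * m)) ^ n / (2 * m) * 1) := by gcongr
          _ = _ := by ring
      · positivity
    have hyK : comY m η c p * K (comY m η c p, en m p.1) ≤ R * B := by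
      have := (abs_le.1 hy').2
      have h1 := h0 (comY m η c p, en m p.1)
      have h2 := hKB (comY m η c p, en m p.1)
      nlinarith
    refine (mul_le_mul_of_nonneg_left hyK hsd).trans ?_
    gcongr
  · refine lintegral_indicator_bound_ne_top (measurableSet_en_le R) (volume_en_le_ne_top R)
      MeasurableSet.univ ?_ _
    simp
  · filter_upwards [ae_prod_fst_ne η, ae_prod_snd_mem measurableSet_Ioo] with p hp hθ
    have hen := en_pos hm p.1
    have hM := comM_pos hm η p.1
    have hsin : 0 ≤ Real.sin p.2 := (Real.sin_pos_of_mem_Ioo hθ).le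
    have hsd : ∀ c, 0 ≤ comDens n m η c p := by
      intro c
      have hR0 : 0 ≤ massR m (comM m η p.1) c := Real.sqrt_nonneg _
      unfold comDens
      split_ifs
      · positivity
      · rfl
    simp_rw [← ENNReal.ofReal_mul (hsd _)]
    refine (ENNReal.continuous_ofReal.tendsto _).comp ?_
    -- Away from `p₄ = p₁` one has `M > 2m`. The threshold is then positive, so the cutoff in
    -- `comDens` is inactive for `c` near `0`.
    have hpos : 0 < comM m η p.1 ^ 2 / 2 - comM m η p.1 * m := by
      have h1 := comM_sq hm η p.1
      have h2 := sq_lt_mdot hm hp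
      have h3 : 2 * m < comM m η p.1 := by nlinarith
      nlinarith
    have c0 : Continuous fun c => massR m (comM m η p.1) c := by unfold massR; fun_prop
    have c1 : ContinuousAt (fun c => comDens n m η c p) 0 := by
      have : Continuous fun c => 1 / en m p.1 * (massR m (comM m η p.1) c ^ n / comM m η p.1 *
        Real.sin p.2 ^ n) := by fun_prop
      refine this.continuousAt.congr ?_
      filter_upwards [eventually_lt_nhds hpos] with c hc
      unfold comDens
      rw [if_pos hc]
    have c2 : Continuous fun c => comY m η c p := by unfold comY; fun_prop
    have : ContinuousAt (fun c => comDens n m η c p * (comY m η c p *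
      K (comY m η c p, en m p.1))) 0 := by fun_prop
    exact this

/-- By Tonelli both sides, as functions of `c`, are densities of the same double integral against
any `χ(c)`. Taking `χ` the indicator of `(-ε, ε)` and using continuity at `0` identifies the values
there. -/
theorem thetaSec_eq_thetaCom_of_continuous (hm : 0 < m) (η : Space (n + 2)) {K : ℝ × ℝ → ℝ}
    (hK : Continuous K) (hs : HasCompactSupport K) (h0 : ∀ p, 0 ≤ K p) :
    thetaSec m η (fun y e => ENNReal.ofReal (y * K (y, e))) 0 =
      thetaCom m η (fun y e => ENNReal.ofReal (y * K (y, e))) 0 := by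
  have hF : Measurable (Function.uncurry fun y e : ℝ => ENNReal.ofReal (y * K (y, e))) := by
    have := hK.measurable
    unfold Function.uncurry
    fun_prop
  have key : ∀ ε : ℝ, 0 < ε →
      ∫⁻ c in Ioo (-ε) ε, thetaSec m η (fun y e => ENNReal.ofReal (y * K (y, e))) c =
        ∫⁻ c in Ioo (-ε) ε, thetaCom m η (fun y e => ENNReal.ofReal (y * K (y, e))) c := by
    intro ε hε
    have hχ : Measurable ((Ioo (-ε) ε).indicator (1 : ℝ → ℝ≥0∞)) :=
      measurable_one.indicator measurableSet_Ioo
    have h1 := lintegral_mul_thetaSec hm η hF hχ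
    have h2 := lintegral_mul_thetaCom hm η hF hχ
    rw [lintegral_lintegral_swap, ← h1] at h2
    · have e : ∀ A : ℝ → ℝ≥0∞, ∫⁻ c, (Ioo (-ε) ε).indicator (1 : ℝ → ℝ≥0∞) c * A c =
          ∫⁻ c in Ioo (-ε) ε, A c := by
        intro A
        rw [← lintegral_indicator measurableSet_Ioo]
        refine lintegral_congr fun c => ?_
        by_cases hc : c ∈ Ioo (-ε) ε <;> simp [hc]
      rw [← e, ← e, h2]
    · have m1 : Measurable fun p : Space (n + 2) × Space (n + 2) => mdot m η p.1 :=
        (measurable_mdot_right m η).comp measurable_fst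
      have m2 : Measurable fun p : Space (n + 2) × Space (n + 2) => mdot m η p.2 :=
        (measurable_mdot_right m η).comp measurable_snd
      have m3 := measurable_mdot (n := n + 2) m
      refine Measurable.aemeasurable ?_
      refine Measurable.mul (by fun_prop) (Measurable.mul (by fun_prop) (Measurable.mul ?_ ?_))
      · exact hF.comp (f := fun p : Space (n + 2) × Space (n + 2) =>
          (mdot m η p.2 - m ^ 2, en m p.1)) (by fun_prop)
      · exact hχ.comp (by fun_prop)
  refine le_antisymm ?_ ?_
  · exact le_of_forall_setLIntegral_eq (continuousAt_thetaCom hm η hK hs h0)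
      (continuousAt_thetaSec hm η hK hs h0) fun ε hε => (key ε hε).symm
  · exact le_of_forall_setLIntegral_eq (continuousAt_thetaSec hm η hK hs h0)
      (continuousAt_thetaCom hm η hK hs h0) key

end Exchange

/-! ### Exchange of the order of integration for all measurable functions -/

section Exchange

variable {n : ℕ} {m : ℝ}

/-- The two push-forward measures are finite on compact sets and agree on compactly supported
continuous functions, so they are equal by the uniqueness in the Riesz theorem. -/
theorem lintegral_eq_of_forall_compactSupport {α β X : Type*} [MeasurableSpace α] [MeasurableSpace β]
    [TopologicalSpace X] [T2Space X] [LocallyCompactSpace X] [SecondCountableTopology X]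
    [MeasurableSpace X] [BorelSpace X]
    {μ : Measure α} {ν : Measure β} {f : α → X} {g : β → X} {d : α → ℝ≥0∞} {e : β → ℝ≥0∞}
    (hf : Measurable f) (hg : Measurable g) (hd : Measurable d) (he : Measurable e)
    (hfin : ∀ K : X → ℝ, Continuous K → HasCompactSupport K → (∀ p, 0 ≤ K p) →
      ∫⁻ a, d a * ENNReal.ofReal (K (f a)) ∂μ ≠ ∞)
    (h : ∀ K : X → ℝ, Continuous K → HasCompactSupport K → (∀ p, 0 ≤ K p) →
      ∫⁻ a, d a * ENNReal.ofReal (K (f a)) ∂μ = ∫⁻ b, e b * ENNReal.ofReal (K (g b)) ∂ν)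
    {F : X → ℝ≥0∞} (hF : Measurable F) :
    ∫⁻ a, d a * F (f a) ∂μ = ∫⁻ b, e b * F (g b) ∂ν := by
  have e1 : ∀ {F : X → ℝ≥0∞}, Measurable F →
      ∫⁻ x, F x ∂((μ.withDensity d).map f) = ∫⁻ a, d a * F (f a) ∂μ := by
    intro F hF
    rw [lintegral_map hF hf]
    exact lintegral_withDensity_eq_lintegral_mul _ hd (hF.comp hf)
  have e2 : ∀ {F : X → ℝ≥0∞}, Measurable F →
      ∫⁻ x, F x ∂((ν.withDensity e).map g) = ∫⁻ b, e b * F (g b) ∂ν := by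
    intro F hF
    rw [lintegral_map hF hg]
    exact lintegral_withDensity_eq_lintegral_mul _ he (hF.comp hg)
  have fin : ∀ (ρ : Measure X), (∀ K : X → ℝ, Continuous K → HasCompactSupport K →
      (∀ p, 0 ≤ K p) → ∫⁻ x, ENNReal.ofReal (K x) ∂ρ ≠ ∞) → IsFiniteMeasureOnCompacts ρ := by
    refine fun ρ hρ => ⟨fun C hC => ?_⟩
    obtain ⟨K, hK1, -, hK2, hK3⟩ := exists_continuous_one_zero_of_isCompact hC isClosed_empty
      (disjoint_empty C)
    refine lt_of_le_of_lt ?_ (lt_top_iff_ne_top.2 (hρ K K.continuous hK2 fun p => (hK3 p).1))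
    rw [← lintegral_indicator_one hC.measurableSet]
    refine lintegral_mono fun x => ?_
    by_cases hx : x ∈ C
    · simp [hx, hK1 hx]
    · simp [hx]
  have fin1 : IsFiniteMeasureOnCompacts ((μ.withDensity d).map f) := by
    refine fin _ fun K hK hs h0 => ?_
    rw [e1 (by have := hK.measurable; fun_prop)]
    exact hfin K hK hs h0
  have fin2 : IsFiniteMeasureOnCompacts ((ν.withDensity e).map g) := by
    refine fin _ fun K hK hs h0 => ?_
    rw [e2 (by have := hK.measurable; fun_prop), ← h K hK hs h0]
    exact hfin K hK hs h0
  have : (μ.withDensity d).map f = (ν.withDensity e).map g := by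
    refine Measure.ext_of_integral_eq_on_compactlySupported_nnreal fun K => ?_
    have hc : Continuous fun x => (K x : ℝ) := by fun_prop
    have hs : HasCompactSupport fun x => (K x : ℝ) :=
      K.hasCompactSupport.comp_left (g := fun r : NNReal => (r : ℝ)) rfl
    have h0 : ∀ x, (0 : ℝ) ≤ K x := fun x => NNReal.coe_nonneg _
    rw [integral_eq_lintegral_of_nonneg_ae (Eventually.of_forall h0) hc.aestronglyMeasurable,
      integral_eq_lintegral_of_nonneg_ae (Eventually.of_forall h0) hc.aestronglyMeasurable,
      e1 (by have := hc.measurable; fun_prop), e2 (by have := hc.measurable; fun_prop),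
      h _ hc hs h0]
  rw [← e1 hF, ← e2 hF, this]

theorem comM_sq_div_four (hm : 0 < m) (η ζ : Space n) :
    comM m η ζ ^ 2 / 4 - m ^ 2 = comK m η ζ ^ 2 := by
  rw [comM_sq hm, comK_sq hm]; ring

theorem massR_comM (hm : 0 < m) (η ζ : Space n) : massR m (comM m η ζ) 0 = comK m η ζ := by
  have h := comM_sq_div_four hm η ζ
  unfold massR
  rw [zero_div, sub_zero, div_pow, show (2 : ℝ) ^ 2 = 4 by norm_num, h]
  exact Real.sqrt_sq (Real.sqrt_nonneg _)

theorem comK_pos (hm : 0 < m) {η ζ : Space n} (h : ζ ≠ η) : 0 < comK m η ζ :=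
  Real.sqrt_pos.2 (by linarith [sq_lt_mdot hm h])

theorem comY_zero (hm : 0 < m) (η : Space n) (p : Space n × ℝ) :
    comY m η 0 p = comK m η p.1 ^ 2 * (1 + Real.cos p.2) := by
  unfold comY
  rw [massR_comM hm, ← comM_sq_div_four hm]
  linear_combination (Real.cos p.2) * (comM_sq_div_four hm η p.1).symm

/-- The two orders of integration over the collision manifold `p₁ + p₄ = p₂ + p₃`. -/
theorem thetaSec_eq_thetaCom (hm : 0 < m) (η : Space (n + 2)) {F : ℝ → ℝ → ℝ≥0∞}
    (hF : Measurable (Function.uncurry F)) : thetaSec m η F 0 = thetaCom m η F 0 := by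
  have hsE : Measurable fun p : Space (n + 2) × ℝ => secE m η 0 p :=
    (measurable_secE m η).comp (f := fun p : Space (n + 2) × ℝ => ((0 : ℝ), p)) (by fun_prop)
  have hsD : Measurable fun p : Space (n + 2) × ℝ => secDens n m η 0 p :=
    (measurable_secDens n m η).comp (f := fun p : Space (n + 2) × ℝ => ((0 : ℝ), p)) (by fun_prop)
  have hcY : Measurable fun p : Space (n + 2) × ℝ => comY m η 0 p :=
    (measurable_comY m η).comp (f := fun p : Space (n + 2) × ℝ => ((0 : ℝ), p)) (by fun_prop)
  have hcD : Measurable fun p : Space (n + 2) × ℝ => comDens n m η 0 p :=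
    (measurable_comDens n m η).comp (f := fun p : Space (n + 2) × ℝ => ((0 : ℝ), p)) (by fun_prop)
  have hmd := measurable_mdot_right m η
  have hsplit : ∀ y K : ℝ, 0 ≤ K → ENNReal.ofReal (y * K) = ENNReal.ofReal y * ENNReal.ofReal K :=
    fun y K hK => by rw [mul_comm, ENNReal.ofReal_mul hK, mul_comm]
  -- The weight `y` of the test functions is moved into the densities and divided out of `F`. This
  -- is harmless because `y > 0` almost everywhere on both sides.
  have key := lintegral_eq_of_forall_compactSupport
    (μ := (volume : Measure (Space (n + 2))).prod (volume.restrict (Ioi (0 : ℝ))))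
    (ν := (volume : Measure (Space (n + 2))).prod (volume.restrict (Ioo 0 Real.pi)))
    (f := fun p => (mdot m η p.1 - m ^ 2, secE m η 0 p))
    (g := fun p => (comY m η 0 p, en m p.1))
    (d := fun p => ENNReal.ofReal (secDens n m η 0 p) * ENNReal.ofReal (mdot m η p.1 - m ^ 2))
    (e := fun p => ENNReal.ofReal (comDens n m η 0 p) * ENNReal.ofReal (comY m η 0 p))
    (by fun_prop) (by fun_prop) (by fun_prop) (by fun_prop)
    (fun K hK hs h0 => by
      obtain ⟨b, hb, hb'⟩ := exists_bound_thetaSec hm η hK hs h0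
      refine ne_top_of_le_ne_top hb' (lintegral_mono_ae ?_)
      filter_upwards [hb 0] with p hp
      rw [mul_assoc, ← hsplit _ _ (h0 _)]
      exact hp)
    (fun K hK hs h0 => by
      have := thetaSec_eq_thetaCom_of_continuous hm η hK hs h0
      unfold thetaSec thetaCom at this
      rw [ENNReal.mul_right_inj (sph_pos n) (sph_ne_top n)] at this
      simp_rw [mul_assoc, ← hsplit _ _ (h0 _)]
      exact this)
    (F := fun p => (ENNReal.ofReal p.1)⁻¹ * F p.1 p.2)
    (Measurable.mul (by fun_prop) hF)
  have hcancel : ∀ y, 0 < y → ∀ a b : ℝ≥0∞,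
      a * ENNReal.ofReal y * ((ENNReal.ofReal y)⁻¹ * b) = a * b := by
    intro y hy a b
    rw [mul_assoc, ← mul_assoc (ENNReal.ofReal y), ENNReal.mul_inv_cancel (by simpa using hy)
      ENNReal.ofReal_ne_top, one_mul]
  unfold thetaSec thetaCom
  congr 1
  refine Eq.trans (lintegral_congr_ae ?_) (key.trans (lintegral_congr_ae ?_))
  · filter_upwards [ae_prod_fst_ne η] with p hp
    exact (hcancel _ (sub_pos.2 (sq_lt_mdot hm hp)) _ _).symm
  · filter_upwards [ae_prod_fst_ne η, ae_prod_snd_mem measurableSet_Ioo] with p hp hθ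
    refine hcancel _ ?_ _ _
    rw [comY_zero hm]
    have h1 := comK_pos hm hp
    have h2 : -1 < Real.cos p.2 := by
      rw [← Real.cos_pi]
      exact Real.cos_lt_cos_of_nonneg_of_le_pi hθ.1.le le_rfl hθ.2
    have h3 : 0 < 1 + Real.cos p.2 := by linarith
    positivity

end Exchange

/-! ### The null form as a bilinear form with an explicit kernel -/

section NullForm

variable {n : ℕ} {m : ℝ}

/-- The angular integral `∫₀^π sinⁿ θ (1 + cos θ)^p dθ`. -/
def angInt (n : ℕ) (p : ℝ) : ℝ≥0∞ :=
  ∫⁻ θ in Ioo 0 Real.pi, ENNReal.ofReal (Real.sin θ ^ n * (1 + Real.cos θ) ^ p)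

theorem measurable_fibInt {F : ℝ → ℝ → ℝ≥0∞} (hF : Measurable (Function.uncurry F)) :
    Measurable fun p : ℝ × ℝ => fibInt n m p.1 p.2 F := by
  unfold fibInt
  refine Measurable.const_mul ?_ _
  refine Measurable.lintegral_prod_right' (f := fun q : (ℝ × ℝ) × ℝ => ENNReal.ofReal (q.2 ^ n) *
    (ENNReal.ofReal (fibDens q.1.1 q.1.2 (m ^ 2 + q.2 ^ 2)) *
      F (fibE q.1.1 q.1.2 (m ^ 2 + q.2 ^ 2)) (fibE q.1.1 q.1.2 (m ^ 2 + q.2 ^ 2) - q.1.2))) ?_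
  refine Measurable.mul (by fun_prop) (Measurable.mul (by fun_prop) ?_)
  exact hF.comp (f := fun q : (ℝ × ℝ) × ℝ => (fibE q.1.1 q.1.2 (m ^ 2 + q.2 ^ 2),
    fibE q.1.1 q.1.2 (m ^ 2 + q.2 ^ 2) - q.1.2)) (by fun_prop)

theorem fibInt_const_mul {a τ : ℝ} (c : ℝ → ℝ≥0∞) {F : ℝ → ℝ → ℝ≥0∞}
    (hF : Measurable (Function.uncurry F)) :
    fibInt n m a τ (fun x y => c (x - y) * F x y) = c τ * fibInt n m a τ F := by
  have hm : Measurable fun ρ : ℝ => ENNReal.ofReal (ρ ^ n) *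
      (ENNReal.ofReal (fibDens a τ (m ^ 2 + ρ ^ 2)) *
        F (fibE a τ (m ^ 2 + ρ ^ 2)) (fibE a τ (m ^ 2 + ρ ^ 2) - τ)) := by
    refine Measurable.mul (by fun_prop) (Measurable.mul (by fun_prop) ?_)
    exact hF.comp (f := fun ρ : ℝ => (fibE a τ (m ^ 2 + ρ ^ 2), fibE a τ (m ^ 2 + ρ ^ 2) - τ))
      (by fun_prop)
  unfold fibInt
  rw [mul_left_comm, ← lintegral_const_mul _ hm]
  congr 1
  refine lintegral_congr fun ρ => ?_
  simp only [sub_sub_cancel]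
  ring

/-- The point `p₄ + (τ, ξ)` has mass `m` exactly when `p₄·(τ, ξ) = (|ξ|² - τ²)/2`. At this value of
the plane coordinate the section of the mass shell is the fiber. -/
theorem sqrt_half_gap {a τ q : ℝ} (h : |τ| < a) (hq : 0 < q) :
    √((a ^ 2 - τ ^ 2) * q + ((a ^ 2 - τ ^ 2) / 2) ^ 2) =
      (a ^ 2 - τ ^ 2) * fibS a τ q / 2 := by
  have hv := sq_sub_sq_pos_of_abs_lt h
  have hS := fibS_sq h hq
  have hS1 := one_lt_fibS h hq
  rw [Real.sqrt_eq_iff_eq_sq (by positivity) (by positivity), div_pow, div_pow, mul_pow, hS]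
  field_simp
  ring

theorem lineE_half_gap {a τ q : ℝ} (h : |τ| < a) (hq : 0 < q) :
    lineE a τ q ((a ^ 2 - τ ^ 2) / 2) = fibE a τ q - τ := by
  have hv := sq_sub_sq_pos_of_abs_lt h
  unfold lineE
  rw [sqrt_half_gap h hq]
  unfold fibE
  field_simp
  ring

/-- The form which dominates `‖|□|^β (u v̄)‖²`; `A` and `B` are the squared moduli of the data as
functions of the energy. -/
def nullForm (n : ℕ) (m : ℝ) (W A B : ℝ → ℝ≥0∞) : ℝ≥0∞ :=
  ∫⁻ ξ : Space (n + 2), ∫⁻ τ in Ioo (-‖ξ‖) ‖ξ‖, W (‖ξ‖ ^ 2 - τ ^ 2) *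
    (fibInt n m ‖ξ‖ τ (fun x y => A x * ENNReal.ofReal (x / y)) *
      fibInt n m ‖ξ‖ τ (fun x y => B y * ENNReal.ofReal (y / x)))

/-- The fiber integral of `A` is unfolded into an integral over `p₁` and `p₂`, with the other
factors constant along the fiber since they depend only on `p₁ - p₂`. The fiber integral of `B` is
the section of the shell of `p₄` at `c = 0`. -/
theorem nullForm_eq_thetaSec (hm : 0 < m) {W A B : ℝ → ℝ≥0∞} (hW : Measurable W)
    (hA : Measurable A) (hB : Measurable B) :
    nullForm n m W A B = ∫⁻ η : Space (n + 2), A (en m η) * ENNReal.ofReal (en m η) *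
      thetaSec m η (fun y e => W (2 * y) * (B e * ENNReal.ofReal (e ^ 2))) 0 := by
  have hBm : Measurable (Function.uncurry fun x y : ℝ => B y * ENNReal.ofReal (y / x)) := by
    unfold Function.uncurry
    fun_prop
  have hfib := measurable_fibInt (n := n) (m := m) hBm
  have key := lintegral_pair_fiber (n := n) hm (K := fun x y ξ => W (‖ξ‖ ^ 2 - (x - y) ^ 2) *
    (A x * ENNReal.ofReal (x / y) *
      fibInt n m ‖ξ‖ (x - y) (fun x y => B y * ENNReal.ofReal (y / x)))) (by
    refine Measurable.mul (by fun_prop) (Measurable.mul (by fun_prop) ?_)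
    exact hfib.comp (f := fun p : ℝ × ℝ × Space (n + 2) => (‖p.2.2‖, p.1 - p.2.1)) (by fun_prop))
  have e1 : nullForm n m W A B = ∫⁻ ξ : Space (n + 2), ∫⁻ τ in Ioo (-‖ξ‖) ‖ξ‖,
      fibInt n m ‖ξ‖ τ fun x y => W (‖ξ‖ ^ 2 - (x - y) ^ 2) *
        (A x * ENNReal.ofReal (x / y) *
          fibInt n m ‖ξ‖ (x - y) (fun x y => B y * ENNReal.ofReal (y / x))) := by
    unfold nullForm
    have hAm : Measurable (Function.uncurry fun x y : ℝ => A x * ENNReal.ofReal (x / y)) := by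
      unfold Function.uncurry
      fun_prop
    refine lintegral_congr fun ξ => setLIntegral_congr_fun measurableSet_Ioo fun τ hτ => ?_
    have := fibInt_const_mul (n := n) (m := m) (a := ‖ξ‖) (τ := τ) (fun t => W (‖ξ‖ ^ 2 - t ^ 2) *
      fibInt n m ‖ξ‖ t (fun x y => B y * ENNReal.ofReal (y / x))) hAm
    rw [mul_comm (fibInt _ _ _ _ _) (fibInt _ _ _ _ _), ← mul_assoc]
    refine this.symm.trans ?_
    congr 1
    ext x y
    ring
  rw [e1, ← key]
  refine lintegral_congr fun η => ?_
  have hmd := measurable_mdot_right m η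
  have hsE : Measurable fun p : Space (n + 2) × ℝ => secE m η 0 p :=
    (measurable_secE m η).comp (f := fun p : Space (n + 2) × ℝ => ((0 : ℝ), p)) (by fun_prop)
  have hsD : Measurable fun p : Space (n + 2) × ℝ => secDens n m η 0 p :=
    (measurable_secDens n m η).comp (f := fun p : Space (n + 2) × ℝ => ((0 : ℝ), p)) (by fun_prop)
  have hmeas : Measurable fun p : Space (n + 2) × ℝ => ENNReal.ofReal (secDens n m η 0 p) *
      (W (2 * (mdot m η p.1 - m ^ 2)) * (B (secE m η 0 p) * ENNReal.ofReal (secE m η 0 p ^ 2))) := by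
    fun_prop
  unfold thetaSec
  rw [lintegral_prod _ hmeas.aemeasurable, ← lintegral_const_mul _ hmeas.lintegral_prod_right',
    ← lintegral_const_mul]
  swap
  · exact hmeas.lintegral_prod_right'.const_mul _
  refine lintegral_congr_ae ?_
  filter_upwards [ae_ne η] with ζ hζ
  have hlt := abs_en_sub_lt hm hζ.symm
  have hv := sq_sub_sq_pos_of_abs_lt hlt
  have hvy := sq_norm_sub_sub_sq (m := m) η ζ
  have hy : mdot m η ζ - m ^ 2 + 0 = (‖η - ζ‖ ^ 2 - (en m η - en m ζ) ^ 2) / 2 := by linarith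
  have hE1 := en_pos hm η
  have hE2 := en_pos hm ζ
  have e2 : ENNReal.ofReal (en m η / en m ζ) = ENNReal.ofReal (en m η) *
      ENNReal.ofReal (1 / en m ζ) := by
    rw [← ENNReal.ofReal_mul hE1.le]; congr 1; ring
  unfold fibInt
  rw [hvy, e2]
  have e3 : ∀ ρ ∈ Ioi (0 : ℝ), ENNReal.ofReal (secDens n m η 0 (ζ, ρ)) *
      (W (2 * (mdot m η ζ - m ^ 2)) * (B (secE m η 0 (ζ, ρ)) *
        ENNReal.ofReal (secE m η 0 (ζ, ρ) ^ 2))) =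
      (W (2 * (mdot m η ζ - m ^ 2)) * ENNReal.ofReal (1 / en m ζ)) * (ENNReal.ofReal (ρ ^ n) *
        (ENNReal.ofReal (fibDens ‖η - ζ‖ (en m η - en m ζ) (m ^ 2 + ρ ^ 2)) *
        (B (fibE ‖η - ζ‖ (en m η - en m ζ) (m ^ 2 + ρ ^ 2) - (en m η - en m ζ)) *
          ENNReal.ofReal ((fibE ‖η - ζ‖ (en m η - en m ζ) (m ^ 2 + ρ ^ 2) - (en m η - en m ζ)) /
            fibE ‖η - ζ‖ (en m η - en m ζ) (m ^ 2 + ρ ^ 2))))) := by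
    intro ρ hρ
    have hρ : 0 < ρ := hρ
    have hq : 0 < m ^ 2 + ρ ^ 2 := by positivity
    have hsecE : secE m η 0 (ζ, ρ) =
        fibE ‖η - ζ‖ (en m η - en m ζ) (m ^ 2 + ρ ^ 2) - (en m η - en m ζ) := by
      unfold secE
      rw [hy, lineE_half_gap hlt hq]
    have hsecD : secDens n m η 0 (ζ, ρ) = 1 / en m ζ * (ρ ^ n * (1 / ((‖η - ζ‖ ^ 2 -
        (en m η - en m ζ) ^ 2) * fibS ‖η - ζ‖ (en m η - en m ζ) (m ^ 2 + ρ ^ 2) / 2))) := by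
      unfold secDens
      rw [hy, sqrt_half_gap hlt hq]
    have h1 := fibE_pos hlt hq
    have h2 := fibE_sub_pos hlt hq
    have h3 := one_lt_fibS hlt hq
    have h4 := fibDens_pos hlt hq
    rw [hsecE, hsecD, ENNReal.ofReal_mul (by positivity), ENNReal.ofReal_mul (by positivity)]
    -- With `E₃ = fibE` and `E₄ = E₃ - τ`, the factor `E₄ / E₃` turns the `E₃E₄` of the fiber
    -- density into `E₄²`.
    have h5 : ENNReal.ofReal (1 / ((‖η - ζ‖ ^ 2 - (en m η - en m ζ) ^ 2) *
          fibS ‖η - ζ‖ (en m η - en m ζ) (m ^ 2 + ρ ^ 2) / 2)) * ENNReal.ofReal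
          ((fibE ‖η - ζ‖ (en m η - en m ζ) (m ^ 2 + ρ ^ 2) - (en m η - en m ζ)) ^ 2) =
        ENNReal.ofReal (fibDens ‖η - ζ‖ (en m η - en m ζ) (m ^ 2 + ρ ^ 2)) *
        ENNReal.ofReal ((fibE ‖η - ζ‖ (en m η - en m ζ) (m ^ 2 + ρ ^ 2) - (en m η - en m ζ)) /
            fibE ‖η - ζ‖ (en m η - en m ζ) (m ^ 2 + ρ ^ 2)) := by
      rw [← ENNReal.ofReal_mul (by positivity), ← ENNReal.ofReal_mul (by positivity)]
      congr 1
      unfold fibDens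
      generalize fibE ‖η - ζ‖ (en m η - en m ζ) (m ^ 2 + ρ ^ 2) = E at *
      generalize ‖η - ζ‖ ^ 2 - (en m η - en m ζ) ^ 2 = v at *
      field_simp
    calc _ = (W (2 * (mdot m η ζ - m ^ 2)) * ENNReal.ofReal (1 / en m ζ)) *
          (ENNReal.ofReal (ρ ^ n) * ((ENNReal.ofReal (1 / ((‖η - ζ‖ ^ 2 -
            (en m η - en m ζ) ^ 2) * fibS ‖η - ζ‖ (en m η - en m ζ) (m ^ 2 + ρ ^ 2) / 2)) *
            ENNReal.ofReal ((fibE ‖η - ζ‖ (en m η - en m ζ) (m ^ 2 + ρ ^ 2) -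
              (en m η - en m ζ)) ^ 2)) * B (fibE ‖η - ζ‖ (en m η - en m ζ) (m ^ 2 + ρ ^ 2) -
              (en m η - en m ζ)))) := by ring
      _ = _ := by rw [h5]; ring
  rw [setLIntegral_congr_fun measurableSet_Ioi e3, lintegral_const_mul _ (by fun_prop)]
  ring

/-- The kernel of the null form as a function of the Minkowski product. -/
def kern (n : ℕ) (β m X : ℝ) : ℝ :=
  √((X - m ^ 2) / 2) ^ n / √(2 * m ^ 2 + 2 * X) * (X - m ^ 2) ^ (2 * β)

theorem measurable_kern (n : ℕ) (β m : ℝ) : Measurable (kern n β m) := by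
  unfold kern
  fun_prop

theorem kern_nonneg {β X : ℝ} (hX : m ^ 2 ≤ X) : 0 ≤ kern n β m X := by
  unfold kern
  have := Real.rpow_nonneg (sub_nonneg.2 hX) (2 * β)
  positivity

/-- After the exchange `p₂` runs over the sphere of radius `k = comK` in the center-of-mass frame.
There `2y = (X - m²)(1 + cos θ)`, so the weight factors into a power of `X - m²` and the angular
constant `angInt n (2β)`. -/
theorem nullForm_eq (hm : 0 < m) (β : ℝ) {A B : ℝ → ℝ≥0∞} (hA : Measurable A) (hB : Measurable B) :
    nullForm n m (fun v => ENNReal.ofReal (v ^ (2 * β))) A B =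
      sph n * angInt n (2 * β) * ∫⁻ η : Space (n + 2), ∫⁻ x : Space (n + 2),
        A (en m η) * ENNReal.ofReal (en m η) * (B (en m x) * ENNReal.ofReal (en m x) *
          ENNReal.ofReal (kern n β m (mdot m η x))) := by
  have hk := measurable_kern n β m
  have hmd2 := measurable_mdot (n := n + 2) m
  rw [nullForm_eq_thetaSec hm (by fun_prop) hA hB, ← lintegral_const_mul]
  swap
  · refine Measurable.lintegral_prod_right' (f := fun p : Space (n + 2) × Space (n + 2) =>
      A (en m p.1) * ENNReal.ofReal (en m p.1) * (B (en m p.2) * ENNReal.ofReal (en m p.2) *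
          ENNReal.ofReal (kern n β m (mdot m p.1 p.2)))) ?_
    fun_prop
  refine lintegral_congr fun η => ?_
  have hmd := measurable_mdot_right m η
  rw [thetaSec_eq_thetaCom hm η (by unfold Function.uncurry; fun_prop),
    lintegral_const_mul _ (by fun_prop)]
  unfold thetaCom
  have hcY : Measurable fun p : Space (n + 2) × ℝ => comY m η 0 p :=
    (measurable_comY m η).comp (f := fun p : Space (n + 2) × ℝ => ((0 : ℝ), p)) (by fun_prop)
  have hcD : Measurable fun p : Space (n + 2) × ℝ => comDens n m η 0 p :=
    (measurable_comDens n m η).comp (f := fun p : Space (n + 2) × ℝ => ((0 : ℝ), p)) (by fun_prop)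
  rw [lintegral_prod _ (by fun_prop)]
  have e : ∫⁻ x : Space (n + 2), ∫⁻ θ in Ioo 0 Real.pi, ENNReal.ofReal (comDens n m η 0 (x, θ)) *
      (ENNReal.ofReal ((2 * comY m η 0 (x, θ)) ^ (2 * β)) *
        (B (en m x) * ENNReal.ofReal (en m x ^ 2))) =
      angInt n (2 * β) * ∫⁻ x : Space (n + 2), B (en m x) * ENNReal.ofReal (en m x) *
          ENNReal.ofReal (kern n β m (mdot m η x)) := by
    rw [← lintegral_const_mul _ (by fun_prop)]
    refine lintegral_congr_ae ?_
    filter_upwards [ae_ne η] with x hx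
    unfold angInt
    rw [← lintegral_mul_const _ (by fun_prop)]
    refine setLIntegral_congr_fun measurableSet_Ioo fun θ hθ => ?_
    have hen := en_pos hm x
    have hM := comM_pos hm η x
    have hK := comK_pos hm hx
    have hsin := Real.sin_pos_of_mem_Ioo hθ
    have h2 : -1 < Real.cos θ := by
      rw [← Real.cos_pi]
      exact Real.cos_lt_cos_of_nonneg_of_le_pi hθ.1.le le_rfl hθ.2
    have h3 : 0 < 1 + Real.cos θ := by linarith
    have hKsq := comK_sq hm η x
    have hpos : 0 < comM m η x ^ 2 / 2 - comM m η x * m := by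
      have h1 := comM_sq hm η x
      have h2 := sq_lt_mdot hm hx
      have h3 : 2 * m < comM m η x := by nlinarith
      nlinarith
    have hd : comDens n m η 0 (x, θ) =
        1 / en m x * (comK m η x ^ n / comM m η x * Real.sin θ ^ n) := by
      unfold comDens
      rw [if_pos hpos, massR_comM hm]
    have hX := sq_lt_mdot hm hx
    have hX' : 0 < mdot m η x - m ^ 2 := sub_pos.2 hX
    have hy : 2 * comY m η 0 (x, θ) = (mdot m η x - m ^ 2) * (1 + Real.cos θ) := by
      rw [comY_zero hm]
      simp only []
      rw [hKsq]; ring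
    have hkern : kern n β m (mdot m η x) =
        comK m η x ^ n / comM m η x * (mdot m η x - m ^ 2) ^ (2 * β) := rfl
    rw [hd, hy, hkern, Real.mul_rpow hX'.le h3.le]
    have r1 := Real.rpow_pos_of_pos hX' (2 * β)
    have r2 := Real.rpow_pos_of_pos h3 (2 * β)
    rw [mul_left_comm (ENNReal.ofReal _) (B _), ← mul_assoc (ENNReal.ofReal _) (B _),
      mul_comm (ENNReal.ofReal _) (B _), mul_assoc (B _), mul_assoc (B _),
      mul_left_comm (ENNReal.ofReal _) (B _)]
    congr 1
    rw [← ENNReal.ofReal_mul (by positivity), ← ENNReal.ofReal_mul (by positivity),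
      ← ENNReal.ofReal_mul (by positivity), ← ENNReal.ofReal_mul (by positivity)]
    congr 1
    field_simp
  simp only [] at e ⊢
  rw [e]
  ring

end NullForm

/-! ### Angular integrals and averages -/

section Angular

variable {n : ℕ} {m b : ℝ}

theorem lintegral_Ioo_pi_reflect (f : ℝ → ℝ≥0∞) :
    ∫⁻ θ in Ioo 0 Real.pi, f θ = ∫⁻ θ in Ioo 0 Real.pi, f (Real.pi - θ) := by
  rw [← lintegral_indicator measurableSet_Ioo, ← lintegral_indicator measurableSet_Ioo,
    ← lintegral_sub_left_eq_self _ Real.pi]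
  refine lintegral_congr fun θ => ?_
  by_cases h : θ ∈ Ioo 0 Real.pi
  · have h' : Real.pi - θ ∈ Ioo 0 Real.pi := ⟨by linarith [h.2], by linarith [h.1]⟩
    rw [indicator_of_mem h, indicator_of_mem h']
  · have h' : Real.pi - θ ∉ Ioo 0 Real.pi := fun h' => h ⟨by linarith [h'.2], by linarith [h'.1]⟩
    rw [indicator_of_notMem h, indicator_of_notMem h']

/-- The angular integral `∫₀^π sinⁿ θ (1 - ν cos θ)^b dθ`. -/
def angB (n : ℕ) (b ν : ℝ) : ℝ≥0∞ :=
  ∫⁻ θ in Ioo 0 Real.pi, ENNReal.ofReal (Real.sin θ ^ n * (1 - ν * Real.cos θ) ^ b)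

theorem abs_cos_lt_one {θ : ℝ} (hθ : θ ∈ Ioo 0 Real.pi) : |Real.cos θ| < 1 := by
  have h := Real.sin_pos_of_mem_Ioo hθ
  have := Real.sin_sq_add_cos_sq θ
  rw [abs_lt]
  constructor <;> nlinarith

theorem angB_one (n : ℕ) (b : ℝ) : angB n b 1 = angInt n b := by
  unfold angB angInt
  rw [lintegral_Ioo_pi_reflect]
  refine lintegral_congr fun θ => ?_
  rw [Real.sin_pi_sub, Real.cos_pi_sub]
  simp

/-- Averaging over `θ ↦ π - θ` leaves only the even part in `cos θ`, which is what is monotone in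
`ν`. -/
theorem two_mul_angB {ν : ℝ} (h0 : 0 ≤ ν) (h1 : ν ≤ 1) (n : ℕ) (b : ℝ) :
    2 * angB n b ν = ∫⁻ θ in Ioo 0 Real.pi, ENNReal.ofReal (Real.sin θ ^ n *
      ((1 - ν * |Real.cos θ|) ^ b + (1 + ν * |Real.cos θ|) ^ b)) := by
  have e : angB n b ν = ∫⁻ θ in Ioo 0 Real.pi,
      ENNReal.ofReal (Real.sin θ ^ n * (1 + ν * Real.cos θ) ^ b) := by
    unfold angB
    rw [lintegral_Ioo_pi_reflect]
    refine lintegral_congr fun θ => ?_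
    rw [Real.sin_pi_sub, Real.cos_pi_sub]
    congr 3
    ring
  rw [two_mul]
  nth_rewrite 2 [e]
  unfold angB
  rw [← lintegral_add_left (by fun_prop)]
  refine setLIntegral_congr_fun measurableSet_Ioo fun θ hθ => ?_
  have hs := Real.sin_pos_of_mem_Ioo hθ
  have hc := abs_cos_lt_one hθ
  have hc' := abs_lt.1 hc
  have p1 : 0 < 1 - ν * Real.cos θ := by nlinarith
  have p2 : 0 < 1 + ν * Real.cos θ := by nlinarith
  have r1 := Real.rpow_pos_of_pos p1 b
  have r2 := Real.rpow_pos_of_pos p2 b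
  rw [← ENNReal.ofReal_add (by positivity) (by positivity), ← mul_add]
  rcases abs_choice (Real.cos θ) with h | h
  · rw [h]
  · rw [h, mul_neg, sub_neg_eq_add, add_comm ((1 - _) ^ b)]
    rfl

/-- The derivative is `b((1 + z)^(b-1) - (1 - z)^(b-1))`. Its two factors have the same sign when `b
≤ 0` or `b ≥ 1`, and opposite signs for `0 < b < 1`; this is the origin of the gap in the sharp
range. -/
theorem rpow_sum_mono (hb : b ≤ 0 ∨ 1 ≤ b) {x y : ℝ} (hx : 0 ≤ x) (hxy : x ≤ y) (hy : y < 1) :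
    (1 - x) ^ b + (1 + x) ^ b ≤ (1 - y) ^ b + (1 + y) ^ b := by
  have hd : ∀ z ∈ Ico (0 : ℝ) 1, HasDerivAt (fun z : ℝ => (1 - z) ^ b + (1 + z) ^ b)
      (b * ((1 + z) ^ (b - 1) - (1 - z) ^ (b - 1))) z := by
    intro z hz
    have h1 : (1 - z) ≠ 0 := by linarith [hz.2]
    have h2 : (1 + z) ≠ 0 := by linarith [hz.1]
    have d1 := ((hasDerivAt_id z).const_sub 1).rpow_const (p := b) (Or.inl h1)
    have d2 := ((hasDerivAt_id z).const_add 1).rpow_const (p := b) (Or.inl h2)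
    refine (d1.add d2).congr_deriv ?_
    simp only [id]
    ring
  have hmono : MonotoneOn (fun z : ℝ => (1 - z) ^ b + (1 + z) ^ b) (Ico 0 1) := by
    refine monotoneOn_of_hasDerivWithinAt_nonneg (convex_Ico 0 1)
      (fun z hz => (hd z hz).continuousAt.continuousWithinAt)
      (fun z hz => (hd z (interior_subset hz)).hasDerivWithinAt) fun z hz => ?_
    have hz := interior_subset hz
    have h1 : 0 < 1 - z := by linarith [hz.2]
    have h2 : 1 - z ≤ 1 + z := by linarith [hz.1]
    rcases hb with hb | hb
    · have := Real.rpow_le_rpow_of_nonpos h1 h2 (by linarith : b - 1 ≤ 0)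
      exact mul_nonneg_of_nonpos_of_nonpos hb (by linarith)
    · have := Real.rpow_le_rpow h1.le h2 (by linarith : 0 ≤ b - 1)
      exact mul_nonneg (by linarith) (by linarith)
  exact hmono ⟨hx, by linarith⟩ ⟨by linarith, hy⟩ hxy

theorem angB_le_of_convex (hb : b ≤ 0 ∨ 1 ≤ b) {ν : ℝ} (h0 : 0 ≤ ν) (h1 : ν ≤ 1) :
    angB n b ν ≤ angInt n b := by
  rw [← angB_one, ← ENNReal.mul_le_mul_iff_right (two_ne_zero) ENNReal.ofNat_ne_top,
    two_mul_angB h0 h1, two_mul_angB zero_le_one le_rfl]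
  refine setLIntegral_mono' measurableSet_Ioo fun θ hθ => ENNReal.ofReal_le_ofReal ?_
  have hs := Real.sin_pos_of_mem_Ioo hθ
  have hc := abs_cos_lt_one hθ
  have := abs_nonneg (Real.cos θ)
  rw [one_mul]
  refine mul_le_mul_of_nonneg_left (rpow_sum_mono hb (by positivity) ?_ hc) (by positivity)
  nlinarith

/-- A non-sharp bound from `1 - ν cos θ ≤ 2`, needed for `0 < b < 1`. -/
theorem angB_le_of_nonneg (hb : 0 ≤ b) {ν : ℝ} (h0 : 0 ≤ ν) (h1 : ν ≤ 1) :
    angB n b ν ≤ ENNReal.ofReal (2 ^ b) * angInt n 0 := by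
  unfold angB angInt
  rw [← lintegral_const_mul' _ _ ENNReal.ofReal_ne_top]
  refine setLIntegral_mono' measurableSet_Ioo fun θ hθ => ?_
  rw [← ENNReal.ofReal_mul (by positivity)]
  refine ENNReal.ofReal_le_ofReal ?_
  have hs := Real.sin_pos_of_mem_Ioo hθ
  have hc := abs_lt.1 (abs_cos_lt_one hθ)
  have h2 : (1 - ν * Real.cos θ) ^ b ≤ 2 ^ b :=
    Real.rpow_le_rpow (by nlinarith) (by nlinarith) hb
  rw [Real.rpow_zero, mul_one, mul_comm]
  gcongr

/-- The normalization of the Beta distribution. -/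
theorem lintegral_rpow_mul_one_sub_rpow {x y : ℝ} (hx : 0 < x) (hy : 0 < y) :
    ∫⁻ t in Ioo (0 : ℝ) 1, ENNReal.ofReal (t ^ (x - 1) * (1 - t) ^ (y - 1)) =
      ENNReal.ofReal (ProbabilityTheory.beta x y) := by
  have h := ProbabilityTheory.lintegral_betaPDF_eq_one hx hy
  have hB := ProbabilityTheory.beta_pos hx hy
  rw [ProbabilityTheory.lintegral_betaPDF] at h
  have e : ∀ t : ℝ, ENNReal.ofReal (1 / ProbabilityTheory.beta x y * t ^ (x - 1) *
      (1 - t) ^ (y - 1)) = ENNReal.ofReal (1 / ProbabilityTheory.beta x y) *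
        ENNReal.ofReal (t ^ (x - 1) * (1 - t) ^ (y - 1)) := by
    intro t
    rw [← ENNReal.ofReal_mul (by positivity), mul_assoc]
  simp_rw [e] at h
  rw [lintegral_const_mul' _ _ ENNReal.ofReal_ne_top] at h
  rw [one_div, ENNReal.ofReal_inv_of_pos hB, mul_comm, ← div_eq_mul_inv,
    ENNReal.div_eq_one_iff] at h
  · exact h
  · simpa using hB
  · exact ENNReal.ofReal_ne_top

/-- The substitution `x = (1 + cos θ)/2` yields a Beta integral, since `sin² θ = (1 + cos θ)(1 - cos
θ)`. -/
theorem angInt_eq {p : ℝ} (hp : 0 < p + (n + 1) / 2) :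
    angInt n p = ENNReal.ofReal (2 ^ (p + n) *
      ProbabilityTheory.beta (p + (n + 1) / 2) ((n + 1) / 2)) := by
  have himg : (fun θ => (1 + Real.cos θ) / 2) '' Ioo 0 Real.pi = Ioo 0 1 := by
    ext x
    constructor
    · rintro ⟨θ, hθ, rfl⟩
      have := abs_lt.1 (abs_cos_lt_one hθ)
      simp only [mem_Ioo]
      constructor <;> linarith
    · intro hx
      have h1 : -1 < 2 * x - 1 := by linarith [hx.1]
      have h2 : 2 * x - 1 < 1 := by linarith [hx.2]
      refine ⟨Real.arccos (2 * x - 1), ⟨Real.arccos_pos.2 h2, ?_⟩, ?_⟩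
      · exact lt_of_le_of_ne (Real.arccos_le_pi _) fun h => by
          rw [Real.arccos_eq_pi] at h; linarith
      · simp only []
        rw [Real.cos_arccos h1.le h2.le]; ring
  have hinj : InjOn (fun θ => (1 + Real.cos θ) / 2) (Ioo 0 Real.pi) := by
    intro x hx y hy h
    have h : Real.cos x = Real.cos y := by simp only at h; linarith
    exact Real.injOn_cos (Ioo_subset_Icc_self hx) (Ioo_subset_Icc_self hy) h
  have hder : ∀ θ ∈ Ioo 0 Real.pi, HasDerivWithinAt (fun θ => (1 + Real.cos θ) / 2)
      (-Real.sin θ / 2) (Ioo 0 Real.pi) θ := fun θ _ =>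
    (((Real.hasDerivAt_cos θ).const_add 1).div_const 2).hasDerivWithinAt
  have key := lintegral_image_eq_lintegral_abs_deriv_mul measurableSet_Ioo hder hinj
    (fun x => ENNReal.ofReal (2 ^ (p + n)) * ENNReal.ofReal (x ^ (p + (n + 1) / 2 - 1) *
      (1 - x) ^ (((n : ℝ) + 1) / 2 - 1)))
  rw [himg, lintegral_const_mul' _ _ ENNReal.ofReal_ne_top,
    lintegral_rpow_mul_one_sub_rpow hp (by positivity)] at key
  rw [ENNReal.ofReal_mul (by positivity), key]
  unfold angInt
  refine setLIntegral_congr_fun measurableSet_Ioo fun θ hθ => ?_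
  have hs := Real.sin_pos_of_mem_Ioo hθ
  have hc := abs_lt.1 (abs_cos_lt_one hθ)
  have h1 : 0 < 1 + Real.cos θ := by linarith
  have h2 : 0 < 1 - Real.cos θ := by linarith
  rw [neg_div, abs_neg, abs_of_pos (by positivity), ← ENNReal.ofReal_mul (by positivity),
    ← ENNReal.ofReal_mul (by positivity)]
  congr 1
  have hsin : Real.sin θ = (1 + Real.cos θ) ^ (1 / 2 : ℝ) * (1 - Real.cos θ) ^ (1 / 2 : ℝ) := by
    rw [← Real.mul_rpow h1.le h2.le, ← Real.sqrt_eq_rpow, eq_comm,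
      Real.sqrt_eq_iff_eq_sq (by nlinarith) hs.le]
    linear_combination -(Real.sin_sq_add_cos_sq θ)
  have h3 : 1 - (1 + Real.cos θ) / 2 = (1 - Real.cos θ) / 2 := by ring
  rw [h3, hsin, ← Real.rpow_natCast]
  generalize 1 + Real.cos θ = u at *
  generalize 1 - Real.cos θ = v at *
  rw [Real.div_rpow h1.le zero_le_two, Real.div_rpow h2.le zero_le_two,
    Real.mul_rpow (by positivity) (by positivity), ← Real.rpow_mul h1.le, ← Real.rpow_mul h2.le]
  have e2 : (2 : ℝ) ^ (p + (n : ℝ)) = 2 ^ (p + ((n : ℝ) + 1) / 2 - 1) *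
      2 ^ (((n : ℝ) + 1) / 2 - 1) * 2 := by
    rw [← Real.rpow_add zero_lt_two, ← Real.rpow_add_one two_ne_zero]
    congr 1; ring
  have eu : u ^ (p + ((n : ℝ) + 1) / 2 - 1) * u ^ (1 / 2 : ℝ) = u ^ (1 / 2 * (n : ℝ)) * u ^ p := by
    rw [← Real.rpow_add h1, ← Real.rpow_add h1]; congr 1; ring
  have ev : v ^ (((n : ℝ) + 1) / 2 - 1) * v ^ (1 / 2 : ℝ) = v ^ (1 / 2 * (n : ℝ)) := by
    rw [← Real.rpow_add h2]; congr 1; ring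
  have p1 : (0 : ℝ) < 2 ^ (p + ((n : ℝ) + 1) / 2 - 1) := by positivity
  have p2 : (0 : ℝ) < 2 ^ (((n : ℝ) + 1) / 2 - 1) := by positivity
  rw [e2, ← ev]
  generalize v ^ (((n : ℝ) + 1) / 2 - 1) = B
  generalize (2 : ℝ) ^ (p + ((n : ℝ) + 1) / 2 - 1) = D at *
  generalize (2 : ℝ) ^ (((n : ℝ) + 1) / 2 - 1) = D' at *
  generalize u ^ (p + ((n : ℝ) + 1) / 2 - 1) = A at *
  generalize u ^ p = W at *
  generalize u ^ (1 / 2 * (n : ℝ)) = U at *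
  generalize u ^ (1 / 2 : ℝ) = s at *
  generalize v ^ (1 / 2 : ℝ) = t at *
  field_simp
  linear_combination -B * t * eu

theorem angInt_ne_top {p : ℝ} (hp : 0 < p + (n + 1) / 2) : angInt n p ≠ ∞ := by
  rw [angInt_eq hp]; exact ENNReal.ofReal_ne_top

theorem angInt_ne_zero {p : ℝ} (hp : 0 < p + (n + 1) / 2) : angInt n p ≠ 0 := by
  rw [angInt_eq hp]
  have := ProbabilityTheory.beta_pos hp (by positivity : 0 < ((n : ℝ) + 1) / 2)
  simp only [ne_eq, ENNReal.ofReal_eq_zero, not_le]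
  positivity

/-- The average of `Z (p₁ · p₂)` over the angle between `p₁` and `p₂`. -/
def angAvg (n : ℕ) (m E₁ E₂ : ℝ) (Z : ℝ → ℝ≥0∞) : ℝ≥0∞ :=
  ∫⁻ θ in Ioo 0 Real.pi, ENNReal.ofReal (Real.sin θ ^ n) *
    Z (E₁ * E₂ - √(E₁ ^ 2 - m ^ 2) * (√(E₂ ^ 2 - m ^ 2) * Real.cos θ))

theorem measurable_angAvg (n : ℕ) (m : ℝ) {Z : ℝ → ℝ≥0∞} (hZ : Measurable Z) :
    Measurable fun p : ℝ × ℝ => angAvg n m p.1 p.2 Z := by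
  unfold angAvg
  refine Measurable.lintegral_prod_right' (f := fun q : (ℝ × ℝ) × ℝ =>
    ENNReal.ofReal (Real.sin q.2 ^ n) * Z (q.1.1 * q.1.2 - √(q.1.1 ^ 2 - m ^ 2) *
      (√(q.1.2 ^ 2 - m ^ 2) * Real.cos q.2))) ?_
  fun_prop

theorem norm_eq_sqrt_en (η : Space n) : ‖η‖ = √(en m η ^ 2 - m ^ 2) := by
  rw [en_sq, add_sub_cancel_left, Real.sqrt_sq (norm_nonneg _)]

/-- In polar coordinates about `η` a radial density sees the kernel only through its angular mean.
The average `angAvg` is not normalized, and `angInt n 0` is the missing total mass. -/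
theorem angInt_mul_lintegral_mdot (η : Space (n + 2)) {H Z : ℝ → ℝ≥0∞} (hH : Measurable H)
    (hZ : Measurable Z) :
    angInt n 0 * ∫⁻ x : Space (n + 2), H (en m x) * Z (mdot m η x) =
      ∫⁻ x : Space (n + 2), H (en m x) * angAvg n m (en m η) (en m x) Z := by
  have hav := measurable_angAvg n m hZ
  have h1 := lintegral_axial_polar η (F := fun r s => H (phi m r) * Z (en m η * phi m r - s))
    (by unfold Function.uncurry; fun_prop)
  have h2 := lintegral_axial_polar η (F := fun r _ => H (phi m r) *
    angAvg n m (en m η) (phi m r) Z) (by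
      unfold Function.uncurry
      exact Measurable.mul (by fun_prop)
        (hav.comp (f := fun p : ℝ × ℝ => (en m η, phi m p.1)) (by fun_prop)))
  refine Eq.trans (congrArg _ h1) (Eq.trans ?_ h2.symm)
  rw [mul_left_comm]
  congr 1
  rw [← lintegral_const_mul]
  swap
  · refine Measurable.lintegral_prod_right' (f := fun p : ℝ × ℝ => ENNReal.ofReal (p.1 ^ (n + 1)) *
      ENNReal.ofReal (Real.sin p.2 ^ n) * (H (phi m p.1) *
        Z (en m η * phi m p.1 - ‖η‖ * (p.1 * Real.cos p.2)))) ?_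
    fun_prop
  refine setLIntegral_congr_fun measurableSet_Ioi fun r hr => ?_
  have hr : 0 < r := hr
  have hphi : √(phi m r ^ 2 - m ^ 2) = r := by
    unfold phi
    rw [Real.sq_sqrt (by positivity), add_sub_cancel_left, Real.sqrt_sq hr.le]
  have e1 : ∀ θ, ENNReal.ofReal (r ^ (n + 1)) * ENNReal.ofReal (Real.sin θ ^ n) * (H (phi m r) *
      Z (en m η * phi m r - ‖η‖ * (r * Real.cos θ))) = (ENNReal.ofReal (r ^ (n + 1)) *
        H (phi m r)) * (ENNReal.ofReal (Real.sin θ ^ n) *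
          Z (en m η * phi m r - ‖η‖ * (r * Real.cos θ))) := fun θ => by ring
  have e2 : ∀ θ, ENNReal.ofReal (r ^ (n + 1)) * ENNReal.ofReal (Real.sin θ ^ n) * (H (phi m r) *
      angAvg n m (en m η) (phi m r) Z) = (ENNReal.ofReal (r ^ (n + 1)) *
        H (phi m r) * angAvg n m (en m η) (phi m r) Z) * ENNReal.ofReal (Real.sin θ ^ n) :=
    fun θ => by ring
  have e3 : angInt n 0 = ∫⁻ θ in Ioo 0 Real.pi, ENNReal.ofReal (Real.sin θ ^ n) := by
    unfold angInt
    simp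
  simp_rw [e1, e2]
  rw [lintegral_const_mul _ (by fun_prop), lintegral_const_mul _ (by fun_prop), ← e3]
  unfold angAvg
  rw [← norm_eq_sqrt_en, hphi]
  ring

end Angular

/-! ### Domination of the kernel by a power, and the upper bound -/

section UpperBound

variable {n : ℕ} {m β : ℝ}

/-- The exponent in the power which dominates the kernel of the null form. -/
def bExp (n : ℕ) (β : ℝ) : ℝ := n / 2 + 2 * β - 1 / 2

/-- The constant in front of the power which dominates the kernel of the null form. -/
def kap (n : ℕ) : ℝ := 2 ^ (-((n : ℝ) + 1) / 2)

theorem kap_pos (n : ℕ) : 0 < kap n := by unfold kap; positivity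

theorem kern_eq (hm : 0 < m) {X : ℝ} (hX : m ^ 2 < X) :
    kern n β m X = kap n * ((X - m ^ 2) ^ ((n : ℝ) / 2 + 2 * β) / √(m ^ 2 + X)) := by
  have hz : 0 < X - m ^ 2 := by linarith
  have hX0 : 0 < X := lt_of_le_of_lt (by positivity) hX
  unfold kern kap
  have h1 : √((X - m ^ 2) / 2) ^ n = (X - m ^ 2) ^ ((n : ℝ) / 2) / 2 ^ ((n : ℝ) / 2) := by
    rw [Real.sqrt_eq_rpow, ← Real.rpow_natCast, ← Real.rpow_mul (by positivity),
      Real.div_rpow hz.le zero_le_two]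
    ring_nf
  have h2 : √(2 * m ^ 2 + 2 * X) = 2 ^ (1 / 2 : ℝ) * √(m ^ 2 + X) := by
    rw [← mul_add, Real.sqrt_mul zero_le_two, Real.sqrt_eq_rpow 2]
  have h3 : (2 : ℝ) ^ (-((n : ℝ) + 1) / 2) = (2 ^ ((n : ℝ) / 2) * 2 ^ (1 / 2 : ℝ))⁻¹ := by
    rw [← Real.rpow_add zero_lt_two, ← Real.rpow_neg zero_le_two]
    congr 1; ring
  rw [h1, h2, h3, Real.rpow_add hz]
  have : 0 < √(m ^ 2 + X) := by positivity
  have : (0 : ℝ) < 2 ^ ((n : ℝ) / 2) := by positivity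
  have : (0 : ℝ) < 2 ^ (1 / 2 : ℝ) := by positivity
  field_simp

/-- In `(X - m²)^(n/2 + 2β) / √(m² + X)` both `X - m²` and `m² + X` are replaced by `X`. The
exponent is nonnegative, and `m > 0` makes the second replacement strict. -/
theorem kern_lt (hm : 0 < m) (ha : 0 ≤ (n : ℝ) / 2 + 2 * β) (hne : ¬ (n = 0 ∧ β = 0)) {X : ℝ}
    (hX : m ^ 2 ≤ X) : kern n β m X < kap n * X ^ bExp n β := by
  have hX0 : 0 < X := lt_of_lt_of_le (by positivity) hX
  have hk := kap_pos n
  rcases hX.eq_or_lt with rfl | hlt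
  · have : kern n β m (m ^ 2) = 0 := by
      unfold kern
      rcases Nat.eq_zero_or_pos n with h0 | h0
      · have hb : 2 * β ≠ 0 := fun h => hne ⟨h0, by linarith⟩
        rw [sub_self, Real.zero_rpow hb, mul_zero]
      · simp [h0.ne']
    rw [this]
    positivity
  · rw [kern_eq hm hlt]
    refine mul_lt_mul_of_pos_left ?_ hk
    have hb : bExp n β = (n : ℝ) / 2 + 2 * β - 1 / 2 := rfl
    rw [hb, Real.rpow_sub hX0, ← Real.sqrt_eq_rpow]
    refine div_lt_div₀' (Real.rpow_le_rpow (by linarith) (by nlinarith) ha) ?_ (by positivity)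
      (by positivity)
    exact Real.sqrt_lt_sqrt hX0.le (by nlinarith [sq_pos_of_pos hm])

/-- The ratio of spatial momenta to energies. -/
def velo (m E₁ E₂ : ℝ) : ℝ := √(E₁ ^ 2 - m ^ 2) * √(E₂ ^ 2 - m ^ 2) / (E₁ * E₂)

theorem velo_nonneg {E₁ E₂ : ℝ} (h₁ : 0 < E₁) (h₂ : 0 < E₂) : 0 ≤ velo m E₁ E₂ := by
  unfold velo; positivity

theorem velo_lt_one (hm : 0 < m) {E₁ E₂ : ℝ} (h₁ : m ≤ E₁) (h₂ : m ≤ E₂) : velo m E₁ E₂ < 1 := by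
  have h1 : 0 < E₁ := by linarith
  have h2 : 0 < E₂ := by linarith
  unfold velo
  rw [div_lt_one (by positivity)]
  have e1 : √(E₁ ^ 2 - m ^ 2) < E₁ := by
    rw [Real.sqrt_lt' h1]; nlinarith
  have e2 : √(E₂ ^ 2 - m ^ 2) < E₂ := by
    rw [Real.sqrt_lt' h2]; nlinarith
  exact mul_lt_mul'' e1 e2 (by positivity) (by positivity)

theorem minkowski_eq {E₁ E₂ : ℝ} (h₁ : 0 < E₁) (h₂ : 0 < E₂) (θ : ℝ) :
    E₁ * E₂ - √(E₁ ^ 2 - m ^ 2) * (√(E₂ ^ 2 - m ^ 2) * Real.cos θ) =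
      E₁ * E₂ * (1 - velo m E₁ E₂ * Real.cos θ) := by
  unfold velo
  field_simp

theorem sq_le_minkowski (hm : 0 < m) {E₁ E₂ : ℝ} (h₁ : m ≤ E₁) (h₂ : m ≤ E₂) (θ : ℝ) :
    m ^ 2 ≤ E₁ * E₂ - √(E₁ ^ 2 - m ^ 2) * (√(E₂ ^ 2 - m ^ 2) * Real.cos θ) := by
  have e1 := Real.sq_sqrt (show 0 ≤ E₁ ^ 2 - m ^ 2 by nlinarith)
  have e2 := Real.sq_sqrt (show 0 ≤ E₂ ^ 2 - m ^ 2 by nlinarith)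
  have p1 := Real.sqrt_nonneg (E₁ ^ 2 - m ^ 2)
  have p2 := Real.sqrt_nonneg (E₂ ^ 2 - m ^ 2)
  generalize √(E₁ ^ 2 - m ^ 2) = x at *
  generalize √(E₂ ^ 2 - m ^ 2) = y at *
  have h3 : x * (y * Real.cos θ) ≤ x * y := by
    nlinarith [mul_nonneg p1 p2, Real.cos_le_one θ]
  have h4 : m ^ 2 + x * y ≤ E₁ * E₂ := by
    refine abs_le_of_sq_le_sq' ?_ (by nlinarith) |>.2
    nlinarith [sq_nonneg (x - y)]
  linarith

theorem angAvg_rpow (hm : 0 < m) {E₁ E₂ : ℝ} (h₁ : m ≤ E₁) (h₂ : m ≤ E₂) (c b : ℝ) (hc : 0 ≤ c) :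
    angAvg n m E₁ E₂ (fun X => ENNReal.ofReal (c * X ^ b)) =
      ENNReal.ofReal (c * (E₁ * E₂) ^ b) * angB n b (velo m E₁ E₂) := by
  have p1 : 0 < E₁ := by linarith
  have p2 : 0 < E₂ := by linarith
  unfold angAvg angB
  rw [← lintegral_const_mul' _ _ ENNReal.ofReal_ne_top]
  refine setLIntegral_congr_fun measurableSet_Ioo fun θ hθ => ?_
  have hv0 := velo_nonneg (m := m) p1 p2
  have hv1 := velo_lt_one hm h₁ h₂
  have hs := Real.sin_pos_of_mem_Ioo hθ
  have hle : velo m E₁ E₂ * Real.cos θ < 1 := by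
    nlinarith [Real.cos_le_one θ]
  simp only
  rw [minkowski_eq p1 p2, Real.mul_rpow (by positivity) (by linarith),
    ← ENNReal.ofReal_mul (by positivity), ← ENNReal.ofReal_mul (by positivity)]
  congr 1
  ring

theorem angB_ne_top {b ν : ℝ} (hb : 0 < b + (n + 1) / 2) (h0 : 0 ≤ ν) (h1 : ν ≤ 1) :
    angB n b ν ≠ ∞ := by
  by_cases h : b ≤ 0 ∨ 1 ≤ b
  · exact ((angB_le_of_convex h h0 h1).trans_lt (angInt_ne_top hb).lt_top).ne
  · have hb0 : 0 ≤ b := by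
      by_contra h'
      exact h (Or.inl (by linarith))
    exact ((angB_le_of_nonneg hb0 h0 h1).trans_lt (ENNReal.mul_lt_top ENNReal.ofReal_lt_top
      (angInt_ne_top (by positivity)).lt_top)).ne

/-- The left side is `n + 2β`. Positivity is the condition for `sinⁿ θ (1 - cos θ)^b` to be
integrable at `θ = 0`; in the admissible range it fails only for `d = 2`, `β = 0`. -/
theorem bExp_add (ha : 0 ≤ (n : ℝ) / 2 + 2 * β) (hne : ¬ (n = 0 ∧ β = 0)) :
    0 < bExp n β + (n + 1) / 2 := by
  unfold bExp
  rcases Nat.eq_zero_or_pos n with h0 | h0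
  · subst h0
    have : β ≠ 0 := fun h => hne ⟨rfl, h⟩
    have : 0 < β := lt_of_le_of_ne (by simpa using ha) (Ne.symm this)
    simp only [Nat.cast_zero]
    linarith
  · have : (1 : ℝ) ≤ n := by exact_mod_cast h0
    linarith

theorem angAvg_kern_lt (hm : 0 < m) (ha : 0 ≤ (n : ℝ) / 2 + 2 * β) (hne : ¬ (n = 0 ∧ β = 0))
    {E₁ E₂ : ℝ} (h₁ : m ≤ E₁) (h₂ : m ≤ E₂) :
    angAvg n m E₁ E₂ (fun X => ENNReal.ofReal (kern n β m X)) <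
      ENNReal.ofReal (kap n * (E₁ * E₂) ^ bExp n β) * angB n (bExp n β) (velo m E₁ E₂) := by
  have p1 : 0 < E₁ := by linarith
  have p2 : 0 < E₂ := by linarith
  have hk := kap_pos n
  have hfin : ENNReal.ofReal (kap n * (E₁ * E₂) ^ bExp n β) *
      angB n (bExp n β) (velo m E₁ E₂) ≠ ∞ := ENNReal.mul_ne_top ENNReal.ofReal_ne_top
    (angB_ne_top (bExp_add ha hne) (velo_nonneg p1 p2) (velo_lt_one hm h₁ h₂).le)
  rw [← angAvg_rpow hm h₁ h₂ _ _ hk.le] at hfin ⊢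
  have hlt : ∀ θ ∈ Ioo 0 Real.pi, ENNReal.ofReal (Real.sin θ ^ n) * ENNReal.ofReal (kern n β m
      (E₁ * E₂ - √(E₁ ^ 2 - m ^ 2) * (√(E₂ ^ 2 - m ^ 2) * Real.cos θ))) <
      ENNReal.ofReal (Real.sin θ ^ n) * ENNReal.ofReal (kap n *
        (E₁ * E₂ - √(E₁ ^ 2 - m ^ 2) * (√(E₂ ^ 2 - m ^ 2) * Real.cos θ)) ^ bExp n β) := by
    intro θ hθ
    have hs := Real.sin_pos_of_mem_Ioo hθ
    have hX := sq_le_minkowski hm h₁ h₂ θ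
    have hlt := kern_lt hm ha hne hX
    have h0 := kern_nonneg (n := n) (β := β) hX
    rw [← ENNReal.ofReal_mul (by positivity), ← ENNReal.ofReal_mul (by positivity)]
    exact (ENNReal.ofReal_lt_ofReal_iff_of_nonneg (by positivity)).2
      (mul_lt_mul_of_pos_left hlt (by positivity))
  have hmk := measurable_kern n β m
  unfold angAvg at hfin ⊢
  refine lintegral_strict_mono ?_ ?_ ?_ ?_
  · rw [Ne, Measure.restrict_eq_zero, Real.volume_Ioo]
    simp [Real.pi_pos]
  · fun_prop
  · refine (lt_of_le_of_lt (setLIntegral_mono' measurableSet_Ioo fun θ hθ => (hlt θ hθ).le)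
      hfin.lt_top).ne
  · exact (ae_restrict_iff' measurableSet_Ioo).2 (Eventually.of_forall hlt)

/-- The square of the weighted norm of data whose squared modulus is `A`. -/
def energy (n : ℕ) (m p : ℝ) (A : ℝ → ℝ≥0∞) : ℝ≥0∞ :=
  ∫⁻ η : Space (n + 2), A (en m η) * ENNReal.ofReal (en m η ^ p)

theorem angInt_mul_nullForm (hm : 0 < m) {A B : ℝ → ℝ≥0∞} (hA : Measurable A)
    (hB : Measurable B) :
    angInt n 0 * nullForm n m (fun v => ENNReal.ofReal (v ^ (2 * β))) A B =
      sph n * angInt n (2 * β) * ∫⁻ η : Space (n + 2), ∫⁻ x : Space (n + 2),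
        A (en m η) * ENNReal.ofReal (en m η) * (B (en m x) * ENNReal.ofReal (en m x) *
          angAvg n m (en m η) (en m x) (fun X => ENNReal.ofReal (kern n β m X))) := by
  have hk := measurable_kern n β m
  have hmd2 := measurable_mdot (n := n + 2) m
  have hav := measurable_angAvg n m (Z := fun X => ENNReal.ofReal (kern n β m X)) (by fun_prop)
  rw [nullForm_eq hm β hA hB, mul_left_comm, ← lintegral_const_mul]
  swap
  · refine Measurable.lintegral_prod_right' (f := fun p : Space (n + 2) × Space (n + 2) =>
      A (en m p.1) * ENNReal.ofReal (en m p.1) * (B (en m p.2) * ENNReal.ofReal (en m p.2) *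
          ENNReal.ofReal (kern n β m (mdot m p.1 p.2)))) ?_
    fun_prop
  congr 1
  refine lintegral_congr fun η => ?_
  have hm3 : Measurable fun x : Space (n + 2) => mdot m η x := by fun_prop
  rw [lintegral_const_mul _ (by fun_prop), lintegral_const_mul, mul_left_comm,
    angInt_mul_lintegral_mdot (m := m) η (H := fun e => B e * ENNReal.ofReal e)
      (Z := fun X => ENNReal.ofReal (kern n β m X)) (by fun_prop) (by fun_prop)]
  exact Measurable.mul (by fun_prop)
    (hav.comp (f := fun x : Space (n + 2) => (en m η, en m x)) (by fun_prop))

theorem lintegral_energy_mul {p : ℝ} (hm : 0 < m) {A B : ℝ → ℝ≥0∞} (hA : Measurable A)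
    (hB : Measurable B) (c : ℝ≥0∞) :
    ∫⁻ η : Space (n + 2), ∫⁻ x : Space (n + 2),
        A (en m η) * ENNReal.ofReal (en m η) * (B (en m x) * ENNReal.ofReal (en m x) *
          (c * ENNReal.ofReal ((en m η * en m x) ^ p))) =
      c * (energy n m (p + 1) A * energy n m (p + 1) B) := by
  unfold energy
  rw [← lintegral_mul_const _ (by fun_prop), ← lintegral_const_mul _ (by fun_prop)]
  refine lintegral_congr fun η => ?_
  rw [← lintegral_const_mul _ (by fun_prop), ← lintegral_const_mul _ (by fun_prop)]
  refine lintegral_congr fun x => ?_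
  have h1 := en_pos hm η
  have h2 := en_pos hm x
  rw [Real.mul_rpow h1.le h2.le, ENNReal.ofReal_mul (by positivity), Real.rpow_add_one h1.ne',
    Real.rpow_add_one h2.ne', ENNReal.ofReal_mul (by positivity), ENNReal.ofReal_mul (by positivity)]
  ring

theorem angInt_mul_nullForm_le (hm : 0 < m) (ha : 0 ≤ (n : ℝ) / 2 + 2 * β)
    (hne : ¬ (n = 0 ∧ β = 0)) {A B : ℝ → ℝ≥0∞} (hA : Measurable A) (hB : Measurable B)
    {M : ℝ≥0∞} (hM : ∀ ν : ℝ, 0 ≤ ν → ν ≤ 1 → angB n (bExp n β) ν ≤ M) :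
    angInt n 0 * nullForm n m (fun v => ENNReal.ofReal (v ^ (2 * β))) A B ≤
      sph n * angInt n (2 * β) * (ENNReal.ofReal (kap n) * M *
        (energy n m (bExp n β + 1) A * energy n m (bExp n β + 1) B)) := by
  rw [angInt_mul_nullForm hm hA hB, ← lintegral_energy_mul hm hA hB]
  refine mul_le_mul_right (lintegral_mono fun η => lintegral_mono fun x => ?_) _
  refine mul_le_mul_right (mul_le_mul_right ?_ _) _
  have h1 := le_en (m := m) η
  have h2 := le_en (m := m) x
  refine (angAvg_kern_lt hm ha hne h1 h2).le.trans ?_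
  rw [ENNReal.ofReal_mul (kap_pos n).le, mul_right_comm]
  exact mul_le_mul_left (mul_le_mul_right (hM _ (velo_nonneg (en_pos hm _) (en_pos hm _))
    (velo_lt_one hm h1 h2).le) _) _

/-- The pointwise kernel bound is strict everywhere. Strictness survives integration because the
larger integral is finite and both data are nonzero on sets of positive measure. -/
theorem angInt_mul_nullForm_lt (hm : 0 < m) (ha : 0 ≤ (n : ℝ) / 2 + 2 * β)
    (hne : ¬ (n = 0 ∧ β = 0)) (hβ : 0 < 2 * β + ((n : ℝ) + 1) / 2) {A B : ℝ → ℝ≥0∞}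
    (hA : Measurable A) (hB : Measurable B)
    {M : ℝ≥0∞} (hM : ∀ ν : ℝ, 0 ≤ ν → ν ≤ 1 → angB n (bExp n β) ν ≤ M) (hMt : M ≠ ∞)
    (hA' : ∀ x, A x ≠ ∞) (hB' : ∀ x, B x ≠ ∞)
    (hEA : energy n m (bExp n β + 1) A ≠ ∞) (hEB : energy n m (bExp n β + 1) B ≠ ∞)
    (hEA0 : energy n m (bExp n β + 1) A ≠ 0) (hEB0 : energy n m (bExp n β + 1) B ≠ 0) :
    angInt n 0 * nullForm n m (fun v => ENNReal.ofReal (v ^ (2 * β))) A B <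
      sph n * angInt n (2 * β) * (ENNReal.ofReal (kap n) * M *
        (energy n m (bExp n β + 1) A * energy n m (bExp n β + 1) B)) := by
  have hk := measurable_kern n β m
  have hav := measurable_angAvg n m (Z := fun X => ENNReal.ofReal (kern n β m X)) (by fun_prop)
  have hfin : ENNReal.ofReal (kap n) * M *
        (energy n m (bExp n β + 1) A * energy n m (bExp n β + 1) B) ≠ ∞ :=
    ENNReal.mul_ne_top (ENNReal.mul_ne_top ENNReal.ofReal_ne_top hMt) (ENNReal.mul_ne_top hEA hEB)
  have hpos : sph n * angInt n (2 * β) ≠ 0 := mul_ne_zero (sph_pos n) (angInt_ne_zero hβ)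
  have hpos' : sph n * angInt n (2 * β) ≠ ∞ :=
    ENNReal.mul_ne_top (sph_ne_top n) (angInt_ne_top hβ)
  rw [angInt_mul_nullForm hm hA hB]
  refine ENNReal.mul_lt_mul_right hpos hpos' ?_
  rw [← lintegral_energy_mul hm hA hB] at hfin ⊢
  have hpt : ∀ η x : Space (n + 2),
      angAvg n m (en m η) (en m x) (fun X => ENNReal.ofReal (kern n β m X)) <
        ENNReal.ofReal (kap n) * M * ENNReal.ofReal ((en m η * en m x) ^ bExp n β) := by
    intro η x
    have h1 := le_en (m := m) η
    have h2 := le_en (m := m) x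
    refine (angAvg_kern_lt hm ha hne h1 h2).trans_le ?_
    rw [ENNReal.ofReal_mul (kap_pos n).le, mul_right_comm]
    exact mul_le_mul_left (mul_le_mul_right (hM _ (velo_nonneg (en_pos hm _) (en_pos hm _))
      (velo_lt_one hm h1 h2).le) _) _
  -- A profile vanishing at almost every point would have zero energy.
  have hfreq : ∀ {A : ℝ → ℝ≥0∞}, energy n m (bExp n β + 1) A ≠ 0 →
      ∃ᵐ η : Space (n + 2), A (en m η) ≠ 0 := by
    intro A h hcon
    refine h ?_
    unfold energy
    rw [lintegral_congr_ae (g := fun _ => 0), lintegral_zero]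
    filter_upwards [hcon] with η hη
    rw [not_not.1 hη, zero_mul]
  have hle : ∀ η x : Space (n + 2), A (en m η) * ENNReal.ofReal (en m η) *
      (B (en m x) * ENNReal.ofReal (en m x) *
          angAvg n m (en m η) (en m x) (fun X => ENNReal.ofReal (kern n β m X))) ≤
      A (en m η) * ENNReal.ofReal (en m η) * (B (en m x) * ENNReal.ofReal (en m x) *
        (ENNReal.ofReal (kap n) * M * ENNReal.ofReal ((en m η * en m x) ^ bExp n β))) :=
    fun η x => mul_le_mul_right (mul_le_mul_right (hpt η x).le _) _
  have hlt : ∀ η x : Space (n + 2), A (en m η) ≠ 0 → B (en m x) ≠ 0 →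
      A (en m η) * ENNReal.ofReal (en m η) *
      (B (en m x) * ENNReal.ofReal (en m x) *
          angAvg n m (en m η) (en m x) (fun X => ENNReal.ofReal (kern n β m X))) <
      A (en m η) * ENNReal.ofReal (en m η) * (B (en m x) * ENNReal.ofReal (en m x) *
        (ENNReal.ofReal (kap n) * M * ENNReal.ofReal ((en m η * en m x) ^ bExp n β))) := by
    intro η x h1 h2
    have e1 : ENNReal.ofReal (en m η) ≠ 0 := by simpa using en_pos hm η
    have e2 : ENNReal.ofReal (en m x) ≠ 0 := by simpa using en_pos hm x
    refine ENNReal.mul_lt_mul_right (mul_ne_zero h1 e1)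
      (ENNReal.mul_ne_top (hA' _) ENNReal.ofReal_ne_top) ?_
    exact ENNReal.mul_lt_mul_right (mul_ne_zero h2 e2)
      (ENNReal.mul_ne_top (hB' _) ENNReal.ofReal_ne_top) (hpt η x)
  have hmeas : Measurable fun p : Space (n + 2) × Space (n + 2) =>
      A (en m p.1) * ENNReal.ofReal (en m p.1) * (B (en m p.2) * ENNReal.ofReal (en m p.2) *
        (ENNReal.ofReal (kap n) * M * ENNReal.ofReal ((en m p.1 * en m p.2) ^ bExp n β))) := by
    fun_prop
  have hae := ae_lt_top hmeas.lintegral_prod_right' hfin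
  refine lintegral_strict_mono_of_ae_le_of_frequently_ae_lt hmeas.lintegral_prod_right'.aemeasurable
    (lt_of_le_of_lt (lintegral_mono fun η => lintegral_mono fun x => hle η x) hfin.lt_top).ne
    (Eventually.of_forall fun η => lintegral_mono fun x => hle η x) ?_
  refine ((hfreq hEA0).and_eventually hae).mono fun η hη => (ne_of_lt ?_)
  refine lintegral_strict_mono_of_ae_le_of_frequently_ae_lt
    (hmeas.comp measurable_prodMk_left).aemeasurable
    (lt_of_le_of_lt (lintegral_mono fun x => hle η x) hη.2).ne
    (Eventually.of_forall fun x => hle η x) ?_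
  exact (hfreq hEB0).mono fun x hx => (hlt η x hη.1 hx).ne

end UpperBound

/-! ### Evaluation of the constant -/

section Constants

variable {n : ℕ} {β : ℝ}

theorem sph_eq (n : ℕ) :
    sph n = ENNReal.ofReal (2 * Real.pi ^ (((n : ℝ) + 1) / 2) / Real.Gamma (((n : ℝ) + 1) / 2)) := by
  have hG : 0 < Real.Gamma (((n : ℝ) + 1) / 2) := Real.Gamma_pos_of_pos (by positivity)
  unfold sph
  rw [EuclideanSpace.volume_ball, ENNReal.ofReal_one, one_pow, one_mul, Fintype.card_fin,
    ← ENNReal.ofReal_natCast, ← ENNReal.ofReal_mul (by positivity)]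
  congr 1
  push_cast
  rw [Real.Gamma_add_one (by positivity), Real.sqrt_eq_rpow, ← Real.rpow_natCast,
    ← Real.rpow_mul Real.pi_nonneg]
  push_cast
  rw [show 1 / 2 * ((n : ℝ) + 1) = ((n : ℝ) + 1) / 2 by ring]
  field_simp

theorem constF_pos (hβ : 0 < (n : ℝ) + 2 * β) (hβ' : 0 < 2 * β + ((n : ℝ) + 1) / 2) :
    0 < constF β (n + 2) := by
  unfold constF
  push_cast
  have h1 : 0 < Real.Gamma (((n : ℝ) + 2) / 2) := Real.Gamma_pos_of_pos (by positivity)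
  have h2 : 0 < Real.Gamma (((n : ℝ) + 2 - 1) / 2 + 2 * β) :=
    Real.Gamma_pos_of_pos (by linarith)
  have h3 : 0 < Real.Gamma ((3 * ((n : ℝ) + 2) - 5) / 2 + 2 * β) :=
    Real.Gamma_pos_of_pos (by linarith [(Nat.cast_nonneg n : (0 : ℝ) ≤ n)])
  have h4 : 0 < (n : ℝ) + 2 - 2 + 2 * β := by linarith
  positivity

theorem sph_mul_angInt (hβ : 0 < (n : ℝ) + 2 * β) (hβ' : 0 < 2 * β + ((n : ℝ) + 1) / 2) :
    sph n * angInt n (2 * β) * (ENNReal.ofReal (kap n) * angInt n (bExp n β)) =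
      ENNReal.ofReal ((2 * Real.pi) ^ (n + 1) * constF β (n + 2)) * angInt n 0 := by
  have hn : (0 : ℝ) ≤ n := Nat.cast_nonneg n
  have hF := constF_pos hβ hβ'
  have hb : bExp n β + ((n : ℝ) + 1) / 2 = n + 2 * β := by unfold bExp; ring
  have hc : 0 < (((n : ℝ) + 1) / 2) := by positivity
  have b1 := ProbabilityTheory.beta_pos hβ' hc
  have b2 := ProbabilityTheory.beta_pos (hb ▸ hβ) hc
  rw [sph_eq, angInt_eq hβ', angInt_eq (hb ▸ hβ), angInt_eq (p := 0) (by positivity)]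
  rw [← ENNReal.ofReal_mul (kap_pos n).le, ← ENNReal.ofReal_mul (by positivity),
    ← ENNReal.ofReal_mul (by positivity), ← ENNReal.ofReal_mul (by positivity)]
  congr 1
  unfold ProbabilityTheory.beta constF kap
  rw [hb]
  push_cast
  have g0 : 0 < Real.Gamma (((n : ℝ) + 1) / 2) := Real.Gamma_pos_of_pos hc
  have g1 : 0 < Real.Gamma ((n : ℝ) / 2 + 1) := Real.Gamma_pos_of_pos (by positivity)
  have g2 : 0 < Real.Gamma (2 * β + ((n : ℝ) + 1) / 2) := Real.Gamma_pos_of_pos hβ'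
  have g3 : 0 < Real.Gamma ((n : ℝ) + 2 * β) := Real.Gamma_pos_of_pos hβ
  have g4 : 0 < Real.Gamma ((3 * (n : ℝ) + 1) / 2 + 2 * β) :=
    Real.Gamma_pos_of_pos (by linarith)
  have g5 : 0 < Real.Gamma ((n : ℝ) + 1) := Real.Gamma_pos_of_pos (by positivity)
  -- Legendre duplication relates `Γ((n+1)/2) Γ(n/2 + 1)` to `Γ(n + 1)`. The former come from the
  -- sphere area and from `constF`, the latter from the Beta function in `angInt n 0`.
  have dup := Real.Gamma_mul_Gamma_add_half (((n : ℝ) + 1) / 2)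
  rw [show ((n : ℝ) + 1) / 2 + 1 / 2 = n / 2 + 1 by ring,
    show 2 * (((n : ℝ) + 1) / 2) = n + 1 by ring, show 1 - ((n : ℝ) + 1) = -n by ring] at dup
  rw [show 2 * β + ((n : ℝ) + 1) / 2 + ((n : ℝ) + 1) / 2 = n + 2 * β + 1 by ring,
    Real.Gamma_add_one hβ.ne',
    show ((n : ℝ) + 2) / 2 = n / 2 + 1 by ring,
    show ((n : ℝ) + 2 - 1) / 2 + 2 * β = 2 * β + ((n : ℝ) + 1) / 2 by ring,
    show ((n : ℝ) + 2 - 2 + 2 * β) = n + 2 * β by ring,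
    show (3 * ((n : ℝ) + 2) - 5) / 2 + 2 * β = (3 * (n : ℝ) + 1) / 2 + 2 * β by ring,
    show (n : ℝ) + 2 * β + ((n : ℝ) + 1) / 2 = (3 * (n : ℝ) + 1) / 2 + 2 * β by ring,
    show (0 : ℝ) + ((n : ℝ) + 1) / 2 = ((n : ℝ) + 1) / 2 by ring,
    show ((n : ℝ) + 1) / 2 + ((n : ℝ) + 1) / 2 = n + 1 by ring, zero_add,
    mul_pow, ← Real.rpow_natCast 2 (n + 1), ← Real.rpow_natCast Real.pi (n + 1)]
  push_cast
  have e1 : (2 : ℝ) ^ (2 * β + n) * 2 ^ (-((n : ℝ) + 1) / 2) * 2 ^ (bExp n β + n) * 2 =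
      2 ^ ((n : ℝ) + 1) * 2 ^ ((n : ℝ) + 2 - 3 + 4 * β) * 2 ^ (n : ℝ) * 2 ^ (-(n : ℝ)) := by
    rw [← Real.rpow_add zero_lt_two, ← Real.rpow_add zero_lt_two, ← Real.rpow_add_one two_ne_zero,
      ← Real.rpow_add zero_lt_two, ← Real.rpow_add zero_lt_two, ← Real.rpow_add zero_lt_two]
    congr 1; unfold bExp; ring
  have e2 : Real.pi ^ (((n : ℝ) + 1) / 2) =
      Real.pi ^ ((n : ℝ) + 1) * Real.pi ^ (-((n : ℝ) + 2) / 2) * √Real.pi := by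
    rw [Real.sqrt_eq_rpow, ← Real.rpow_add Real.pi_pos, ← Real.rpow_add Real.pi_pos]
    congr 1; ring
  have hsp : 0 < √Real.pi := by positivity
  rw [e2]
  generalize √Real.pi = sp at *
  generalize Real.Gamma (((n : ℝ) + 1) / 2) = G0 at *
  generalize Real.Gamma ((n : ℝ) / 2 + 1) = G1 at *
  generalize Real.Gamma (2 * β + ((n : ℝ) + 1) / 2) = G2 at *
  generalize Real.Gamma ((n : ℝ) + 2 * β) = G3 at *
  generalize Real.Gamma ((3 * (n : ℝ) + 1) / 2 + 2 * β) = G4 at *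
  generalize Real.Gamma ((n : ℝ) + 1) = G5 at *
  generalize Real.pi ^ ((n : ℝ) + 1) = p1
  generalize Real.pi ^ (-((n : ℝ) + 2) / 2) = p2
  generalize (2 : ℝ) ^ (2 * β + n) = t1 at *
  generalize (2 : ℝ) ^ (-((n : ℝ) + 1) / 2) = t2 at *
  generalize (2 : ℝ) ^ (bExp n β + n) = t3 at *
  generalize (2 : ℝ) ^ ((n : ℝ) + 1) = t4 at *
  generalize (2 : ℝ) ^ ((n : ℝ) + 2 - 3 + 4 * β) = t5 at *
  generalize (2 : ℝ) ^ (n : ℝ) = t6 at *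
  generalize (2 : ℝ) ^ (-(n : ℝ)) = t7 at *
  generalize (n : ℝ) + 2 * β = w at *
  field_simp
  have e3 : t1 * t2 * t3 * 2 * (G5 * sp) = t4 * t5 * t6 * (G0 * G1) := by
    rw [dup, e1]; ring
  linear_combination p1 * p2 * e3

end Constants

/-! ### The `L²` Fourier transform on integrable functions; truncation -/

section FourierL2

variable {V : Type*} [NormedAddCommGroup V] [InnerProductSpace ℝ V] [FiniteDimensional ℝ V]
  [MeasurableSpace V] [BorelSpace V]

theorem ae_eq_of_forall_integral_schwartz_eq {G G' : V → ℂ} (hG : LocallyIntegrable G)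
    (hG' : LocallyIntegrable G') (h : ∀ ψ : 𝓢(V, ℂ), ∫ x, G x * ψ x = ∫ x, G' x * ψ x) :
    G =ᵐ[volume] G' := by
  refine ae_eq_of_integral_contDiff_smul_eq hG hG' fun g hg hc => ?_
  have hg₁ : HasCompactSupport (Complex.ofRealCLM ∘ g) := hc.comp_left rfl
  have hg₂ : ContDiff ℝ ((⊤ : ℕ∞) : WithTop ℕ∞) (Complex.ofRealCLM ∘ g) := by fun_prop
  have := h (hg₁.toSchwartzMap hg₂)
  simpa [mul_comm] using this

/-- Both functions pair equally with every Schwartz function: the transform is moved onto the test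
function, as a tempered distribution on one side and by Fubini on the other. -/
theorem coeFn_fourier_of_integrable (f : Lp (α := V) ℂ 2) (hf : Integrable (f : V → ℂ)) :
    ((𝓕 f : Lp (α := V) ℂ 2) : V → ℂ) =ᵐ[volume] 𝓕 (f : V → ℂ) := by
  have hc : Continuous (𝓕 (f : V → ℂ)) :=
    VectorFourier.fourierIntegral_continuous Real.continuous_fourierChar
      (by exact continuous_inner) hf
  refine ae_eq_of_forall_integral_schwartz_eq
    ((Lp.memLp _).locallyIntegrable one_le_two) hc.locallyIntegrable fun ψ => ?_
  have h1 := DFunLike.congr_fun (Lp.fourier_toTemperedDistribution_eq f) ψ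
  rw [TemperedDistribution.fourier_apply, Lp.toTemperedDistribution_apply,
    Lp.toTemperedDistribution_apply] at h1
  have h2 := VectorFourier.integral_fourierIntegral_smul_eq_flip (μ := (volume : Measure V))
    (ν := (volume : Measure V)) (L := innerₗ V) (f := (ψ : V → ℂ)) (g := (f : V → ℂ))
    Real.continuous_fourierChar (by exact continuous_inner) ψ.integrable hf
  rw [flip_innerₗ] at h2
  have h3 := h1.symm.trans h2
  simp only [smul_eq_mul] at h3
  simp_rw [mul_comm _ (ψ _)]
  exact h3

theorem coeFn_fourierInv_of_integrable (f : Lp (α := V) ℂ 2) (hf : Integrable (f : V → ℂ)) :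
    ((𝓕⁻ f : Lp (α := V) ℂ 2) : V → ℂ) =ᵐ[volume] 𝓕⁻ (f : V → ℂ) := by
  have hc : Continuous (𝓕⁻ (f : V → ℂ)) :=
    VectorFourier.fourierIntegral_continuous Real.continuous_fourierChar
      (by exact continuous_inner.neg) hf
  refine ae_eq_of_forall_integral_schwartz_eq
    ((Lp.memLp _).locallyIntegrable one_le_two) hc.locallyIntegrable fun ψ => ?_
  have h1 := DFunLike.congr_fun (Lp.fourierInv_toTemperedDistribution_eq f) ψ
  rw [TemperedDistribution.fourierInv_apply, Lp.toTemperedDistribution_apply,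
    Lp.toTemperedDistribution_apply, SchwartzMap.fourierInv_coe] at h1
  have h2 := VectorFourier.integral_fourierIntegral_smul_eq_flip (μ := (volume : Measure V))
    (ν := (volume : Measure V)) (L := -innerₗ V) (f := (ψ : V → ℂ)) (g := (f : V → ℂ))
    Real.continuous_fourierChar (by exact continuous_inner.neg) ψ.integrable hf
  have h4 : (-innerₗ V).flip = -innerₗ V := by
    ext x y
    simp [real_inner_comm]
  rw [h4] at h2
  have h3 := h1.symm.trans h2
  simp only [smul_eq_mul] at h3
  simp_rw [mul_comm _ (ψ _)]
  exact h3

/-- Truncation of an `L²` function to a ball. -/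
def truncBall (k : ℕ) (f : Lp (α := V) ℂ 2) : Lp (α := V) ℂ 2 :=
  ((Lp.memLp f).indicator (s := Metric.ball (0 : V) k) measurableSet_ball).toLp _

theorem coeFn_truncBall (k : ℕ) (f : Lp (α := V) ℂ 2) :
    (truncBall k f : V → ℂ) =ᵐ[volume] (Metric.ball (0 : V) k).indicator f :=
  MemLp.coeFn_toLp _

theorem integrable_truncBall (k : ℕ) (f : Lp (α := V) ℂ 2) :
    Integrable (truncBall k f : V → ℂ) := by
  refine Integrable.congr ?_ (coeFn_truncBall k f).symm
  rw [integrable_indicator_iff measurableSet_ball]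
  exact (((Lp.memLp f).locallyIntegrable one_le_two).integrableOn_isCompact
    (isCompact_closedBall (0 : V) k)).mono_set Metric.ball_subset_closedBall

theorem tendsto_truncBall (f : Lp (α := V) ℂ 2) :
    Tendsto (fun k => truncBall k f) atTop (𝓝 f) := by
  rw [Lp.tendsto_Lp_iff_tendsto_eLpNorm']
  have hm : AEMeasurable (fun x => ‖f x‖ₑ) volume := (Lp.aestronglyMeasurable f).enorm
  have h1 : ∀ k : ℕ, eLpNorm (⇑(truncBall k f) - ⇑f) 2 volume =
      (∫⁻ x, (Metric.ball (0 : V) k)ᶜ.indicator (fun x => ‖f x‖ₑ ^ (2 : ℝ)) x) ^ (1 / 2 : ℝ) := by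
    intro k
    rw [eLpNorm_eq_lintegral_rpow_enorm_toReal two_ne_zero ENNReal.ofNat_ne_top]
    simp only [ENNReal.toReal_ofNat]
    congr 1
    refine lintegral_congr_ae ?_
    filter_upwards [coeFn_truncBall k f] with x hx
    by_cases h : x ∈ Metric.ball (0 : V) k
    · simp [hx, h]
    · simp [hx, h]
  simp_rw [h1]
  have h2 : Tendsto (fun k : ℕ => ∫⁻ x, (Metric.ball (0 : V) k)ᶜ.indicator
      (fun x => ‖f x‖ₑ ^ (2 : ℝ)) x) atTop (𝓝 (∫⁻ _ : V, 0)) := by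
    refine tendsto_lintegral_of_dominated_convergence' (fun x => ‖f x‖ₑ ^ (2 : ℝ)) (fun k => ?_)
      (fun k => ?_) ?_ ?_
    · exact (hm.pow_const _).indicator measurableSet_ball.compl
    · exact Eventually.of_forall fun x => indicator_le_self _ _ _
    · have := (Lp.memLp f).2
      rw [eLpNorm_lt_top_iff_lintegral_rpow_enorm_lt_top two_ne_zero ENNReal.ofNat_ne_top] at this
      exact this.ne
    · refine Eventually.of_forall fun x => ?_
      obtain ⟨K, hK⟩ := exists_nat_gt ‖x‖
      refine tendsto_const_nhds.congr' ?_
      filter_upwards [eventually_ge_atTop K] with k hk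
      have : x ∈ Metric.ball (0 : V) k := by
        rw [mem_ball_zero_iff]
        exact hK.trans_le (by exact_mod_cast hk)
      simp [this]
  rw [lintegral_zero] at h2
  have h3 := (ENNReal.continuous_rpow_const (y := (1 / 2 : ℝ))).tendsto 0 |>.comp h2
  simpa [Function.comp_def] using h3

end FourierL2

/-! ### Radial functions in `L²` -/

section Radial

variable {n : ℕ}

/-- The sets of the form `{x | ‖x‖ ∈ s}`. -/
@[reducible]
def radialSpace (d : ℕ) : MeasurableSpace (Space d) :=
  MeasurableSpace.comap (fun x : Space d => ‖x‖) inferInstance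

theorem radialSpace_le (d : ℕ) : radialSpace d ≤ inferInstanceAs (MeasurableSpace (Space d)) :=
  measurable_norm.comap_le

/-- Square integrable functions which are measurable functions of the norm. -/
def radialL2 (d : ℕ) : Submodule ℂ (L2 d) := lpMeas ℂ ℂ (radialSpace d) 2 volume

/-- Closedness is what lets radial symmetry pass from truncations to their limits. -/
theorem isClosed_radialL2 (d : ℕ) : IsClosed (radialL2 d : Set (L2 d)) := by
  have : Fact (radialSpace d ≤ inferInstanceAs (MeasurableSpace (Space d))) := ⟨radialSpace_le d⟩
  have : CompleteSpace (lpMeas ℂ ℂ (radialSpace d) 2 (volume : Measure (Space d))) :=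
    inferInstance
  exact IsComplete.isClosed (completeSpace_coe_iff_isComplete.1 this)

theorem exists_measurable_of_mem_radialL2 {d : ℕ} {f : L2 d} (hf : f ∈ radialL2 d) :
    ∃ F : ℝ → ℂ, Measurable F ∧ ∀ᵐ x, f x = F ‖x‖ := by
  obtain ⟨g, hg, hfg⟩ := mem_lpMeas_iff_aestronglyMeasurable.1 hf
  obtain ⟨F, hF, hgF⟩ := StronglyMeasurable.exists_eq_measurable_comp hg
  exact ⟨F, hF.measurable, hfg.trans (by rw [hgF]; rfl)⟩

theorem mem_radialL2_of_ae {d : ℕ} {f : L2 d} {F : ℝ → ℂ} (hF : Measurable F)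
    (h : ∀ᵐ x, f x = F ‖x‖) : f ∈ radialL2 d := by
  refine mem_lpMeas_iff_aestronglyMeasurable.2 ⟨F ∘ (fun x => ‖x‖), ?_, h⟩
  exact Measurable.stronglyMeasurable (hF.comp (comap_measurable _))

/-- The profile in `IsRadial` need not be measurable. By Fubini in polar coordinates, almost every
direction `ω` has the property that a measurable representative agrees with the profile at almost
every point of its ray. Restricting the representative to one such ray gives a measurable profile.
-/
theorem isRadial_iff {f : L2 (n + 1)} : IsRadial f ↔ f ∈ radialL2 (n + 1) := by
  constructor
  swap
  · intro h
    obtain ⟨F, -, hF⟩ := exists_measurable_of_mem_radialL2 h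
    exact ⟨F, hF⟩
  rintro ⟨f₀, hf₀⟩
  have hdim : Module.finrank ℝ (Space (n + 1)) = n + 1 := by simp
  obtain ⟨g, hg, hfg⟩ := Lp.aestronglyMeasurable f
  have hgf : ∀ᵐ x : Space (n + 1), g x = f₀ ‖x‖ := by
    filter_upwards [hfg, hf₀] with x h1 h2
    rw [← h1, h2]
  have mp := (volume : Measure (Space (n + 1))).measurePreserving_homeomorphUnitSphereProd
  have hsub : ∀ᵐ x : ({0}ᶜ : Set (Space (n + 1))) ∂(Measure.comap Subtype.val volume),
      g x = f₀ ‖(x : Space (n + 1))‖ := by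
    rw [ae_iff] at hgf ⊢
    rw [(MeasurableEmbedding.subtype_coe (measurableSet_singleton _).compl).comap_apply]
    refine measure_mono_null ?_ hgf
    rintro _ ⟨x, hx, rfl⟩
    exact hx
  have hpol : ∀ᵐ p : (Metric.sphere (0 : Space (n + 1)) 1) × Ioi (0 : ℝ)
      ∂((volume : Measure (Space (n + 1))).toSphere.prod
        (Measure.volumeIoiPow (Module.finrank ℝ (Space (n + 1)) - 1))),
      g ((p.2 : ℝ) • (p.1 : Space (n + 1))) = f₀ p.2 := by
    have mp' := mp.symm (homeomorphUnitSphereProd (Space (n + 1))).toMeasurableEquiv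
    have := mp'.quasiMeasurePreserving.ae hsub
    filter_upwards [this] with p hp
    have e : (((homeomorphUnitSphereProd (Space (n + 1))).toMeasurableEquiv.symm p :
        ({0}ᶜ : Set (Space (n + 1)))) : Space (n + 1)) = (p.2 : ℝ) • (p.1 : Space (n + 1)) := rfl
    rw [e] at hp
    rw [hp, norm_smul, Real.norm_of_nonneg (le_of_lt p.2.2), norm_eq_of_mem_sphere, mul_one]
  have hne : (volume : Measure (Space (n + 1))).toSphere ≠ 0 := by
    intro h
    have := (volume : Measure (Space (n + 1))).toSphere_apply_univ
    rw [h, hdim] at this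
    simp only [Measure.coe_zero, Pi.zero_apply] at this
    exact mul_ne_zero (by simp) (Metric.measure_ball_pos _ _ one_pos).ne' this.symm
  have : (ae (volume : Measure (Space (n + 1))).toSphere).NeBot := ae_neBot.2 hne
  obtain ⟨ω, hω⟩ := (Measure.ae_ae_of_ae_prod hpol).exists
  set F : ℝ → ℂ := fun r => g (r • (ω : Space (n + 1))) with hFdef
  have hF : Measurable F := hg.measurable.comp (by fun_prop)
  refine mem_radialL2_of_ae hF ?_
  have h1 := Measure.quasiMeasurePreserving_snd
    (μ := (volume : Measure (Space (n + 1))).toSphere)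
    (ν := Measure.volumeIoiPow (Module.finrank ℝ (Space (n + 1)) - 1)) |>.ae hω
  have h2 := mp.quasiMeasurePreserving.ae (hpol.and h1)
  have h3 : ∀ᵐ x : ({0}ᶜ : Set (Space (n + 1))) ∂(Measure.comap Subtype.val volume),
      g x = F ‖(x : Space (n + 1))‖ := by
    filter_upwards [h2, hsub] with x hx hx'
    rw [hx']
    have := hx.2
    simp only [homeomorphUnitSphereProd_apply_snd_coe] at this
    exact this.symm
  have h4 : ∀ᵐ x ∂(volume : Measure (Space (n + 1))), x ∈ ({0}ᶜ : Set (Space (n + 1))) →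
      g x = F ‖x‖ := by
    rw [ae_iff] at h3 ⊢
    rw [(MeasurableEmbedding.subtype_coe (measurableSet_singleton _).compl).comap_apply] at h3
    refine measure_mono_null ?_ h3
    intro x hx
    simp only [mem_ofPred_eq, Classical.not_imp] at hx
    exact ⟨⟨x, hx.1⟩, hx.2, rfl⟩
  filter_upwards [h4, hfg, Measure.ae_ne volume (0 : Space (n + 1))] with x h5 h6 h7
  rw [h6, h5 h7]

theorem measurable_radial_of_invariant {g : Space (n + 1) → ℂ} (hg : Continuous g)
    (h : ∀ (R : Space (n + 1) ≃ₗᵢ[ℝ] Space (n + 1)) x, g (R x) = g x) :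
    ∃ F : ℝ → ℂ, Measurable F ∧ ∀ x, g x = F ‖x‖ := by
  refine ⟨fun r => g (r • EuclideanSpace.single 0 1), (hg.comp (by fun_prop)).measurable,
    fun x => ?_⟩
  obtain ⟨R, hR⟩ := exists_isometry_axis x
  change g x = g (‖x‖ • EuclideanSpace.single 0 1)
  rw [← hR, h]

theorem comp_isometry_of_mem_radialL2 {d : ℕ} {f : L2 d} (hf : f ∈ radialL2 d)
    (R : Space d ≃ₗᵢ[ℝ] Space d) : (f : Space d → ℂ) ∘ R =ᵐ[volume] f := by
  obtain ⟨F, -, hF⟩ := exists_measurable_of_mem_radialL2 hf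
  have := R.measurePreserving.quasiMeasurePreserving.ae hF
  filter_upwards [this, hF] with x h1 h2
  rw [Function.comp_apply, h1, h2, R.norm_map]

theorem truncBall_mem_radialL2 {d : ℕ} {f : L2 d} (hf : f ∈ radialL2 d) (k : ℕ) :
    truncBall k f ∈ radialL2 d := by
  obtain ⟨F, hFm, hF⟩ := exists_measurable_of_mem_radialL2 hf
  refine mem_radialL2_of_ae (F := (Iio (k : ℝ)).indicator F) (hFm.indicator measurableSet_Iio) ?_
  filter_upwards [coeFn_truncBall k f, hF] with x h1 h2
  rw [h1]
  by_cases h : ‖x‖ < k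
  · simp [h, h2]
  · simp [h]

/-- A truncation is integrable, so its transform is a continuous, rotation-invariant integral. The
general case follows by density, as `radialL2` is closed. -/
theorem fourier_mem_radialL2 {f : L2 (n + 1)} (hf : f ∈ radialL2 (n + 1)) :
    (𝓕 f : L2 (n + 1)) ∈ radialL2 (n + 1) := by
  have hlim : Tendsto (fun k => (𝓕 (truncBall k f) : L2 (n + 1))) atTop (𝓝 (𝓕 f)) :=
    ((Lp.fourierTransformₗᵢ (Space (n + 1)) ℂ).continuous.tendsto f).comp (tendsto_truncBall f)
  refine (isClosed_radialL2 _).mem_of_tendsto hlim (Eventually.of_forall fun k => ?_)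
  have hi := integrable_truncBall k f
  obtain ⟨F, hF, hF'⟩ := measurable_radial_of_invariant
    (g := 𝓕 (truncBall k f : Space (n + 1) → ℂ))
    (VectorFourier.fourierIntegral_continuous Real.continuous_fourierChar
      (by exact continuous_inner) hi) (fun R x => by
      rw [← Real.fourier_comp_linearIsometry]
      exact Real.fourier_congr_ae
        (comp_isometry_of_mem_radialL2 (truncBall_mem_radialL2 hf k) R) x)
  refine mem_radialL2_of_ae hF ?_
  filter_upwards [coeFn_fourier_of_integrable _ hi] with x hx
  rw [hx, hF']

theorem fourierInv_mem_radialL2 {f : L2 (n + 1)} (hf : f ∈ radialL2 (n + 1)) :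
    (𝓕⁻ f : L2 (n + 1)) ∈ radialL2 (n + 1) := by
  have hlim : Tendsto (fun k => (𝓕⁻ (truncBall k f) : L2 (n + 1))) atTop (𝓝 (𝓕⁻ f)) :=
    ((Lp.fourierTransformₗᵢ (Space (n + 1)) ℂ).symm.continuous.tendsto f).comp
      (tendsto_truncBall f)
  refine (isClosed_radialL2 _).mem_of_tendsto hlim (Eventually.of_forall fun k => ?_)
  have hi := integrable_truncBall k f
  obtain ⟨F, hF, hF'⟩ := measurable_radial_of_invariant
    (g := 𝓕⁻ (truncBall k f : Space (n + 1) → ℂ))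
    (VectorFourier.fourierIntegral_continuous Real.continuous_fourierChar
      (by exact continuous_inner.neg) hi) (fun R x => by
      rw [← Real.fourierInv_comp_linearIsometry]
      exact Real.fourierInv_congr_ae
        (comp_isometry_of_mem_radialL2 (truncBall_mem_radialL2 hf k) R) x)
  refine mem_radialL2_of_ae hF ?_
  filter_upwards [coeFn_fourierInv_of_integrable _ hi] with x hx
  rw [hx, hF']

end Radial

/-! ### The propagator -/

section Propagator

variable {d : ℕ} {s t : ℝ}

/-- In the frequency `ξ / 2π` the mass is `s / 2π`, and a factor `2π` comes out of every energy. -/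
theorem phi_two_pi (s r : ℝ) : phi s (2 * Real.pi * r) = 2 * Real.pi * phi (s / (2 * Real.pi)) r := by
  have hp := Real.pi_pos
  have h : s ^ 2 + (2 * Real.pi * r) ^ 2 =
      (2 * Real.pi) ^ 2 * ((s / (2 * Real.pi)) ^ 2 + r ^ 2) := by
    field_simp
  unfold phi
  rw [h, Real.sqrt_mul (by positivity), Real.sqrt_sq (by positivity)]

theorem norm_propagator (s t : ℝ) (f : L2 d) : ‖propagator s t f‖ = ‖f‖ := by
  unfold propagator
  have h1 : ∀ h : L2 d, ‖(𝓕⁻ h : L2 d)‖ = ‖h‖ := fun h =>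
    (Lp.fourierTransformₗᵢ (Space d) ℂ).symm.norm_map h
  rw [h1, ← Lp.norm_fourier_eq f, Lp.norm_toLp, Lp.norm_def]
  congr 1
  refine eLpNorm_congr_norm_ae (Eventually.of_forall fun ζ => ?_)
  rw [norm_mul, norm_propSymbol, one_mul]

theorem propagator_sub (s t : ℝ) (f g : L2 d) :
    propagator s t (f - g) = propagator s t f - propagator s t g := by
  unfold propagator
  have h1 : ∀ h h' : L2 d, (𝓕⁻ (h - h') : L2 d) = 𝓕⁻ h - 𝓕⁻ h' := fun h h' =>
    (Lp.fourierTransformₗᵢ (Space d) ℂ).symm.map_sub h h'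
  have h2 : (𝓕 (f - g) : L2 d) = 𝓕 f - 𝓕 g := (Lp.fourierTransformₗᵢ (Space d) ℂ).map_sub f g
  rw [← h1, ← MemLp.toLp_sub]
  congr 1
  refine MemLp.toLp_congr _ _ ?_
  rw [h2]
  filter_upwards [Lp.coeFn_sub (𝓕 f : L2 d) (𝓕 g)] with ζ hζ
  rw [hζ]
  simp [mul_sub]

theorem tendsto_propagator (s t : ℝ) {f : L2 d} {F : ℕ → L2 d} (h : Tendsto F atTop (𝓝 f)) :
    Tendsto (fun k => propagator s t (F k)) atTop (𝓝 (propagator s t f)) := by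
  rw [tendsto_iff_norm_sub_tendsto_zero] at h ⊢
  simpa [← propagator_sub, norm_propagator] using h

theorem coeFn_propagator_of_integrable (s t : ℝ) (f : L2 d)
    (hf : Integrable ((𝓕 f : L2 d) : Space d → ℂ)) :
    (propagator s t f : Space d → ℂ) =ᵐ[volume] fun x => ∫ η : Space d,
      Complex.exp (((2 * Real.pi * (inner ℝ η x + t * en (s / (2 * Real.pi)) η) : ℝ) : ℂ) *
        Complex.I) * (𝓕 f : L2 d) η := by
  have h1 : Integrable (fun ζ => propSymbol d s t ζ * (𝓕 f : L2 d) ζ) := by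
    refine hf.bdd_mul (c := 1) (continuous_propSymbol d s t).aestronglyMeasurable ?_
    exact Eventually.of_forall fun ζ => (norm_propSymbol d s t ζ).le
  have h2 := MemLp.coeFn_toLp (memLp_propSymbol_mul s t (𝓕 f))
  refine (coeFn_fourierInv_of_integrable _ (h1.congr h2.symm)).trans ?_
  refine Eventually.of_forall fun x => ?_
  rw [Real.fourierInv_congr_ae h2, Real.fourierInv_eq']
  refine integral_congr_ae (Eventually.of_forall fun η => ?_)
  simp only [smul_eq_mul]
  rw [← mul_assoc]
  congr 1
  unfold propSymbol en
  rw [phi_two_pi, ← Complex.exp_add, ← add_mul]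
  congr 2
  push_cast
  ring

end Propagator

/-! ### Pairing products of `L²` functions with bounded weights -/

section WeightedPairing

variable {d : ℕ} {w : Space d → ℂ} {M : ℝ}

theorem memLp_top_of_norm_le (hw : AEStronglyMeasurable w volume) (hM : ∀ x, ‖w x‖ ≤ M) :
    MemLp w ∞ volume := memLp_top_of_bound hw M (Eventually.of_forall hM)

theorem integrable_mul_conj (u v : L2 d) : Integrable fun x => u x * conj (v x) :=
  L2.integrable_inner v u

/-- As an inner product with a multiplication operator, the integral is bounded by the sup norm of
the weight and jointly continuous in `u` and `v`. -/
theorem integral_mul_conj_mul (hw : MemLp w ∞ (volume : Measure (Space d))) (u v : L2 d) :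
    ∫ x, u x * conj (v x) * w x =
      inner ℂ v ((ContinuousLinearMap.mul ℂ ℂ).holderL volume ∞ 2 2 (hw.toLp w) u) := by
  rw [L2.inner_def]
  refine integral_congr_ae ?_
  filter_upwards [(ContinuousLinearMap.mul ℂ ℂ).coeFn_holder (r := 2) (hw.toLp w) u,
    hw.coeFn_toLp] with x h1 h2
  rw [ContinuousLinearMap.holderL_apply_apply, h1, h2]
  simp only [ContinuousLinearMap.mul_apply', RCLike.inner_apply]
  ring

theorem norm_integral_mul_conj_mul_le (hw : AEStronglyMeasurable w volume) (hM : ∀ x, ‖w x‖ ≤ M)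
    (hM0 : 0 ≤ M) (u v : L2 d) : ‖∫ x, u x * conj (v x) * w x‖ ≤ M * (‖u‖ * ‖v‖) := by
  have hw' := memLp_top_of_norm_le hw hM
  rw [integral_mul_conj_mul hw']
  refine (norm_inner_le_norm _ _).trans ?_
  have h1 := (ContinuousLinearMap.mul ℂ ℂ).norm_holder_apply_apply_le (r := 2) (hw'.toLp w) u
  have h2 : ‖hw'.toLp w‖ ≤ M := by
    rw [Lp.norm_toLp]
    refine ENNReal.toReal_le_of_le_ofReal hM0 ?_
    rw [eLpNorm_exponent_top]
    exact eLpNormEssSup_le_of_ae_bound (Eventually.of_forall hM)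
  rw [ContinuousLinearMap.opNorm_mul, one_mul] at h1
  have h3 : ‖(ContinuousLinearMap.mul ℂ ℂ).holderL volume ∞ 2 2 (hw'.toLp w) u‖ ≤ M * ‖u‖ :=
    h1.trans (by gcongr)
  calc _ ≤ ‖v‖ * (M * ‖u‖) := by gcongr
    _ = _ := by ring

theorem tendsto_integral_mul_conj_mul (hw : AEStronglyMeasurable w volume) (hM : ∀ x, ‖w x‖ ≤ M)
    {u v : L2 d} {U W : ℕ → L2 d} (hu : Tendsto U atTop (𝓝 u)) (hv : Tendsto W atTop (𝓝 v)) :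
    Tendsto (fun k => ∫ x, U k x * conj (W k x) * w x) atTop
      (𝓝 (∫ x, u x * conj (v x) * w x)) := by
  have hw' := memLp_top_of_norm_le hw hM
  simp_rw [integral_mul_conj_mul hw']
  exact hv.inner (((ContinuousLinearMap.mul ℂ ℂ).holderL volume ∞ 2 2
    (hw'.toLp w)).continuous.tendsto u |>.comp hu)

end WeightedPairing

/-! ### Schwartz functions on space-time -/

section Spacetime

variable {d : ℕ}

theorem exists_decay {V : Type*} [NormedAddCommGroup V] [NormedSpace ℝ V] (χ : 𝓢(V, ℂ)) (k : ℕ) :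
    ∃ C : ℝ, 0 ≤ C ∧ ∀ x, ‖χ x‖ ≤ C * (1 + ‖x‖) ^ (-(k : ℝ)) := by
  have h := fun x => SchwartzMap.one_add_le_sup_seminorm_apply (𝕜 := ℝ) (m := (k, 0))
    (le_refl k) (le_refl 0) χ x
  simp only [norm_iteratedFDeriv_zero] at h
  have hpos : ∀ x : V, (0 : ℝ) < (1 + ‖x‖) ^ k := fun x => by positivity
  refine ⟨_, le_trans (by positivity) (h 0), fun x => ?_⟩
  rw [Real.rpow_neg (by positivity), Real.rpow_natCast, ← div_eq_mul_inv, le_div_iff₀ (hpos x),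
    mul_comm]
  exact h x

theorem norm_fst_le (t : ℝ) (x : Space d) : ‖t‖ ≤ ‖(WithLp.toLp 2 (t, x) : Spacetime d)‖ :=
  WithLp.norm_fst_le _ (WithLp.toLp 2 (t, x) : Spacetime d)

theorem norm_snd_le (t : ℝ) (x : Space d) : ‖x‖ ≤ ‖(WithLp.toLp 2 (t, x) : Spacetime d)‖ :=
  WithLp.norm_snd_le _ (WithLp.toLp 2 (t, x) : Spacetime d)

theorem measurePreserving_toLp (d : ℕ) :
    MeasurePreserving (fun p : ℝ × Space d => (WithLp.toLp 2 p : Spacetime d)) :=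
  WithLp.volume_preserving_toLp _ _

theorem measurableEmbedding_toLp (d : ℕ) :
    MeasurableEmbedding (fun p : ℝ × Space d => (WithLp.toLp 2 p : Spacetime d)) :=
  (MeasurableEquiv.toLp 2 (ℝ × Space d)).measurableEmbedding

theorem integral_exp_mul_fourier (ψ : 𝓢(Spacetime d, ℂ)) (τ : ℝ) (ξ : Space d) :
    ∫ z : ℝ × Space d, Complex.exp (((2 * Real.pi * (inner ℝ ξ z.2 + z.1 * τ) : ℝ) : ℂ) *
      Complex.I) * (𝓕 ψ : 𝓢(Spacetime d, ℂ)) (WithLp.toLp 2 z) = ψ (WithLp.toLp 2 (τ, ξ)) := by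
  have h : 𝓕⁻ (𝓕 ψ : 𝓢(Spacetime d, ℂ)) = ψ := FourierTransform.fourierInv_fourier_eq ψ
  conv_rhs => rw [← h, SchwartzMap.fourierInv_coe, Real.fourierInv_eq']
  rw [← (measurePreserving_toLp d).integral_comp (measurableEmbedding_toLp d)]
  refine integral_congr_ae (Eventually.of_forall fun z => ?_)
  simp only [smul_eq_mul, WithLp.prod_inner_apply]
  congr 4
  rw [real_inner_comm ξ z.2]
  simp [mul_comm]
  try ring

end Spacetime

/-! ### The Fourier transform of the product, tested against Schwartz functions -/

section Pairing

variable {d : ℕ} {m : ℝ}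

/-- A test function evaluated at the difference of two points of the mass shell. -/
def shellTest (m : ℝ) (ψ : 𝓢(Spacetime d, ℂ)) (p : Space d × Space d) : ℂ :=
  ψ (WithLp.toLp 2 (en m p.1 - en m p.2, p.1 - p.2))

theorem continuous_shellTest (m : ℝ) (ψ : 𝓢(Spacetime d, ℂ)) : Continuous (shellTest m ψ) := by
  have h := continuous_en (d := d) m
  refine ψ.continuous.comp ?_
  exact (WithLp.prod_continuous_toLp 2 ℝ (Space d)).comp (by fun_prop)

/-- The test function is dominated by an integrable function `h` of `p₁ - p₂`. With `|u||v| ≤ |u|² +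
|v|²`, each term is the integrand of a convolution of two integrable functions. -/
theorem integrable_mul_conj_mul_shellTest (u v : L2 d) (ψ : 𝓢(Spacetime d, ℂ)) :
    Integrable fun p : Space d × Space d => u p.1 * conj (v p.2) * shellTest m ψ p := by
  obtain ⟨C, hC0, hC⟩ := exists_decay ψ (d + 1)
  set h : Space d → ℝ := fun x => C * (1 + ‖x‖) ^ (-((d + 1 : ℕ) : ℝ)) with hdef
  have hh : Integrable h := by
    refine (integrable_one_add_norm ?_).const_mul C
    simp
  have hb : ∀ p : Space d × Space d, ‖shellTest m ψ p‖ ≤ h (p.1 - p.2) := by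
    intro p
    refine (hC _).trans ?_
    simp only [hdef]
    refine mul_le_mul_of_nonneg_left ?_ hC0
    refine Real.rpow_le_rpow_of_nonpos (by positivity) ?_ (neg_nonpos.2 (Nat.cast_nonneg _))
    linarith [norm_snd_le (en m p.1 - en m p.2) (p.1 - p.2)]
  have hsq : ∀ u : L2 d, Integrable fun x => ‖u x‖ ^ 2 := fun u =>
    (memLp_two_iff_integrable_sq_norm (Lp.aestronglyMeasurable u)).1 (Lp.memLp u)
  have i1 : Integrable (fun p : Space d × Space d => ‖v p.2‖ ^ 2 * h (p.1 - p.2)) :=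
    Integrable.convolution_integrand (ContinuousLinearMap.mul ℝ ℝ) (hsq v) hh
  have i2 : Integrable (fun p : Space d × Space d => ‖u p.1‖ ^ 2 * h (p.1 - p.2)) := by
    have := (Integrable.convolution_integrand (ContinuousLinearMap.mul ℝ ℝ) (hsq u) hh).swap
    refine this.congr (Eventually.of_forall fun p => ?_)
    simp only [ContinuousLinearMap.mul_apply', Function.comp_apply, Prod.fst_swap, Prod.snd_swap,
      hdef]
    rw [norm_sub_rev]
  have hmu : AEStronglyMeasurable (fun p : Space d × Space d => u p.1) volume :=
    (Lp.aestronglyMeasurable u).comp_fst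
  have hmv : AEStronglyMeasurable (fun p : Space d × Space d => v p.2) volume :=
    (Lp.aestronglyMeasurable v).comp_snd
  refine (i2.add i1).mono' ?_ (Eventually.of_forall fun p => ?_)
  · exact (hmu.mul (Complex.continuous_conj.comp_aestronglyMeasurable hmv)).mul
      (continuous_shellTest m ψ).aestronglyMeasurable
  · have h0 : 0 ≤ h (p.1 - p.2) := (norm_nonneg _).trans (hb p)
    simp only [norm_mul, RCLike.norm_conj, Pi.add_apply]
    calc ‖u p.1‖ * ‖v p.2‖ * ‖shellTest m ψ p‖ ≤ ‖u p.1‖ * ‖v p.2‖ * h (p.1 - p.2) := by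
          gcongr; exact hb p
      _ ≤ (‖u p.1‖ ^ 2 + ‖v p.2‖ ^ 2) * h (p.1 - p.2) := by
          gcongr
          nlinarith [sq_nonneg (‖u p.1‖ - ‖v p.2‖), sq_nonneg (‖u p.1‖ + ‖v p.2‖)]
      _ = _ := by ring

/-- The phase of a product of two plane waves. -/
def wavePhase (m : ℝ) (z : ℝ × Space d) (p : Space d × Space d) : ℂ :=
  Complex.exp (((2 * Real.pi * (inner ℝ (p.1 - p.2) z.2 + z.1 * (en m p.1 - en m p.2)) : ℝ) : ℂ) *
    Complex.I)

theorem norm_wavePhase (m : ℝ) (z : ℝ × Space d) (p : Space d × Space d) :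
    ‖wavePhase m z p‖ = 1 := Complex.norm_exp_ofReal_mul_I _

theorem continuous_wavePhase (m : ℝ) :
    Continuous fun q : (ℝ × Space d) × (Space d × Space d) => wavePhase m q.1 q.2 := by
  have h := continuous_en (d := d) m
  unfold wavePhase
  fun_prop

variable {s : ℝ} {f g : L2 d}

theorem product_ae_eq (s t : ℝ)
    (hf : Integrable ((𝓕 f : L2 d) : Space d → ℂ)) (hg : Integrable ((𝓕 g : L2 d) : Space d → ℂ)) :
    (product s f g t) =ᵐ[volume] fun x => ∫ p : Space d × Space d,
      wavePhase (s / (2 * Real.pi)) (t, x) p * ((𝓕 f : L2 d) p.1 * conj ((𝓕 g : L2 d) p.2)) := by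
  filter_upwards [coeFn_propagator_of_integrable s t f hf,
    coeFn_propagator_of_integrable s t g hg] with x h1 h2
  unfold product
  rw [h1, h2, ← integral_conj, ← integral_prod_mul]
  refine integral_congr_ae (Eventually.of_forall fun p => ?_)
  simp only [map_mul]
  rw [mul_mul_mul_comm, ← Complex.exp_conj, ← Complex.exp_add]
  unfold wavePhase
  congr 2
  simp only [map_mul, Complex.conj_ofReal, Complex.conj_I, inner_sub_left]
  push_cast
  ring

/-- For integrable `𝓕 f` and `𝓕 g` the product is an absolutely convergent superposition of plane
waves. Fubini and Fourier inversion of the test function apply to each wave. -/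
theorem pairing_of_integrable (ψ : 𝓢(Spacetime d, ℂ))
    (hf : Integrable ((𝓕 f : L2 d) : Space d → ℂ)) (hg : Integrable ((𝓕 g : L2 d) : Space d → ℂ)) :
    Integrable (fun t => ∫ x, product s f g t x *
      (𝓕 ψ : 𝓢(Spacetime d, ℂ)) (WithLp.toLp 2 (t, x))) ∧
    ∫ t, ∫ x, product s f g t x * (𝓕 ψ : 𝓢(Spacetime d, ℂ)) (WithLp.toLp 2 (t, x)) =
      ∫ p : Space d × Space d, (𝓕 f : L2 d) p.1 * conj ((𝓕 g : L2 d) p.2) *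
        shellTest (s / (2 * Real.pi)) ψ p := by
  set m := s / (2 * Real.pi) with hm
  set χ : ℝ × Space d → ℂ := fun z => (𝓕 ψ : 𝓢(Spacetime d, ℂ)) (WithLp.toLp 2 z) with hχ
  have hχi : Integrable χ :=
    (measurePreserving_toLp d).integrable_comp_emb (measurableEmbedding_toLp d) |>.2
      (SchwartzMap.integrable _)
  set Φ : (ℝ × Space d) × (Space d × Space d) → ℂ := fun q =>
    wavePhase m q.1 q.2 * (χ q.1 * ((𝓕 f : L2 d) q.2.1 * conj ((𝓕 g : L2 d) q.2.2))) with hΦ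
  have hgc : Integrable (fun η => conj ((𝓕 g : L2 d) η)) := by
    exact hg.congr' (Complex.continuous_conj.comp_aestronglyMeasurable hg.1)
      (Eventually.of_forall fun _ => (RCLike.norm_conj _).symm)
  have hΦi : Integrable Φ (volume.prod volume) := by
    refine (hχi.mul_prod (hf.mul_prod hgc)).bdd_mul (c := 1)
      (continuous_wavePhase m).aestronglyMeasurable ?_
    exact Eventually.of_forall fun q => (norm_wavePhase _ _ _).le
  have h1 : ∀ t, ∫ x, product s f g t x * χ (t, x) = ∫ x, ∫ p, Φ ((t, x), p) := by
    intro t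
    refine integral_congr_ae ?_
    filter_upwards [product_ae_eq s t hf hg] with x hx
    rw [hx, ← integral_mul_const]
    refine integral_congr_ae (Eventually.of_forall fun p => ?_)
    simp only [hΦ]
    ring
  have h2 : Integrable (fun z : ℝ × Space d => ∫ p, Φ (z, p)) (volume.prod volume) :=
    hΦi.integral_prod_left
  refine ⟨?_, ?_⟩
  · exact (h2.integral_prod_left).congr (Eventually.of_forall fun t => (h1 t).symm)
  · have h3 : ∫ t, ∫ x, product s f g t x * χ (t, x) = ∫ t, ∫ x, ∫ p, Φ ((t, x), p) :=
      integral_congr_ae (Eventually.of_forall h1)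
    refine h3.trans ?_
    rw [← integral_prod (fun z : ℝ × Space d => ∫ p, Φ (z, p)) h2]
    refine (integral_integral_swap hΦi).trans ?_
    refine integral_congr_ae (Eventually.of_forall fun p => ?_)
    have h4 := integral_exp_mul_fourier ψ (en m p.1 - en m p.2) (p.1 - p.2)
    simp only [shellTest]
    rw [← h4, ← integral_const_mul]
    refine integral_congr_ae (Eventually.of_forall fun z => ?_)
    simp only [hΦ, wavePhase, hχ]
    ring

theorem fourier_fourierInv_L2 (h : L2 d) : (𝓕 (𝓕⁻ h : L2 d) : L2 d) = h :=
  FourierTransform.fourier_fourierInv_eq h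

theorem norm_truncBall_le (k : ℕ) (h : L2 d) : ‖truncBall k h‖ ≤ ‖h‖ := by
  unfold truncBall
  rw [Lp.norm_toLp, Lp.norm_def]
  exact ENNReal.toReal_mono (Lp.eLpNorm_ne_top _) (eLpNorm_indicator_le _)

/-- Frequencies are truncated to balls and the limit is taken on both sides by dominated
convergence: in time by Schwartz decay and unitarity of the propagator, in frequency by
`integrable_mul_conj_mul_shellTest`. -/
theorem pairing (s : ℝ) (f g : L2 d) (ψ : 𝓢(Spacetime d, ℂ)) :
    Integrable (fun t => ∫ x, product s f g t x *
      (𝓕 ψ : 𝓢(Spacetime d, ℂ)) (WithLp.toLp 2 (t, x))) ∧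
    ∫ t, ∫ x, product s f g t x * (𝓕 ψ : 𝓢(Spacetime d, ℂ)) (WithLp.toLp 2 (t, x)) =
      ∫ p : Space d × Space d, (𝓕 f : L2 d) p.1 * conj ((𝓕 g : L2 d) p.2) *
        shellTest (s / (2 * Real.pi)) ψ p := by
  set m := s / (2 * Real.pi) with hm
  set T : ℕ → L2 d → L2 d := fun k h => 𝓕⁻ (truncBall k (𝓕 h)) with hT
  have hFT : ∀ k h, (𝓕 (T k h) : L2 d) = truncBall k (𝓕 h) := fun k h => fourier_fourierInv_L2 _
  have hTlim : ∀ h, Tendsto (fun k => T k h) atTop (𝓝 h) := by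
    intro h
    have := ((Lp.fourierTransformₗᵢ (Space d) ℂ).symm.continuous.tendsto (𝓕 h)).comp
      (tendsto_truncBall (𝓕 h))
    have e : (Lp.fourierTransformₗᵢ (Space d) ℂ).symm (𝓕 h) = h :=
      (Lp.fourierTransformₗᵢ (Space d) ℂ).symm_apply_apply h
    rw [e] at this
    exact this
  have hTn : ∀ k h, ‖T k h‖ ≤ ‖h‖ := by
    intro k h
    rw [← Lp.norm_fourier_eq, hFT, ← Lp.norm_fourier_eq h]
    exact norm_truncBall_le _ _
  obtain ⟨C, hC0, hC⟩ := exists_decay (𝓕 ψ : 𝓢(Spacetime d, ℂ)) 2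
  have hcont : Continuous fun z : ℝ × Space d =>
      (𝓕 ψ : 𝓢(Spacetime d, ℂ)) (WithLp.toLp 2 z) :=
    (SchwartzMap.continuous _).comp (WithLp.prod_continuous_toLp 2 ℝ (Space d))
  have hw : ∀ t x, ‖(𝓕 ψ : 𝓢(Spacetime d, ℂ)) (WithLp.toLp 2 (t, x))‖ ≤
      C * (1 + ‖t‖) ^ (-((2 : ℕ) : ℝ)) := by
    intro t x
    refine (hC _).trans (mul_le_mul_of_nonneg_left ?_ hC0)
    exact Real.rpow_le_rpow_of_nonpos (by positivity) (by linarith [norm_fst_le t x]) (by simp)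
  have hwm : ∀ t, AEStronglyMeasurable
      (fun x : Space d => (𝓕 ψ : 𝓢(Spacetime d, ℂ)) (WithLp.toLp 2 (t, x))) volume := fun t =>
    (hcont.comp (by fun_prop : Continuous fun x : Space d => (t, x))).aestronglyMeasurable
  have hcase : ∀ k, _ := fun k => pairing_of_integrable (s := s) (f := T k f) (g := T k g) ψ
    (by rw [hFT]; exact integrable_truncBall _ _) (by rw [hFT]; exact integrable_truncBall _ _)
  have hpt : ∀ t, Tendsto (fun k => ∫ x, product s (T k f) (T k g) t x *
      (𝓕 ψ : 𝓢(Spacetime d, ℂ)) (WithLp.toLp 2 (t, x))) atTop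
      (𝓝 (∫ x, product s f g t x * (𝓕 ψ : 𝓢(Spacetime d, ℂ)) (WithLp.toLp 2 (t, x)))) :=
    fun t => tendsto_integral_mul_conj_mul (hwm t) (hw t)
      (tendsto_propagator s t (hTlim f)) (tendsto_propagator s t (hTlim g))
  have hbd : ∀ (u v : L2 d) t, ‖∫ x, product s u v t x *
      (𝓕 ψ : 𝓢(Spacetime d, ℂ)) (WithLp.toLp 2 (t, x))‖ ≤
      C * (1 + ‖t‖) ^ (-((2 : ℕ) : ℝ)) * (‖u‖ * ‖v‖) := by
    intro u v t
    have := norm_integral_mul_conj_mul_le (hwm t) (hw t) (by positivity) (propagator s t u)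
      (propagator s t v)
    rwa [norm_propagator, norm_propagator] at this
  have hint : Integrable fun t : ℝ => C * (1 + ‖t‖) ^ (-((2 : ℕ) : ℝ)) * (‖f‖ * ‖g‖) := by
    refine ((integrable_one_add_norm ?_).const_mul C).mul_const _
    simp
  have hmeas : AEStronglyMeasurable (fun t => ∫ x, product s f g t x *
      (𝓕 ψ : 𝓢(Spacetime d, ℂ)) (WithLp.toLp 2 (t, x))) volume :=
    aestronglyMeasurable_of_tendsto_ae atTop (fun k => (hcase k).1.1)
      (Eventually.of_forall hpt)
  refine ⟨hint.mono' hmeas (Eventually.of_forall fun t => hbd f g t), ?_⟩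
  have hL := tendsto_integral_of_dominated_convergence _ (fun k => (hcase k).1.1) hint
    (fun k => Eventually.of_forall fun t => (hbd (T k f) (T k g) t).trans (by
      gcongr <;> apply hTn)) (Eventually.of_forall hpt)
  refine tendsto_nhds_unique hL ?_
  simp_rw [(hcase _).2, hFT]
  have hI := integrable_mul_conj_mul_shellTest (m := m) (𝓕 f : L2 d) (𝓕 g) ψ
  have hae : ∀ᵐ p : Space d × Space d, ∀ k : ℕ,
      truncBall k (𝓕 f : L2 d) p.1 = (Metric.ball (0 : Space d) k).indicator (𝓕 f : L2 d) p.1 ∧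
      truncBall k (𝓕 g : L2 d) p.2 = (Metric.ball (0 : Space d) k).indicator (𝓕 g : L2 d) p.2 := by
    rw [ae_all_iff]
    intro k
    exact (Measure.quasiMeasurePreserving_fst.ae (coeFn_truncBall k (𝓕 f : L2 d))).and
      (Measure.quasiMeasurePreserving_snd.ae (coeFn_truncBall k (𝓕 g : L2 d)))
  refine tendsto_integral_of_dominated_convergence (fun p => ‖(𝓕 f : L2 d) p.1 *
    conj ((𝓕 g : L2 d) p.2) * shellTest m ψ p‖) (fun k => ?_) hI.norm (fun k => ?_) ?_
  · exact (integrable_mul_conj_mul_shellTest (m := m) (truncBall k (𝓕 f : L2 d))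
      (truncBall k (𝓕 g)) ψ).1
  · filter_upwards [hae] with p hp
    rw [(hp k).1, (hp k).2]
    simp only [norm_mul, RCLike.norm_conj]
    gcongr
    · exact norm_indicator_le_norm_self _ _
    · exact norm_indicator_le_norm_self _ _
  · filter_upwards [hae] with p hp
    obtain ⟨K, hK⟩ := exists_nat_gt (max ‖p.1‖ ‖p.2‖)
    refine tendsto_const_nhds.congr' ?_
    filter_upwards [eventually_ge_atTop K] with k hk
    have hk' : (K : ℝ) ≤ k := by exact_mod_cast hk
    have h1 : p.1 ∈ Metric.ball (0 : Space d) k := by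
      rw [mem_ball_zero_iff]
      exact (le_max_left _ _).trans_lt (hK.trans_le hk')
    have h2 : p.2 ∈ Metric.ball (0 : Space d) k := by
      rw [mem_ball_zero_iff]
      exact (le_max_right _ _).trans_lt (hK.trans_le hk')
    rw [(hp k).1, (hp k).2, indicator_of_mem h1, indicator_of_mem h2]

end Pairing

/-! ### The Fourier transform of the product as a fiber integral -/

section FiberMeasure

variable {n : ℕ} {m : ℝ}

/-- The density of the measure on the fiber `p₁ - p₂ = (τ, ξ)`, `|ξ| = a`. -/
def fibWt (n : ℕ) (m a τ ρ : ℝ) : ℝ :=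
  if |τ| < a ∧ 0 < ρ then (sph n).toReal * (ρ ^ n * fibDens a τ (m ^ 2 + ρ ^ 2)) else 0

theorem fibWt_nonneg (hm : 0 < m) (a τ ρ : ℝ) : 0 ≤ fibWt n m a τ ρ := by
  unfold fibWt
  split_ifs with h
  · have := fibDens_pos h.1 (by positivity : 0 < m ^ 2 + ρ ^ 2)
    have := h.2
    positivity
  · exact le_rfl

@[fun_prop]
theorem measurable_fibWt {α : Type*} [MeasurableSpace α] {f g h : α → ℝ} (hf : Measurable f)
    (hg : Measurable g) (hh : Measurable h) :
    Measurable fun x => fibWt n m (f x) (g x) (h x) := by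
  unfold fibWt
  refine Measurable.ite ?_ (by fun_prop) measurable_const
  exact (measurableSet_lt (f := fun x => |g x|) (g := f) (by fun_prop) hf).inter
    (measurableSet_lt (f := fun _ => (0 : ℝ)) (g := h) measurable_const hh)

theorem fibInt_eq_lintegral (hm : 0 < m) {a τ : ℝ} (h : |τ| < a) (F : ℝ → ℝ → ℝ≥0∞) :
    fibInt n m a τ F = ∫⁻ ρ, ENNReal.ofReal (fibWt n m a τ ρ) *
      F (fibE a τ (m ^ 2 + ρ ^ 2)) (fibE a τ (m ^ 2 + ρ ^ 2) - τ) := by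
  unfold fibInt
  rw [← lintegral_const_mul' _ _ (sph_ne_top n), ← lintegral_indicator measurableSet_Ioi]
  refine lintegral_congr fun ρ => ?_
  by_cases hρ : 0 < ρ
  · have h1 := fibDens_pos h (by positivity : 0 < m ^ 2 + ρ ^ 2)
    rw [indicator_of_mem (mem_Ioi.2 hρ), fibWt, if_pos ⟨h, hρ⟩,
      ENNReal.ofReal_mul (by positivity), ENNReal.ofReal_toReal (sph_ne_top n),
      ENNReal.ofReal_mul (by positivity)]
    ring
  · rw [indicator_of_notMem (by simpa using hρ), fibWt, if_neg (fun h => hρ h.2)]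
    simp

/-- The energies and the difference of two points of the mass shell. -/
def shellPair (m : ℝ) (p : Space (n + 2) × Space (n + 2)) : ℝ × ℝ × Space (n + 2) :=
  (en m p.1, en m p.2, p.1 - p.2)

/-- The energies and the difference of two points of the mass shell in terms of the coordinates
on the fibers. -/
def fibPair (m : ℝ) (q : (ℝ × Space (n + 2)) × ℝ) : ℝ × ℝ × Space (n + 2) :=
  (fibE ‖q.1.2‖ q.1.1 (m ^ 2 + q.2 ^ 2), fibE ‖q.1.2‖ q.1.1 (m ^ 2 + q.2 ^ 2) - q.1.1, q.1.2)

theorem measurable_shellPair (m : ℝ) : Measurable (shellPair (n := n) m) := by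
  unfold shellPair
  fun_prop

theorem measurable_fibPair (m : ℝ) : Measurable (fibPair (n := n) m) := by
  unfold fibPair
  fun_prop

/-- As an equality of measures, the disintegration also applies to complex-valued integrands. -/
theorem map_shellPair (hm : 0 < m) :
    (volume : Measure (Space (n + 2) × Space (n + 2))).map (shellPair m) =
      ((volume : Measure ((ℝ × Space (n + 2)) × ℝ)).withDensity
        fun q => ENNReal.ofReal (fibWt n m ‖q.1.2‖ q.1.1 q.2)).map (fibPair m) := by
  ext S hS
  rw [Measure.map_apply (measurable_shellPair m) hS, Measure.map_apply (measurable_fibPair m) hS,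
    withDensity_apply _ (measurable_fibPair m hS), ← lintegral_indicator_one
      (measurable_shellPair m hS), ← lintegral_indicator (measurable_fibPair m hS)]
  have hmeas : Measurable (S.indicator (1 : ℝ × ℝ × Space (n + 2) → ℝ≥0∞)) :=
    measurable_one.indicator hS
  have hK := lintegral_pair_fiber (n := n) hm
    (K := fun x y ξ => S.indicator (1 : ℝ × ℝ × Space (n + 2) → ℝ≥0∞) (x, y, ξ)) hmeas
  have hL : ∫⁻ p : Space (n + 2) × Space (n + 2), (shellPair m ⁻¹' S).indicator 1 p =
      ∫⁻ η : Space (n + 2), ∫⁻ ζ : Space (n + 2),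
        S.indicator (1 : ℝ × ℝ × Space (n + 2) → ℝ≥0∞) (en m η, en m ζ, η - ζ) := by
    refine lintegral_prod _ ?_
    exact (measurable_one.indicator (measurable_shellPair m hS)).aemeasurable
  rw [hL, hK]
  set J : (ℝ × Space (n + 2)) × ℝ → ℝ≥0∞ := fun q =>
    ENNReal.ofReal (fibWt n m ‖q.1.2‖ q.1.1 q.2) *
      S.indicator (1 : ℝ × ℝ × Space (n + 2) → ℝ≥0∞) (fibPair m q) with hJ
  have hJm : Measurable J := by
    refine Measurable.mul (by fun_prop) (hmeas.comp (measurable_fibPair m))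
  have hR : ∀ q, (fibPair m ⁻¹' S).indicator
      (fun q : (ℝ × Space (n + 2)) × ℝ => ENNReal.ofReal (fibWt n m ‖q.1.2‖ q.1.1 q.2)) q =
        J q := by
    intro q
    simp only [hJ]
    by_cases hq : fibPair m q ∈ S
    · rw [indicator_of_mem (by exact hq), indicator_of_mem hq, Pi.one_apply, mul_one]
    · rw [indicator_of_notMem (by exact hq), indicator_of_notMem hq, mul_zero]
  simp_rw [hR]
  refine Eq.symm (Eq.trans (lintegral_prod _ hJm.aemeasurable) ?_)
  refine (lintegral_prod_symm _ hJm.lintegral_prod_right'.aemeasurable).trans ?_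
  refine lintegral_congr fun ξ => ?_
  rw [← lintegral_indicator measurableSet_Ioo]
  refine lintegral_congr fun τ => ?_
  by_cases h : |τ| < ‖ξ‖
  · rw [indicator_of_mem (by simpa [abs_lt] using h), fibInt_eq_lintegral hm h]
    rfl
  · rw [indicator_of_notMem (by simpa [abs_lt] using h), ← lintegral_zero (μ := (volume : Measure ℝ))]
    refine lintegral_congr fun ρ => ?_
    simp only [hJ, fibWt]
    rw [if_neg (fun h' => h h'.1)]
    simp

theorem integrable_shellPair_iff (hm : 0 < m) {K : ℝ × ℝ × Space (n + 2) → ℂ}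
    (hK : Measurable K) :
    Integrable (fun p => K (shellPair m p)) ↔
      Integrable (fun q : (ℝ × Space (n + 2)) × ℝ =>
        (fibWt n m ‖q.1.2‖ q.1.1 q.2 : ℂ) * K (fibPair m q)) := by
  have h1 := integrable_map_measure (μ := (volume : Measure (Space (n + 2) × Space (n + 2))))
    (hK.aestronglyMeasurable (μ := volume.map (shellPair m)))
    (measurable_shellPair m).aemeasurable
  refine h1.symm.trans ?_
  rw [map_shellPair hm, integrable_map_measure hK.aestronglyMeasurable
    (measurable_fibPair m).aemeasurable]
  rw [integrable_withDensity_iff_integrable_smul' (by fun_prop)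
    (Eventually.of_forall fun _ => ENNReal.ofReal_lt_top)]
  refine integrable_congr (Eventually.of_forall fun q => ?_)
  simp only [Function.comp_apply]
  rw [ENNReal.toReal_ofReal (fibWt_nonneg hm _ _ _), Complex.real_smul]

theorem integral_shellPair (hm : 0 < m) {K : ℝ × ℝ × Space (n + 2) → ℂ} (hK : Measurable K) :
    ∫ p, K (shellPair m p) = ∫ q : (ℝ × Space (n + 2)) × ℝ,
      (fibWt n m ‖q.1.2‖ q.1.1 q.2 : ℂ) * K (fibPair m q) := by
  have h1 := integral_map (μ := (volume : Measure (Space (n + 2) × Space (n + 2))))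
    (measurable_shellPair m).aemeasurable
    (hK.aestronglyMeasurable (μ := volume.map (shellPair m)))
  refine h1.symm.trans ?_
  rw [map_shellPair hm, integral_map (measurable_fibPair m).aemeasurable hK.aestronglyMeasurable,
    integral_withDensity_eq_integral_toReal_smul (by fun_prop)
    (Eventually.of_forall fun _ => ENNReal.ofReal_lt_top)]
  refine integral_congr_ae (Eventually.of_forall fun q => ?_)
  simp only
  rw [ENNReal.toReal_ofReal (fibWt_nonneg hm _ _ _), Complex.real_smul]

/-- The space-time Fourier transform of the product, for data which are the functions `F₁` and `F₂`
of the energy. -/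
def fibConv (n : ℕ) (m : ℝ) (F₁ F₂ : ℝ → ℂ) (a τ : ℝ) : ℂ :=
  ∫ ρ, (fibWt n m a τ ρ : ℂ) *
    (F₁ (fibE a τ (m ^ 2 + ρ ^ 2)) * conj (F₂ (fibE a τ (m ^ 2 + ρ ^ 2) - τ)))

theorem fibConv_eq_zero {F₁ F₂ : ℝ → ℂ} {a τ : ℝ} (h : ¬ |τ| < a) :
    fibConv n m F₁ F₂ a τ = 0 := by
  unfold fibConv
  rw [← integral_zero ℝ ℂ]
  refine integral_congr_ae (Eventually.of_forall fun ρ => ?_)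
  simp only [fibWt]
  rw [if_neg (fun h' => h h'.1)]
  simp

theorem enorm_fibConv_le (hm : 0 < m) {F₁ F₂ : ℝ → ℂ} {a τ : ℝ} (h : |τ| < a) :
    ‖fibConv n m F₁ F₂ a τ‖ₑ ≤ fibInt n m a τ fun x y => ‖F₁ x‖ₑ * ‖F₂ y‖ₑ := by
  rw [fibInt_eq_lintegral hm h]
  refine (enorm_integral_le_lintegral_enorm _).trans (le_of_eq ?_)
  refine lintegral_congr fun ρ => ?_
  rw [enorm_mul, enorm_mul, RCLike.enorm_conj]
  congr 1
  rw [← ofReal_norm, Complex.norm_of_nonneg (fibWt_nonneg hm _ _ _)]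

/-- For nonnegative profiles there is no cancellation. Finiteness is needed because a divergent
Bochner integral is `0` by convention. -/
theorem enorm_fibConv_eq (hm : 0 < m) {F : ℝ → ℝ} (hF : Measurable F) (hF0 : ∀ x, 0 ≤ F x)
    {a τ : ℝ} (h : |τ| < a)
    (hfin : fibInt n m a τ (fun x y => ENNReal.ofReal (F x) * ENNReal.ofReal (F y)) ≠ ∞) :
    ‖fibConv n m (fun x => (F x : ℂ)) (fun x => (F x : ℂ)) a τ‖ₑ =
      fibInt n m a τ fun x y => ENNReal.ofReal (F x) * ENNReal.ofReal (F y) := by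
  rw [fibInt_eq_lintegral hm h] at hfin ⊢
  set k : ℝ → ℝ := fun ρ => fibWt n m a τ ρ *
    (F (fibE a τ (m ^ 2 + ρ ^ 2)) * F (fibE a τ (m ^ 2 + ρ ^ 2) - τ)) with hk
  have hk0 : ∀ ρ, 0 ≤ k ρ := fun ρ =>
    mul_nonneg (fibWt_nonneg hm _ _ _) (mul_nonneg (hF0 _) (hF0 _))
  have hkm : Measurable k := by simp only [hk]; fun_prop
  have e1 : ∀ ρ, ENNReal.ofReal (fibWt n m a τ ρ) * (ENNReal.ofReal (F (fibE a τ (m ^ 2 + ρ ^ 2))) *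
      ENNReal.ofReal (F (fibE a τ (m ^ 2 + ρ ^ 2) - τ))) = ENNReal.ofReal (k ρ) := by
    intro ρ
    simp only [hk]
    rw [ENNReal.ofReal_mul (fibWt_nonneg hm _ _ _), ENNReal.ofReal_mul (hF0 _)]
  simp_rw [e1] at hfin ⊢
  have hki : Integrable k := by
    refine (lintegral_ofReal_ne_top_iff_integrable hkm.aestronglyMeasurable
      (Eventually.of_forall hk0)).1 hfin
  have e2 : fibConv n m (fun x => (F x : ℂ)) (fun x => (F x : ℂ)) a τ = ((∫ ρ, k ρ : ℝ) : ℂ) := by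
    unfold fibConv
    rw [← integral_complex_ofReal]
    refine integral_congr_ae (Eventually.of_forall fun ρ => ?_)
    simp [hk]
  rw [e2, ← ofReal_integral_eq_lintegral_ofReal hki (Eventually.of_forall hk0),
    ← ofReal_norm, Complex.norm_of_nonneg (integral_nonneg hk0)]

theorem locallyIntegrable_of_integrable_mul_schwartz {V : Type*} [NormedAddCommGroup V]
    [InnerProductSpace ℝ V] [FiniteDimensional ℝ V] [MeasurableSpace V] [BorelSpace V]
    {G : V → ℂ} (h : ∀ ψ : 𝓢(V, ℂ), Integrable fun x => G x * ψ x) : LocallyIntegrable G := by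
  intro x
  let φ : ContDiffBump x := ⟨1, 2, one_pos, one_lt_two⟩
  have hc : HasCompactSupport (Complex.ofRealCLM ∘ φ) := φ.hasCompactSupport.comp_left rfl
  have hd : ContDiff ℝ ((⊤ : ℕ∞) : WithTop ℕ∞) (Complex.ofRealCLM ∘ φ) :=
    Complex.ofRealCLM.contDiff.comp φ.contDiff
  refine ⟨Metric.closedBall x 1, Metric.closedBall_mem_nhds x one_pos, ?_⟩
  refine ((h (hc.toSchwartzMap hd)).integrableOn (s := Metric.closedBall x 1)).congr_fun ?_
    Metric.isClosed_closedBall.measurableSet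
  intro y hy
  have : φ y = 1 := φ.one_of_mem_closedBall hy
  simp [this]

/-- The pairing identity is pushed through the disintegration, and Fubini integrates out the fiber
variable `ρ`, on which the test function does not depend. -/
theorem isSpacetimeFourier_product {s : ℝ} (hs : 0 < s) {f g : L2 (n + 2)} {F₁ F₂ : ℝ → ℂ}
    (hF₁ : Measurable F₁) (hF₂ : Measurable F₂)
    (hf : ∀ᵐ η, (𝓕 f : L2 (n + 2)) η = F₁ (en (s / (2 * Real.pi)) η))
    (hg : ∀ᵐ η, (𝓕 g : L2 (n + 2)) η = F₂ (en (s / (2 * Real.pi)) η)) :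
    IsSpacetimeFourier (product s f g)
      fun ζ => fibConv n (s / (2 * Real.pi)) F₁ F₂ ‖ζ.snd‖ ζ.fst := by
  set m := s / (2 * Real.pi) with hmdef
  have hm : 0 < m := by positivity
  have main : ∀ ψ : 𝓢(Spacetime (n + 2), ℂ),
      Integrable (fun ζ : Spacetime (n + 2) => fibConv n m F₁ F₂ ‖ζ.snd‖ ζ.fst * ψ ζ) ∧
      ∫ ζ : Spacetime (n + 2), fibConv n m F₁ F₂ ‖ζ.snd‖ ζ.fst * ψ ζ =
        ∫ p : Space (n + 2) × Space (n + 2), (𝓕 f : L2 (n + 2)) p.1 *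
          conj ((𝓕 g : L2 (n + 2)) p.2) * shellTest m ψ p := by
    intro ψ
    set K : ℝ × ℝ × Space (n + 2) → ℂ := fun k =>
      F₁ k.1 * conj (F₂ k.2.1) * ψ (WithLp.toLp 2 (k.1 - k.2.1, k.2.2)) with hK
    have hconj : Measurable (fun z : ℂ => conj z) := Complex.continuous_conj.measurable
    have hKm : Measurable K := by
      have h1 : Measurable fun k : ℝ × ℝ × Space (n + 2) =>
          ψ (WithLp.toLp 2 (k.1 - k.2.1, k.2.2)) := by
        refine Continuous.measurable (ψ.continuous.comp ?_)
        exact (WithLp.prod_continuous_toLp 2 ℝ (Space (n + 2))).comp (by fun_prop)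
      have h2 : Measurable fun k : ℝ × ℝ × Space (n + 2) => conj (F₂ k.2.1) :=
        hconj.comp (hF₂.comp (by fun_prop))
      exact ((hF₁.comp (by fun_prop)).mul h2).mul h1
    have hae : (fun p : Space (n + 2) × Space (n + 2) => (𝓕 f : L2 (n + 2)) p.1 *
        conj ((𝓕 g : L2 (n + 2)) p.2) * shellTest m ψ p) =ᵐ[volume]
          fun p => K (shellPair m p) := by
      filter_upwards [Measure.quasiMeasurePreserving_fst.ae hf,
        Measure.quasiMeasurePreserving_snd.ae hg] with p h1 h2
      rw [h1, h2]
      rfl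
    have hi := (integrable_mul_conj_mul_shellTest (m := m) (𝓕 f : L2 (n + 2)) (𝓕 g) ψ).congr hae
    rw [integrable_shellPair_iff hm hKm] at hi
    have e1 : ∀ z : ℝ × Space (n + 2), ∫ ρ : ℝ, (fibWt n m ‖z.2‖ z.1 ρ : ℂ) *
        K (fibPair m (z, ρ)) = fibConv n m F₁ F₂ ‖z.2‖ z.1 * ψ (WithLp.toLp 2 z) := by
      intro z
      unfold fibConv
      rw [← integral_mul_const]
      refine integral_congr_ae (Eventually.of_forall fun ρ => ?_)
      simp only [hK, fibPair, sub_sub_cancel]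
      ring
    have hi2 := Integrable.integral_prod_left hi
    simp only [e1] at hi2
    have hemb := measurableEmbedding_toLp (n + 2)
    have hmp := measurePreserving_toLp (n + 2)
    refine ⟨?_, ?_⟩
    · exact (hmp.integrable_comp_emb hemb).1 hi2
    · rw [integral_congr_ae hae, integral_shellPair hm hKm, ← hmp.integral_comp hemb]
      refine Eq.symm ((integral_prod _ hi).trans ?_)
      exact integral_congr_ae (Eventually.of_forall e1)
  refine ⟨locallyIntegrable_of_integrable_mul_schwartz fun ψ => (main ψ).1,
    fun t => integrable_mul_conj _ _, fun ψ => ?_⟩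
  obtain ⟨h1, h2⟩ := pairing s f g ψ
  exact ⟨(main ψ).1, h1, (main ψ).2.trans h2.symm⟩

end FiberMeasure

/-! ### The two sides of the estimate in terms of energy profiles -/

section Norms

theorem sq_eLpNorm_two {α : Type*} [MeasurableSpace α] {μ : Measure α} (f : α → ℂ) :
    eLpNorm f 2 μ ^ 2 = ∫⁻ x, ‖f x‖ₑ ^ 2 ∂μ := by
  have := eLpNorm_nnreal_pow_eq_lintegral (f := f) (μ := μ) (p := 2) two_ne_zero
  simpa using this

/-- The symbol of `|□|^β`. -/
def boxSymbol (d : ℕ) (β : ℝ) (ζ : Spacetime d) : ℂ :=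
  ((|(2 * Real.pi * ζ.fst) ^ 2 - (2 * Real.pi * ‖ζ.snd‖) ^ 2| ^ β : ℝ) : ℂ)

theorem measurable_boxSymbol (d : ℕ) (β : ℝ) : Measurable (boxSymbol d β) := by
  unfold boxSymbol
  have h1 : Measurable fun ζ : Spacetime d => ζ.fst :=
    (WithLp.prod_continuous_ofLp 2 ℝ (Space d)).measurable.fst
  have h2 : Measurable fun ζ : Spacetime d => ζ.snd :=
    (WithLp.prod_continuous_ofLp 2 ℝ (Space d)).measurable.snd
  fun_prop

/-- Pairings with Schwartz functions determine `G` almost everywhere, so every competitor in the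
infimum has the norm on the right; one exists as soon as that norm is finite. -/
theorem boxNorm_eq {d : ℕ} {β : ℝ} {F : ℝ → Space d → ℂ} {G : Spacetime d → ℂ}
    (h : IsSpacetimeFourier F G) :
    boxNorm β F = eLpNorm (fun ζ => boxSymbol d β ζ * G ζ) 2 volume := by
  refine le_antisymm ?_ (le_iInf₂ fun H hH => ?_)
  · by_cases hfin : eLpNorm (fun ζ => boxSymbol d β ζ * G ζ) 2 volume = ∞
    · rw [hfin]
      exact le_top
    · have hmem : MemLp (fun ζ => boxSymbol d β ζ * G ζ) 2 volume :=
        ⟨(measurable_boxSymbol d β).aestronglyMeasurable.mul h.1.aestronglyMeasurable,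
          lt_top_iff_ne_top.2 hfin⟩
      have hF : (𝓕 (𝓕⁻ (hmem.toLp _) : SpacetimeL2 d) : SpacetimeL2 d) = hmem.toLp _ :=
        FourierTransform.fourier_fourierInv_eq _
      refine (iInf₂_le (𝓕⁻ (hmem.toLp _) : SpacetimeL2 d) ⟨G, h, ?_⟩).trans (le_of_eq ?_)
      · rw [← ofReal_norm, ← Lp.norm_fourier_eq, hF, ofReal_norm, Lp.enorm_toLp]
      · rw [hF]
        exact hmem.coeFn_toLp
  · obtain ⟨G', hG', hH'⟩ := hH
    have hGG : G =ᵐ[volume] G' := ae_eq_of_forall_integral_schwartz_eq h.1 hG'.1 fun ψ => by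
      rw [(h.2.2 ψ).2.2, (hG'.2.2 ψ).2.2]
    rw [← ofReal_norm H, ← Lp.norm_fourier_eq, ofReal_norm, Lp.enorm_def]
    refine le_of_eq (eLpNorm_congr_ae ?_)
    filter_upwards [hGG, hH'] with ζ h1 h2
    rw [h2, h1]
    rfl

variable {n : ℕ} {m : ℝ}

theorem sq_sobolevNorm {s : ℝ} (hs : 0 < s) (α : ℝ) {f : L2 (n + 2)} {F : ℝ → ℂ}
    (hf : ∀ᵐ η, (𝓕 f : L2 (n + 2)) η = F (en (s / (2 * Real.pi)) η)) :
    sobolevNorm s α f ^ 2 = ENNReal.ofReal ((2 * Real.pi) ^ (2 * α)) *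
      energy n (s / (2 * Real.pi)) (2 * α) (fun x => ‖F x‖ₑ ^ 2) := by
  have hm : 0 < s / (2 * Real.pi) := by positivity
  unfold sobolevNorm energy
  rw [sq_eLpNorm_two, ← lintegral_const_mul' _ _ ENNReal.ofReal_ne_top]
  refine lintegral_congr_ae ?_
  filter_upwards [hf] with η h
  have hp := en_pos hm η
  have h1 : ‖((phi s (2 * Real.pi * ‖η‖) ^ α : ℝ) : ℂ)‖ₑ ^ 2 =
      ENNReal.ofReal ((2 * Real.pi) ^ (2 * α)) *
        ENNReal.ofReal (en (s / (2 * Real.pi)) η ^ (2 * α)) := by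
    have e : phi s (2 * Real.pi * ‖η‖) = 2 * Real.pi * en (s / (2 * Real.pi)) η := phi_two_pi _ _
    rw [e, ← ofReal_norm, Complex.norm_of_nonneg (by positivity), ← ENNReal.ofReal_pow
      (by positivity), ← ENNReal.ofReal_mul (by positivity), ← Real.mul_rpow (by positivity) hp.le,
      mul_comm 2 α, Real.rpow_mul (by positivity), Real.rpow_two]
  rw [enorm_mul, mul_pow, h1, h]
  ring

theorem measurable_fibConv {F₁ F₂ : ℝ → ℂ} (hF₁ : Measurable F₁) (hF₂ : Measurable F₂) :
    Measurable fun p : ℝ × ℝ => fibConv n m F₁ F₂ p.1 p.2 := by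
  have hconj : Measurable (fun z : ℂ => conj z) := Complex.continuous_conj.measurable
  have h2 : Measurable fun q : (ℝ × ℝ) × ℝ =>
      conj (F₂ (fibE q.1.1 q.1.2 (m ^ 2 + q.2 ^ 2) - q.1.2)) :=
    hconj.comp (hF₂.comp (by fun_prop))
  have h1 : Measurable fun q : (ℝ × ℝ) × ℝ => (fibWt n m q.1.1 q.1.2 q.2 : ℂ) *
      (F₁ (fibE q.1.1 q.1.2 (m ^ 2 + q.2 ^ 2)) *
        conj (F₂ (fibE q.1.1 q.1.2 (m ^ 2 + q.2 ^ 2) - q.1.2))) := by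
    refine Measurable.mul ?_ (Measurable.mul (hF₁.comp (by fun_prop)) h2)
    exact Complex.measurable_ofReal.comp (by fun_prop)
  exact h1.stronglyMeasurable.integral_prod_right.measurable

theorem sq_eLpNorm_boxSymbol_mul (β : ℝ) {F₁ F₂ : ℝ → ℂ} (hF₁ : Measurable F₁)
    (hF₂ : Measurable F₂) :
    eLpNorm (fun ζ : Spacetime (n + 2) =>
      boxSymbol (n + 2) β ζ * fibConv n m F₁ F₂ ‖ζ.snd‖ ζ.fst) 2 volume ^ 2 =
      ENNReal.ofReal ((2 * Real.pi) ^ (4 * β)) * ∫⁻ ξ : Space (n + 2), ∫⁻ τ in Ioo (-‖ξ‖) ‖ξ‖,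
        ENNReal.ofReal ((‖ξ‖ ^ 2 - τ ^ 2) ^ (2 * β)) * ‖fibConv n m F₁ F₂ ‖ξ‖ τ‖ₑ ^ 2 := by
  have hmc := measurable_fibConv (n := n) (m := m) hF₁ hF₂
  rw [sq_eLpNorm_two, ← (measurePreserving_toLp (n + 2)).lintegral_comp_emb
    (measurableEmbedding_toLp (n + 2))]
  have hmeas : Measurable fun z : ℝ × Space (n + 2) =>
      ‖boxSymbol (n + 2) β (WithLp.toLp 2 z) * fibConv n m F₁ F₂ ‖z.2‖ z.1‖ₑ ^ 2 := by
    have h1 : Measurable fun z : ℝ × Space (n + 2) => boxSymbol (n + 2) β (WithLp.toLp 2 z) :=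
      (measurable_boxSymbol _ _).comp (measurableEmbedding_toLp (n + 2)).measurable
    have h2 : Measurable fun z : ℝ × Space (n + 2) => fibConv n m F₁ F₂ ‖z.2‖ z.1 :=
      hmc.comp (f := fun z : ℝ × Space (n + 2) => (‖z.2‖, z.1)) (by fun_prop)
    fun_prop
  refine (lintegral_prod_symm _ hmeas.aemeasurable).trans ?_
  rw [← lintegral_const_mul' _ _ ENNReal.ofReal_ne_top]
  refine lintegral_congr fun ξ => ?_
  rw [← lintegral_const_mul' _ _ ENNReal.ofReal_ne_top, ← lintegral_indicator measurableSet_Ioo]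
  refine lintegral_congr fun τ => ?_
  by_cases h : |τ| < ‖ξ‖
  · have hv := sq_sub_sq_pos_of_abs_lt h
    rw [indicator_of_mem (by simpa [abs_lt] using h), enorm_mul, mul_pow, ← mul_assoc]
    congr 1
    have e : |(2 * Real.pi * τ) ^ 2 - (2 * Real.pi * ‖ξ‖) ^ 2| =
        (2 * Real.pi) ^ 2 * (‖ξ‖ ^ 2 - τ ^ 2) := by
      rw [abs_of_nonpos]
      · ring
      · have := mul_pos (pow_pos (mul_pos two_pos Real.pi_pos) 2) hv
        nlinarith
    change ‖((|(2 * Real.pi * τ) ^ 2 - (2 * Real.pi * ‖ξ‖) ^ 2| ^ β : ℝ) : ℂ)‖ₑ ^ 2 = _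
    rw [e, ← ofReal_norm, Complex.norm_of_nonneg (by positivity), ← ENNReal.ofReal_pow
      (by positivity), ← ENNReal.ofReal_mul (by positivity)]
    congr 1
    rw [Real.mul_rpow (by positivity) hv.le, mul_pow, ← Real.rpow_natCast (2 * Real.pi) 2,
      ← Real.rpow_mul (by positivity), ← Real.rpow_natCast _ 2, ← Real.rpow_natCast _ 2,
      ← Real.rpow_mul (by positivity), ← Real.rpow_mul hv.le]
    congr 2 <;> (push_cast; ring)
  · rw [indicator_of_notMem (by simpa [abs_lt] using h), fibConv_eq_zero h]
    simp

/-- Cauchy–Schwarz after inserting `1 = √(x/y) √(y/x)`. With these weights the energies of the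
points carrying no data appear as `1/E`, the density of the Lorentz-invariant measure. -/
theorem sq_fibInt_le (hm : 0 < m) {U V : ℝ → ℝ≥0∞} (hU : Measurable U) (hV : Measurable V)
    {a τ : ℝ} (h : |τ| < a) :
    fibInt n m a τ (fun x y => U x * V y) ^ 2 ≤
      fibInt n m a τ (fun x y => U x ^ 2 * ENNReal.ofReal (x / y)) *
        fibInt n m a τ (fun x y => V y ^ 2 * ENNReal.ofReal (y / x)) := by
  simp only [fibInt_eq_lintegral hm h]
  set E : ℝ → ℝ := fun ρ => fibE a τ (m ^ 2 + ρ ^ 2) with hE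
  have hEm : Measurable E := by simp only [hE]; fun_prop
  set p : ℝ → ℝ≥0∞ := fun ρ => ENNReal.ofReal √(fibWt n m a τ ρ) *
    (U (E ρ) * ENNReal.ofReal √(E ρ / (E ρ - τ))) with hp
  set q : ℝ → ℝ≥0∞ := fun ρ => ENNReal.ofReal √(fibWt n m a τ ρ) *
    (V (E ρ - τ) * ENNReal.ofReal √((E ρ - τ) / E ρ)) with hq
  have hpm : Measurable p := by simp only [hp]; fun_prop
  have hqm : Measurable q := by simp only [hq]; fun_prop
  have key := ENNReal.lintegral_mul_le_Lp_mul_Lq volume Real.HolderConjugate.two_two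
    hpm.aemeasurable hqm.aemeasurable
  -- The energies are only known to be positive for `ρ > 0`; elsewhere the weight vanishes.
  have E1 : ∀ ρ, 0 < E ρ ∨ fibWt n m a τ ρ = 0 := by
    intro ρ
    by_cases hρ : 0 < ρ
    · exact Or.inl (fibE_pos h (by positivity))
    · exact Or.inr (by unfold fibWt; rw [if_neg (fun h => hρ h.2)])
  have E2 : ∀ ρ, 0 < E ρ - τ ∨ fibWt n m a τ ρ = 0 := by
    intro ρ
    by_cases hρ : 0 < ρ
    · exact Or.inl (fibE_sub_pos h (by positivity))
    · exact Or.inr (by unfold fibWt; rw [if_neg (fun h => hρ h.2)])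
  have w2 : ∀ ρ, ENNReal.ofReal √(fibWt n m a τ ρ) ^ 2 = ENNReal.ofReal (fibWt n m a τ ρ) := by
    intro ρ
    rw [← ENNReal.ofReal_pow (by positivity), Real.sq_sqrt (fibWt_nonneg hm _ _ _)]
  have e0 : ∀ ρ, ENNReal.ofReal (fibWt n m a τ ρ) * (U (E ρ) * V (E ρ - τ)) = (p * q) ρ := by
    intro ρ
    simp only [hp, hq, Pi.mul_apply]
    rcases E1 ρ with h1 | h1
    swap
    · rw [h1]; simp
    rcases E2 ρ with h2 | h2
    swap
    · rw [h2]; simp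
    have : ENNReal.ofReal √(E ρ / (E ρ - τ)) * ENNReal.ofReal √((E ρ - τ) / E ρ) = 1 := by
      rw [← ENNReal.ofReal_mul (by positivity), ← Real.sqrt_mul (by positivity),
        div_mul_div_cancel₀ h2.ne', div_self h1.ne']
      simp
    calc _ = ENNReal.ofReal √(fibWt n m a τ ρ) ^ 2 * (U (E ρ) * V (E ρ - τ)) * 1 := by
          rw [w2, mul_one]
      _ = _ := by rw [← this]; ring
  have e1 : ∀ ρ, p ρ ^ (2 : ℝ) = ENNReal.ofReal (fibWt n m a τ ρ) *
      (U (E ρ) ^ 2 * ENNReal.ofReal (E ρ / (E ρ - τ))) := by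
    intro ρ
    simp only [hp]
    rcases E1 ρ with h1 | h1
    swap
    · rw [h1]; simp
    rcases E2 ρ with h2 | h2
    swap
    · rw [h2]; simp
    rw [ENNReal.rpow_two, mul_pow, mul_pow, w2, ← ENNReal.ofReal_pow (by positivity),
      Real.sq_sqrt (by positivity)]
  have e2 : ∀ ρ, q ρ ^ (2 : ℝ) = ENNReal.ofReal (fibWt n m a τ ρ) *
      (V (E ρ - τ) ^ 2 * ENNReal.ofReal ((E ρ - τ) / E ρ)) := by
    intro ρ
    simp only [hq]
    rcases E1 ρ with h1 | h1
    swap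
    · rw [h1]; simp
    rcases E2 ρ with h2 | h2
    swap
    · rw [h2]; simp
    rw [ENNReal.rpow_two, mul_pow, mul_pow, w2, ← ENNReal.ofReal_pow (by positivity),
      Real.sq_sqrt (by positivity)]
  simp_rw [e1, e2, ← e0] at key
  have key2 := ENNReal.rpow_le_rpow key (zero_le_two : (0 : ℝ) ≤ 2)
  rw [ENNReal.mul_rpow_of_nonneg _ _ zero_le_two, ← ENNReal.rpow_mul, ← ENNReal.rpow_mul] at key2
  simpa using key2

theorem sq_boxNorm_le {s β : ℝ} (hs : 0 < s) {f g : L2 (n + 2)} {F₁ F₂ : ℝ → ℂ}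
    (hF₁ : Measurable F₁) (hF₂ : Measurable F₂)
    (hf : ∀ᵐ η, (𝓕 f : L2 (n + 2)) η = F₁ (en (s / (2 * Real.pi)) η))
    (hg : ∀ᵐ η, (𝓕 g : L2 (n + 2)) η = F₂ (en (s / (2 * Real.pi)) η)) :
    boxNorm β (product s f g) ^ 2 ≤ ENNReal.ofReal ((2 * Real.pi) ^ (4 * β)) *
      nullForm n (s / (2 * Real.pi)) (fun v => ENNReal.ofReal (v ^ (2 * β)))
        (fun x => ‖F₁ x‖ₑ ^ 2) (fun x => ‖F₂ x‖ₑ ^ 2) := by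
  have hm : 0 < s / (2 * Real.pi) := by positivity
  rw [boxNorm_eq (isSpacetimeFourier_product hs hF₁ hF₂ hf hg),
    sq_eLpNorm_boxSymbol_mul β hF₁ hF₂]
  refine mul_le_mul_right (lintegral_mono fun ξ => ?_) _
  refine setLIntegral_mono' measurableSet_Ioo fun τ hτ => mul_le_mul_right ?_ _
  have h : |τ| < ‖ξ‖ := abs_lt.2 hτ
  refine le_trans ?_ (sq_fibInt_le hm hF₁.enorm hF₂.enorm h)
  exact pow_le_pow_left' (enorm_fibConv_le hm h) 2

/-- For nonnegative data the triangle inequality loses nothing and `heq` is equality in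
Cauchy–Schwarz. Finiteness of the null form makes almost every fiber integral finite, as
`enorm_fibConv_eq` requires. -/
theorem sq_boxNorm_self {s β : ℝ} (hs : 0 < s) {f : L2 (n + 2)} {F : ℝ → ℝ}
    (hF : Measurable F) (hF0 : ∀ x, 0 ≤ F x)
    (hf : ∀ᵐ η, (𝓕 f : L2 (n + 2)) η = (F (en (s / (2 * Real.pi)) η) : ℂ))
    (hW : nullForm n (s / (2 * Real.pi)) (fun v => ENNReal.ofReal (v ^ (2 * β)))
        (fun x => ENNReal.ofReal (F x) ^ 2) (fun x => ENNReal.ofReal (F x) ^ 2) ≠ ∞)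
    (heq : ∀ a τ : ℝ, |τ| < a →
      fibInt n (s / (2 * Real.pi)) a τ
        (fun x y => ENNReal.ofReal (F x) * ENNReal.ofReal (F y)) ^ 2 =
      fibInt n (s / (2 * Real.pi)) a τ
          (fun x y => ENNReal.ofReal (F x) ^ 2 * ENNReal.ofReal (x / y)) *
        fibInt n (s / (2 * Real.pi)) a τ
          (fun x y => ENNReal.ofReal (F y) ^ 2 * ENNReal.ofReal (y / x))) :
    boxNorm β (product s f f) ^ 2 = ENNReal.ofReal ((2 * Real.pi) ^ (4 * β)) *
      nullForm n (s / (2 * Real.pi)) (fun v => ENNReal.ofReal (v ^ (2 * β)))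
        (fun x => ENNReal.ofReal (F x) ^ 2) (fun x => ENNReal.ofReal (F x) ^ 2) := by
  have hm : 0 < s / (2 * Real.pi) := by positivity
  have hFc : Measurable fun x => (F x : ℂ) := Complex.measurable_ofReal.comp hF
  rw [boxNorm_eq (isSpacetimeFourier_product hs hFc hFc hf hf),
    sq_eLpNorm_boxSymbol_mul β hFc hFc]
  congr 1
  have hfm : Measurable fun p : ℝ × ℝ => fibInt n (s / (2 * Real.pi)) p.1 p.2
      (fun x y => ENNReal.ofReal (F x) * ENNReal.ofReal (F y)) :=
    measurable_fibInt (by unfold Function.uncurry; fun_prop)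
  have hnf : nullForm n (s / (2 * Real.pi)) (fun v => ENNReal.ofReal (v ^ (2 * β)))
        (fun x => ENNReal.ofReal (F x) ^ 2) (fun x => ENNReal.ofReal (F x) ^ 2) =
      ∫⁻ ξ : Space (n + 2), ∫⁻ τ, (Ioo (-‖ξ‖) ‖ξ‖).indicator (fun τ =>
        ENNReal.ofReal ((‖ξ‖ ^ 2 - τ ^ 2) ^ (2 * β)) * fibInt n (s / (2 * Real.pi)) ‖ξ‖ τ
          (fun x y => ENNReal.ofReal (F x) * ENNReal.ofReal (F y)) ^ 2) τ := by
    unfold nullForm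
    refine lintegral_congr fun ξ => ?_
    rw [← lintegral_indicator measurableSet_Ioo]
    refine lintegral_congr fun τ => ?_
    by_cases h : τ ∈ Ioo (-‖ξ‖) ‖ξ‖
    · rw [indicator_of_mem h, indicator_of_mem h, heq _ _ (abs_lt.2 h)]
    · rw [indicator_of_notMem h, indicator_of_notMem h]
  rw [hnf] at hW ⊢
  have hmeas : Measurable fun p : Space (n + 2) × ℝ => (Ioo (-‖p.1‖) ‖p.1‖).indicator (fun τ =>
        ENNReal.ofReal ((‖p.1‖ ^ 2 - τ ^ 2) ^ (2 * β)) * fibInt n (s / (2 * Real.pi)) ‖p.1‖ τ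
          (fun x y => ENNReal.ofReal (F x) * ENNReal.ofReal (F y)) ^ 2) p.2 := by
    have hS : MeasurableSet {p : Space (n + 2) × ℝ | -‖p.1‖ < p.2 ∧ p.2 < ‖p.1‖} :=
      (measurableSet_lt (f := fun p : Space (n + 2) × ℝ => -‖p.1‖) (g := fun p => p.2)
        (by fun_prop) (by fun_prop)).inter
      (measurableSet_lt (f := fun p : Space (n + 2) × ℝ => p.2) (g := fun p => ‖p.1‖)
        (by fun_prop) (by fun_prop))
    have hg : Measurable fun p : Space (n + 2) × ℝ =>
        ENNReal.ofReal ((‖p.1‖ ^ 2 - p.2 ^ 2) ^ (2 * β)) * fibInt n (s / (2 * Real.pi)) ‖p.1‖ p.2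
          (fun x y => ENNReal.ofReal (F x) * ENNReal.ofReal (F y)) ^ 2 := by
      refine Measurable.mul (by fun_prop) (Measurable.pow_const ?_ 2)
      exact hfm.comp (f := fun p : Space (n + 2) × ℝ => (‖p.1‖, p.2)) (by fun_prop)
    exact hg.indicator hS
  have hae1 := ae_lt_top hmeas.lintegral_prod_right' hW
  refine lintegral_congr_ae ?_
  filter_upwards [hae1] with ξ hξ
  rw [← lintegral_indicator measurableSet_Ioo]
  refine lintegral_congr_ae ?_
  filter_upwards [ae_lt_top (hmeas.comp measurable_prodMk_left) hξ.ne] with τ hτ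
  by_cases h : τ ∈ Ioo (-‖ξ‖) ‖ξ‖
  · have h' : |τ| < ‖ξ‖ := abs_lt.2 h
    have hv := sq_sub_sq_pos_of_abs_lt h'
    simp only [Function.comp_apply] at hτ
    rw [indicator_of_mem h] at hτ
    rw [indicator_of_mem h, indicator_of_mem h, enorm_fibConv_eq hm hF hF0 h']
    intro htop
    rw [htop] at hτ
    have h0 : ENNReal.ofReal ((‖ξ‖ ^ 2 - τ ^ 2) ^ (2 * β)) ≠ 0 := by
      simp only [ne_eq, ENNReal.ofReal_eq_zero, not_le]
      positivity
    rw [ENNReal.top_pow two_ne_zero, ENNReal.mul_top h0] at hτ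
    exact lt_irrefl _ hτ
  · rw [indicator_of_notMem h, indicator_of_notMem h]

end Norms

/-! ### The estimate, and its strict form -/

section RadialEstimates

variable {n : ℕ} {s β : ℝ}

/-- The order of the Sobolev norms in the estimate. -/
def sobOrder (n : ℕ) (β : ℝ) : ℝ := (((n + 2 : ℕ) : ℝ) - 1) / 4 + β

theorem two_mul_sobOrder (n : ℕ) (β : ℝ) : 2 * sobOrder n β = bExp n β + 1 := by
  unfold sobOrder bExp
  push_cast
  ring

theorem exists_energyProfile {f : L2 (n + 2)} (m : ℝ) (hf : IsRadial f) :
    ∃ F : ℝ → ℂ, Measurable F ∧ ∀ᵐ η, (𝓕 f : L2 (n + 2)) η = F (en m η) := by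
  obtain ⟨F, hF, h⟩ := exists_measurable_of_mem_radialL2 (fourier_mem_radialL2 (isRadial_iff.1 hf))
  refine ⟨fun x => F √(x ^ 2 - m ^ 2), hF.comp (by fun_prop), ?_⟩
  filter_upwards [h] with η hη
  rw [hη, ← norm_eq_sqrt_en]

/-- Since `4α = n + 1 + 4β`, the powers of `2π` from the two Sobolev norms match those from the
symbol of `□`, up to the `(2π)^(n+1)` that accompanies `constF`. -/
theorem two_pi_rpow_sobOrder (n : ℕ) (β : ℝ) :
    ENNReal.ofReal ((2 * Real.pi) ^ (2 * sobOrder n β)) *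
      ENNReal.ofReal ((2 * Real.pi) ^ (2 * sobOrder n β)) =
    ENNReal.ofReal ((2 * Real.pi) ^ (4 * β)) * ENNReal.ofReal ((2 * Real.pi) ^ (n + 1)) := by
  have hp := Real.pi_pos
  rw [← ENNReal.ofReal_mul (by positivity), ← ENNReal.ofReal_mul (by positivity),
    ← Real.rpow_add (by positivity), ← Real.rpow_natCast, ← Real.rpow_add (by positivity)]
  congr 2
  unfold sobOrder
  push_cast
  ring

/-- Any bound `M` of the angular integrals uniform in `ν` gives an estimate. The mass enters only
through the energies, so the condition on `C` does not involve `s`. -/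
theorem radialEstimate_of_le (hs : 0 < s) (ha : 0 ≤ (n : ℝ) / 2 + 2 * β)
    (hne : ¬ (n = 0 ∧ β = 0)) {M : ℝ≥0∞}
    (hM : ∀ ν : ℝ, 0 ≤ ν → ν ≤ 1 → angB n (bExp n β) ν ≤ M) {C : ℝ} (hC0 : 0 ≤ C)
    (hC : sph n * angInt n (2 * β) * (ENNReal.ofReal (kap n) * M) ≤
      ENNReal.ofReal ((2 * Real.pi) ^ (n + 1) * C ^ 2) * angInt n 0) :
    RadialEstimate (n + 2) s β C := by
  intro f g hf hg
  have hm : 0 < s / (2 * Real.pi) := by positivity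
  obtain ⟨F, hF, hfF⟩ := exists_energyProfile (s / (2 * Real.pi)) hf.1
  obtain ⟨G, hG, hgG⟩ := exists_energyProfile (s / (2 * Real.pi)) hg.1
  have h0 : angInt n 0 ≠ 0 := angInt_ne_zero (by positivity)
  have h0' : angInt n 0 ≠ ∞ := angInt_ne_top (by positivity)
  have h1 := sq_boxNorm_le (β := β) hs hF hG hfF hgG
  have h2 := angInt_mul_nullForm_le (n := n) (β := β) hm ha hne (hF.enorm.pow_const 2)
    (hG.enorm.pow_const 2) hM
  have h3 := sq_sobolevNorm hs (sobOrder n β) hfF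
  have h4 := sq_sobolevNorm hs (sobOrder n β) hgG
  rw [two_mul_sobOrder] at h3 h4
  have h5 := two_pi_rpow_sobOrder n β
  rw [two_mul_sobOrder] at h5
  change boxNorm β (product s f g) ≤ ENNReal.ofReal C * sobolevNorm s (sobOrder n β) f *
    sobolevNorm s (sobOrder n β) g
  rw [← ENNReal.pow_le_pow_left_iff two_ne_zero, mul_pow, mul_pow, h3, h4,
    ← ENNReal.mul_le_mul_iff_right h0 h0']
  set IF := energy n (s / (2 * Real.pi)) (bExp n β + 1) fun x => ‖F x‖ₑ ^ 2
  set IG := energy n (s / (2 * Real.pi)) (bExp n β + 1) fun x => ‖G x‖ₑ ^ 2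
  calc angInt n 0 * boxNorm β (product s f g) ^ 2
      ≤ ENNReal.ofReal ((2 * Real.pi) ^ (4 * β)) * (angInt n 0 *
        nullForm n (s / (2 * Real.pi)) (fun v => ENNReal.ofReal (v ^ (2 * β)))
          (fun x => ‖F x‖ₑ ^ 2) (fun x => ‖G x‖ₑ ^ 2)) := by
        refine (mul_le_mul_right h1 _).trans (le_of_eq ?_)
        ring
    _ ≤ ENNReal.ofReal ((2 * Real.pi) ^ (4 * β)) * (sph n * angInt n (2 * β) *
        (ENNReal.ofReal (kap n) * M * (IF * IG))) := mul_le_mul_right h2 _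
    _ = ENNReal.ofReal ((2 * Real.pi) ^ (4 * β)) * (sph n * angInt n (2 * β) *
        (ENNReal.ofReal (kap n) * M)) * (IF * IG) := by ring
    _ ≤ ENNReal.ofReal ((2 * Real.pi) ^ (4 * β)) *
        (ENNReal.ofReal ((2 * Real.pi) ^ (n + 1) * C ^ 2) * angInt n 0) * (IF * IG) :=
        mul_le_mul_left (mul_le_mul_right hC _) _
    _ = ENNReal.ofReal ((2 * Real.pi) ^ (4 * β)) * ENNReal.ofReal ((2 * Real.pi) ^ (n + 1)) *
        (angInt n 0 * ENNReal.ofReal C ^ 2 * (IF * IG)) := by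
        rw [ENNReal.ofReal_mul (by positivity), ENNReal.ofReal_pow hC0]
        ring
    _ = _ := by
        rw [← h5]
        ring

theorem energy_ne_zero_of_ne_zero {m p : ℝ} (hm : 0 < m) {f : L2 (n + 2)} {F : ℝ → ℂ}
    (hF : Measurable F) (hfF : ∀ᵐ η, (𝓕 f : L2 (n + 2)) η = F (en m η)) (hf : f ≠ 0) :
    energy n m p (fun x => ‖F x‖ₑ ^ 2) ≠ 0 := by
  intro h
  refine hf ?_
  have hF0 : (𝓕 f : L2 (n + 2)) = 0 := by
    unfold energy at h
    rw [lintegral_eq_zero_iff (by fun_prop)] at h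
    rw [Lp.eq_zero_iff_ae_eq_zero]
    filter_upwards [h, hfF] with η h1 h2
    have h3 : ENNReal.ofReal (en m η ^ p) ≠ 0 := by
      have := en_pos hm η
      simp only [ne_eq, ENNReal.ofReal_eq_zero, not_le]
      positivity
    rw [h2]
    simpa [h3] using h1
  have := Lp.norm_fourier_eq f
  rw [hF0, norm_zero] at this
  exact norm_eq_zero.1 this.symm

theorem boxNorm_lt (hs : 0 < s) (ha : 0 ≤ (n : ℝ) / 2 + 2 * β)
    (hne : ¬ (n = 0 ∧ β = 0)) (hβ : 0 < 2 * β + ((n : ℝ) + 1) / 2) {M : ℝ≥0∞}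
    (hM : ∀ ν : ℝ, 0 ≤ ν → ν ≤ 1 → angB n (bExp n β) ν ≤ M) (hMt : M ≠ ∞) {C : ℝ} (hC0 : 0 ≤ C)
    (hC : sph n * angInt n (2 * β) * (ENNReal.ofReal (kap n) * M) ≤
      ENNReal.ofReal ((2 * Real.pi) ^ (n + 1) * C ^ 2) * angInt n 0)
    {f g : L2 (n + 2)} (hf : IsRadialData s (sobOrder n β) f) (hg : IsRadialData s (sobOrder n β) g)
    (hf0 : f ≠ 0) (hg0 : g ≠ 0) :
    boxNorm β (product s f g) < ENNReal.ofReal C * sobolevNorm s (sobOrder n β) f *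
      sobolevNorm s (sobOrder n β) g := by
  have hm : 0 < s / (2 * Real.pi) := by positivity
  obtain ⟨F, hF, hfF⟩ := exists_energyProfile (s / (2 * Real.pi)) hf.1
  obtain ⟨G, hG, hgG⟩ := exists_energyProfile (s / (2 * Real.pi)) hg.1
  have h0 : angInt n 0 ≠ 0 := angInt_ne_zero (by positivity)
  have h0' : angInt n 0 ≠ ∞ := angInt_ne_top (by positivity)
  have h1 := sq_boxNorm_le (β := β) hs hF hG hfF hgG
  have h3 := sq_sobolevNorm hs (sobOrder n β) hfF
  have h4 := sq_sobolevNorm hs (sobOrder n β) hgG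
  rw [two_mul_sobOrder] at h3 h4
  have hpp : ∀ p : ℝ, ENNReal.ofReal ((2 * Real.pi) ^ p) ≠ 0 := fun p => by
    have := Real.pi_pos
    simp only [ne_eq, ENNReal.ofReal_eq_zero, not_le]
    positivity
  have hfin : ∀ {I x : ℝ≥0∞} {p : ℝ}, x ^ 2 = ENNReal.ofReal ((2 * Real.pi) ^ p) * I →
      x < ∞ → I ≠ ∞ := by
    rintro I x p h hx rfl
    rw [ENNReal.mul_top (hpp _)] at h
    exact (ENNReal.pow_lt_top hx).ne h
  have h2 := angInt_mul_nullForm_lt (n := n) (β := β) hm ha hne hβ (hF.enorm.pow_const 2)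
    (hG.enorm.pow_const 2) hM hMt (fun x => by simp) (fun x => by simp) (hfin h3 hf.2)
    (hfin h4 hg.2) (energy_ne_zero_of_ne_zero hm hF hfF hf0)
    (energy_ne_zero_of_ne_zero hm hG hgG hg0)
  have h5 := two_pi_rpow_sobOrder n β
  rw [two_mul_sobOrder] at h5
  rw [← ENNReal.pow_lt_pow_left_iff two_ne_zero, mul_pow, mul_pow, h3, h4,
    ← ENNReal.mul_lt_mul_iff_right h0 h0']
  set IF := energy n (s / (2 * Real.pi)) (bExp n β + 1) fun x => ‖F x‖ₑ ^ 2
  set IG := energy n (s / (2 * Real.pi)) (bExp n β + 1) fun x => ‖G x‖ₑ ^ 2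
  calc angInt n 0 * boxNorm β (product s f g) ^ 2
      ≤ ENNReal.ofReal ((2 * Real.pi) ^ (4 * β)) * (angInt n 0 *
        nullForm n (s / (2 * Real.pi)) (fun v => ENNReal.ofReal (v ^ (2 * β)))
          (fun x => ‖F x‖ₑ ^ 2) (fun x => ‖G x‖ₑ ^ 2)) := by
        refine (mul_le_mul_right h1 _).trans (le_of_eq ?_)
        ring
    _ < ENNReal.ofReal ((2 * Real.pi) ^ (4 * β)) * (sph n * angInt n (2 * β) *
        (ENNReal.ofReal (kap n) * M * (IF * IG))) :=
        ENNReal.mul_lt_mul_right (hpp _) ENNReal.ofReal_ne_top h2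
    _ = ENNReal.ofReal ((2 * Real.pi) ^ (4 * β)) * (sph n * angInt n (2 * β) *
        (ENNReal.ofReal (kap n) * M)) * (IF * IG) := by ring
    _ ≤ ENNReal.ofReal ((2 * Real.pi) ^ (4 * β)) *
        (ENNReal.ofReal ((2 * Real.pi) ^ (n + 1) * C ^ 2) * angInt n 0) * (IF * IG) :=
        mul_le_mul_left (mul_le_mul_right hC _) _
    _ = ENNReal.ofReal ((2 * Real.pi) ^ (4 * β)) * ENNReal.ofReal ((2 * Real.pi) ^ (n + 1)) *
        (angInt n 0 * ENNReal.ofReal C ^ 2 * (IF * IG)) := by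
        rw [ENNReal.ofReal_mul (by positivity), ENNReal.ofReal_pow hC0]
        ring
    _ = _ := by
        rw [← h5]
        ring

theorem exists_angB_le (hb : 0 < bExp n β + ((n : ℝ) + 1) / 2) :
    ∃ M : ℝ≥0∞, M ≠ ∞ ∧ ∀ ν : ℝ, 0 ≤ ν → ν ≤ 1 → angB n (bExp n β) ν ≤ M := by
  by_cases h : bExp n β ≤ 0 ∨ 1 ≤ bExp n β
  · exact ⟨_, angInt_ne_top hb, fun ν h0 h1 => angB_le_of_convex h h0 h1⟩
  · have hb0 : 0 ≤ bExp n β := by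
      by_contra h'
      exact h (Or.inl (by linarith))
    exact ⟨_, ENNReal.mul_ne_top ENNReal.ofReal_ne_top (angInt_ne_top (by positivity)),
      fun ν h0 h1 => angB_le_of_nonneg hb0 h0 h1⟩

theorem exists_radialEstimate (ha : 0 ≤ (n : ℝ) / 2 + 2 * β) (hne : ¬ (n = 0 ∧ β = 0))
    (hβ : 0 < 2 * β + ((n : ℝ) + 1) / 2) :
    ∃ C : ℝ, 0 < C ∧ ∀ s : ℝ, 0 < s → RadialEstimate (n + 2) s β C := by
  obtain ⟨M, hMt, hM⟩ := exists_angB_le (bExp_add ha hne)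
  have h0 : angInt n 0 ≠ 0 := angInt_ne_zero (by positivity)
  have h0' : angInt n 0 ≠ ∞ := angInt_ne_top (by positivity)
  set K : ℝ≥0∞ := sph n * angInt n (2 * β) * (ENNReal.ofReal (kap n) * M) / angInt n 0 with hK
  have hKt : K ≠ ∞ := by
    refine ENNReal.div_ne_top (ENNReal.mul_ne_top (ENNReal.mul_ne_top (sph_ne_top n)
      (angInt_ne_top hβ)) (ENNReal.mul_ne_top ENNReal.ofReal_ne_top hMt)) h0
  have hC1 : 1 ≤ 1 + K.toReal := by linarith [ENNReal.toReal_nonneg (a := K)]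
  -- With `C = 1 + K` one has `C² ≥ K`, and `(2π)^(n+1) ≥ 1`.
  refine ⟨1 + K.toReal, by linarith, fun s hs =>
    radialEstimate_of_le hs ha hne hM (by linarith) ?_⟩
  rw [← ENNReal.div_le_iff h0 h0']
  refine ENNReal.le_ofReal_iff_toReal_le hKt (by positivity) |>.2 ?_
  have h1 : (1 : ℝ) ≤ (2 * Real.pi) ^ (n + 1) :=
    one_le_pow₀ (by nlinarith [Real.pi_gt_three])
  change K.toReal ≤ _
  nlinarith

end RadialEstimates

/-! ### The kernel at high energies -/

section HighEnergy

variable {n : ℕ} {m β : ℝ}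

theorem tendsto_sqrt_sq_sub_div (m : ℝ) :
    Tendsto (fun E : ℝ => √(E ^ 2 - m ^ 2) / E) atTop (𝓝 1) := by
  have h1 : Tendsto (fun E : ℝ => √(1 - (m / E) ^ 2)) atTop (𝓝 (√(1 - 0 ^ 2))) := by
    refine Tendsto.sqrt (tendsto_const_nhds.sub (Tendsto.pow ?_ 2))
    exact tendsto_const_nhds.div_atTop tendsto_id
  rw [show √(1 - (0 : ℝ) ^ 2) = 1 by simp] at h1
  refine h1.congr' ?_
  filter_upwards [eventually_gt_atTop 0] with E hE
  have h2 : E ^ 2 - m ^ 2 = E ^ 2 * (1 - (m / E) ^ 2) := by field_simp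
  rw [h2, Real.sqrt_mul (by positivity), Real.sqrt_sq hE.le, mul_div_cancel_left₀ _ hE.ne']

theorem tendsto_mul_atTop_prod :
    Tendsto (fun p : ℝ × ℝ => p.1 * p.2) (atTop ×ˢ atTop) atTop :=
  tendsto_fst.atTop_mul_atTop₀ tendsto_snd

theorem tendsto_velo (m : ℝ) :
    Tendsto (fun p : ℝ × ℝ => velo m p.1 p.2) (atTop ×ˢ atTop) (𝓝 1) := by
  have h := ((tendsto_sqrt_sq_sub_div m).comp tendsto_fst).mul
    ((tendsto_sqrt_sq_sub_div m).comp (tendsto_snd (f := (atTop : Filter ℝ))))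
  rw [mul_one] at h
  refine h.congr fun p => ?_
  simp only [Function.comp_apply]
  unfold velo
  rw [div_mul_div_comm]

/-- After division by `E₁E₂` the mass enters only through `m² / (E₁E₂) → 0` and `ν → 1`, so the loss
in `kern_lt` disappears in the limit. -/
theorem tendsto_kern_div (hm : 0 < m) {c : ℝ} (hc : c < 1) :
    Tendsto (fun p : ℝ × ℝ => kern n β m (p.1 * p.2 * (1 - velo m p.1 p.2 * c)) /
      (p.1 * p.2) ^ bExp n β) (atTop ×ˢ atTop) (𝓝 (kap n * (1 - c) ^ bExp n β)) := by
  have hc0 : 0 < 1 - c := by linarith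
  have hr := tendsto_mul_atTop_prod
  have hY : Tendsto (fun p : ℝ × ℝ => 1 - velo m p.1 p.2 * c) (atTop ×ˢ atTop) (𝓝 (1 - c)) := by
    have := tendsto_const_nhds (x := (1 : ℝ)).sub ((tendsto_velo m).mul_const c)
    simpa using this
  have hI : Tendsto (fun p : ℝ × ℝ => m ^ 2 / (p.1 * p.2)) (atTop ×ˢ atTop) (𝓝 0) :=
    tendsto_const_nhds.div_atTop hr
  have hsub := hY.sub hI
  have hadd := hI.add hY
  rw [sub_zero] at hsub
  rw [zero_add] at hadd
  have hlim := ((hsub.rpow_const (p := (n : ℝ) / 2 + 2 * β) (Or.inl hc0.ne')).div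
    (hadd.sqrt) (by positivity)).const_mul (kap n)
  have e1 : kap n * ((1 - c) ^ ((n : ℝ) / 2 + 2 * β) / √(1 - c)) =
      kap n * (1 - c) ^ bExp n β := by
    rw [Real.sqrt_eq_rpow, ← Real.rpow_sub hc0]
    rfl
  rw [e1] at hlim
  refine hlim.congr' ?_
  filter_upwards [hr.eventually_gt_atTop 0, hsub.eventually_const_lt hc0,
    hY.eventually_const_lt hc0] with p h1 h2 h3
  simp only [Pi.div_apply]
  generalize p.1 * p.2 = r at *
  generalize 1 - velo m p.1 p.2 * c = Y at *
  have h4 : r * Y - m ^ 2 = r * (Y - m ^ 2 / r) := by field_simp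
  have h5 : m ^ 2 + r * Y = r * (m ^ 2 / r + Y) := by field_simp
  have h6 : m ^ 2 < r * Y := by
    have := mul_pos h1 h2
    linarith
  have h7 : 0 < m ^ 2 / r + Y := by positivity
  rw [kern_eq hm h6, h4, h5, Real.mul_rpow h1.le h2.le, Real.sqrt_mul h1.le]
  have h8 : r ^ bExp n β = r ^ ((n : ℝ) / 2 + 2 * β) / √r := by
    rw [Real.sqrt_eq_rpow, ← Real.rpow_sub h1]
    rfl
  rw [h8]
  have : 0 < r ^ ((n : ℝ) / 2 + 2 * β) := by positivity
  have : 0 < √r := by positivity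
  have : 0 < √(m ^ 2 / r + Y) := by positivity
  field_simp

/-- Only a lower bound is needed, so Fatou's lemma along pairs of energies tending to infinity
suffices. -/
theorem eventually_lt_angAvg_kern (hm : 0 < m) {c : ℝ≥0∞}
    (hc : c < ENNReal.ofReal (kap n) * angInt n (bExp n β)) :
    ∀ᶠ p : ℝ × ℝ in atTop ×ˢ atTop, c * ENNReal.ofReal ((p.1 * p.2) ^ bExp n β) ≤
      angAvg n m p.1 p.2 (fun X => ENNReal.ofReal (kern n β m X)) := by
  have hk := measurable_kern n β m
  set Φ : ℝ × ℝ → ℝ → ℝ≥0∞ := fun p θ => ENNReal.ofReal (Real.sin θ ^ n) * ENNReal.ofReal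
    (kern n β m (p.1 * p.2 * (1 - velo m p.1 p.2 * Real.cos θ)) / (p.1 * p.2) ^ bExp n β) with hΦ
  have hfat := lintegral_liminf_le' (μ := volume.restrict (Ioo 0 Real.pi)) (f := Φ)
    (u := (atTop ×ˢ atTop : Filter (ℝ × ℝ))) (fun p => by
      refine Measurable.aemeasurable ?_
      simp only [hΦ]
      fun_prop)
  have hlim : ∫⁻ θ in Ioo 0 Real.pi, liminf (fun p => Φ p θ) (atTop ×ˢ atTop) =
      ENNReal.ofReal (kap n) * angInt n (bExp n β) := by
    rw [← angB_one]
    unfold angB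
    rw [← lintegral_const_mul' _ _ ENNReal.ofReal_ne_top]
    refine setLIntegral_congr_fun measurableSet_Ioo fun θ hθ => ?_
    have hs := Real.sin_pos_of_mem_Ioo hθ
    have hc1 := abs_lt.1 (abs_cos_lt_one hθ)
    have h1 : 0 < 1 - Real.cos θ := by linarith
    have hk0 := kap_pos n
    have := ENNReal.tendsto_ofReal (tendsto_kern_div (n := n) (β := β) hm hc1.2)
    have h2 := ENNReal.Tendsto.const_mul (a := ENNReal.ofReal (Real.sin θ ^ n)) this
      (Or.inr ENNReal.ofReal_ne_top)
    refine h2.liminf_eq.trans ?_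
    rw [one_mul, ← ENNReal.ofReal_mul (by positivity), ← ENNReal.ofReal_mul (by positivity)]
    congr 1
    ring
  rw [hlim] at hfat
  have hev := eventually_lt_of_lt_liminf (hc.trans_le hfat)
  have hpos : ∀ᶠ p : ℝ × ℝ in atTop ×ˢ atTop, 0 < p.1 ∧ 0 < p.2 :=
    (tendsto_fst.eventually_gt_atTop 0).and (tendsto_snd.eventually_gt_atTop 0)
  filter_upwards [hev, hpos] with p h1 h2
  have h3 : 0 < (p.1 * p.2) ^ bExp n β := by
    have := mul_pos h2.1 h2.2
    positivity
  refine (mul_le_mul_left h1.le _).trans (le_of_eq ?_)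
  rw [← lintegral_mul_const' _ _ ENNReal.ofReal_ne_top]
  unfold angAvg
  refine lintegral_congr fun θ => ?_
  simp only [hΦ]
  rw [mul_assoc, ← ENNReal.ofReal_mul' h3.le, div_mul_cancel₀ _ h3.ne', minkowski_eq h2.1 h2.2]

end HighEnergy

/-! ### Concentration of the test data at high energies -/

section Concentration

variable {n : ℕ} {m : ℝ}

theorem lintegral_exp_en_lt_top (hm : 0 < m) {c : ℝ} (hc : 0 < c) (p : ℝ) :
    ∫⁻ η : Space (n + 2), ENNReal.ofReal (Real.exp (-c * en m η) * en m η ^ p) < ∞ := by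
  -- With `k ≥ p` the power `E^(p-k)` is at most `m^(p-k)`. The extra `n + 3` powers absorbed by the
  -- exponential give decay integrable in dimension `n + 2`.
  obtain ⟨k, hk⟩ := exists_nat_ge p
  set j := k + (n + 3) with hj
  set K : ℝ := m ^ (p - k) * ((j.factorial : ℝ) / c ^ j * Real.exp c) with hK
  have hK0 : 0 ≤ K := by positivity
  have hb : ∀ η : Space (n + 2), Real.exp (-c * en m η) * en m η ^ p ≤
      K * (1 + ‖η‖) ^ (-((n + 3 : ℕ) : ℝ)) := by
    intro η
    have h1 := le_en (m := m) η
    have h0 := en_pos hm η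
    have h2 := norm_lt_en hm η
    have h3 : en m η ^ p ≤ m ^ (p - k) * (1 + en m η) ^ k := by
      calc en m η ^ p = en m η ^ (p - k) * en m η ^ k := by
            rw [← Real.rpow_natCast (en m η) k, ← Real.rpow_add h0]
            congr 1; ring
        _ ≤ m ^ (p - k) * (1 + en m η) ^ k := by
            gcongr ?_ * ?_ ^ _
            · exact Real.rpow_le_rpow_of_nonpos hm h1 (by linarith)
            · linarith
    have h4 : (1 + en m η) ^ j ≤ (j.factorial : ℝ) / c ^ j * Real.exp (c * (1 + en m η)) := by
      have := Real.pow_div_factorial_le_exp (c * (1 + en m η)) (by positivity) j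
      rw [mul_pow, div_le_iff₀ (by positivity)] at this
      rw [div_mul_eq_mul_div, le_div_iff₀ (by positivity)]
      linarith
    have h5 : (1 + ‖η‖) ^ (n + 3) ≤ (1 + en m η) ^ (n + 3) := by gcongr
    rw [Real.rpow_neg (by positivity), Real.rpow_natCast, ← div_eq_mul_inv,
      le_div_iff₀ (by positivity)]
    calc Real.exp (-c * en m η) * en m η ^ p * (1 + ‖η‖) ^ (n + 3)
        ≤ Real.exp (-c * en m η) * (m ^ (p - k) * (1 + en m η) ^ k) * (1 + en m η) ^ (n + 3) := by
          gcongr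
      _ = m ^ (p - k) * (Real.exp (-c * en m η) * (1 + en m η) ^ j) := by
          rw [hj, pow_add]; ring
      _ ≤ m ^ (p - k) * (Real.exp (-c * en m η) *
          ((j.factorial : ℝ) / c ^ j * Real.exp (c * (1 + en m η)))) := by gcongr
      _ = K := by
          rw [hK, mul_add, Real.exp_add, mul_one, neg_mul, Real.exp_neg]
          have := Real.exp_pos (c * en m η)
          field_simp
  have hint : Integrable fun η : Space (n + 2) => K * (1 + ‖η‖) ^ (-((n + 3 : ℕ) : ℝ)) := by
    refine (integrable_one_add_norm ?_).const_mul K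
    simp only [finrank_euclideanSpace, Fintype.card_fin]
    push_cast
    linarith
  refine lt_of_le_of_lt (lintegral_mono fun η => ENNReal.ofReal_le_ofReal (hb η)) ?_
  exact hint.lintegral_lt_top

/-- In polar coordinates the integrand grows like `r^(n+1+p)` with `n + 1 + p ≥ -1/2`, so it
dominates a multiple of `1/r` at infinity. -/
theorem lintegral_en_rpow_eq_top (hm : 0 < m) {p : ℝ} (hp : -(3 / 2) ≤ p) :
    ∫⁻ η : Space (n + 2), ENNReal.ofReal (en m η ^ p) = ∞ := by
  have h1 : ∫⁻ η : Space (n + 2), ENNReal.ofReal (en m η ^ p) =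
      sph (n + 1) * ∫⁻ r in Ioi (0 : ℝ), ENNReal.ofReal (r ^ (n + 1)) *
        ENNReal.ofReal (phi m r ^ p) :=
    lintegral_fun_norm (f := fun r => ENNReal.ofReal (phi m r ^ p)) (by fun_prop)
  rw [h1]
  refine ENNReal.mul_eq_top.2 (Or.inl ⟨sph_pos _, ?_⟩)
  set R := max 1 m with hR
  have hR1 : 1 ≤ R := le_max_left _ _
  have hRm : m ≤ R := le_max_right _ _
  by_contra hne
  have h2 : ∫⁻ r in Ioi R, ENNReal.ofReal (r⁻¹) ≠ ∞ := by
    have h3 : ∫⁻ r in Ioi R, ENNReal.ofReal (r⁻¹) ≤ ENNReal.ofReal 2 *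
        ∫⁻ r in Ioi (0 : ℝ), ENNReal.ofReal (r ^ (n + 1)) * ENNReal.ofReal (phi m r ^ p) := by
      rw [← lintegral_const_mul' _ _ ENNReal.ofReal_ne_top]
      refine le_trans (setLIntegral_mono' measurableSet_Ioi fun r hr => ?_)
        (lintegral_mono_set (Ioi_subset_Ioi (by linarith)))
      have hr : R < r := hr
      have hr1 : 1 ≤ r := by linarith
      have hphi : 0 < phi m r := phi_pos hm r
      have hsq : phi m r ^ 2 = m ^ 2 + r ^ 2 := Real.sq_sqrt (by positivity)
      have hphi1 : 1 ≤ phi m r := by nlinarith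
      rw [← ENNReal.ofReal_mul (by positivity), ← ENNReal.ofReal_mul (by positivity)]
      refine ENNReal.ofReal_le_ofReal ?_
      have h4 : (phi m r ^ 2)⁻¹ ≤ phi m r ^ p := by
        rw [← Real.rpow_natCast, ← Real.rpow_neg hphi.le]
        exact Real.rpow_le_rpow_of_exponent_le hphi1 (by push_cast; linarith)
      have h5 : r ≤ r ^ (n + 1) := le_self_pow₀ hr1 (by simp)
      calc r⁻¹ ≤ 2 * (r * (phi m r ^ 2)⁻¹) := by
            rw [hsq, inv_eq_one_div, ← div_eq_mul_inv, ← mul_div_assoc,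
              div_le_div_iff₀ (by positivity) (by positivity)]
            nlinarith
        _ ≤ 2 * (r ^ (n + 1) * phi m r ^ p) := by gcongr
    exact (h3.trans_lt (ENNReal.mul_lt_top ENNReal.ofReal_lt_top (lt_top_iff_ne_top.2 hne))).ne
  refine not_integrableOn_Ioi_inv (a := R) ?_
  refine (lintegral_ofReal_ne_top_iff_integrable (by fun_prop) ?_).1 h2
  filter_upwards [ae_restrict_mem measurableSet_Ioi] with r hr
  have : 0 < r := by
    have : R < r := hr
    linarith
  exact inv_nonneg.2 this.le

/-- The part with energies at least `R` of the energy of the data `exp (-a E) / E`. -/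
def tailEnergy (n : ℕ) (m p R a : ℝ) : ℝ≥0∞ :=
  ∫⁻ η : Space (n + 2), {η | R ≤ en m η}.indicator
    (fun η => ENNReal.ofReal (Real.exp (-(2 * a) * en m η) * en m η ^ p)) η

theorem measurable_tail (m p R a : ℝ) : Measurable ({η : Space (n + 2) | R ≤ en m η}.indicator
    (fun η => ENNReal.ofReal (Real.exp (-(2 * a) * en m η) * en m η ^ p))) :=
  Measurable.indicator (by fun_prop) (measurableSet_le measurable_const (by fun_prop))

theorem lintegral_low_lt_top (hm : 0 < m) (p R : ℝ) :
    ∫⁻ η : Space (n + 2), {η | ¬ R ≤ en m η}.indicator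
      (fun η => ENNReal.ofReal (en m η ^ p)) η < ∞ := by
  have h := lintegral_exp_en_lt_top (n := n) hm one_pos p
  refine lt_of_le_of_lt (b := ENNReal.ofReal (Real.exp R) * ∫⁻ η : Space (n + 2),
    ENNReal.ofReal (Real.exp (-1 * en m η) * en m η ^ p)) ?_
    (ENNReal.mul_lt_top ENNReal.ofReal_lt_top h)
  rw [← lintegral_const_mul' _ _ ENNReal.ofReal_ne_top]
  refine lintegral_mono fun η => ?_
  by_cases hη : R ≤ en m η
  · rw [indicator_of_notMem (by simpa using hη)]
    exact zero_le
  · rw [indicator_of_mem (by simpa using hη), ← ENNReal.ofReal_mul (by positivity)]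
    refine ENNReal.ofReal_le_ofReal ?_
    have h0 := en_pos hm η
    rw [← mul_assoc, ← Real.exp_add]
    refine le_mul_of_one_le_left (by positivity) (Real.one_le_exp ?_)
    linarith

/-- By monotone convergence the limit is the undamped integral over energies at least `R`. It
diverges since the whole integral does and the low energies contribute a finite amount. -/
theorem tendsto_tailEnergy (hm : 0 < m) {p : ℝ} (hp : -(3 / 2) ≤ p) (R : ℝ) :
    Tendsto (fun k : ℕ => tailEnergy n m p R (1 / ((k : ℝ) + 1))) atTop (𝓝 ∞) := by
  have htop : ∫⁻ η : Space (n + 2), {η | R ≤ en m η}.indicator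
      (fun η => ENNReal.ofReal (en m η ^ p)) η = ∞ := by
    by_contra hne
    have h1 := lintegral_en_rpow_eq_top (n := n) hm hp
    have h2 := lintegral_low_lt_top (n := n) hm p R
    have h3 : ∫⁻ η : Space (n + 2), ENNReal.ofReal (en m η ^ p) =
        (∫⁻ η : Space (n + 2), {η | R ≤ en m η}.indicator
          (fun η => ENNReal.ofReal (en m η ^ p)) η) +
        ∫⁻ η : Space (n + 2), {η | ¬ R ≤ en m η}.indicator
          (fun η => ENNReal.ofReal (en m η ^ p)) η := by
      rw [← lintegral_add_left (Measurable.indicator (by fun_prop)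
        (measurableSet_le measurable_const (by fun_prop)))]
      refine lintegral_congr fun η => ?_
      by_cases hη : R ≤ en m η
      · rw [indicator_of_mem (by simpa using hη), indicator_of_notMem (by simpa using hη), add_zero]
      · rw [indicator_of_notMem (by simpa using hη), indicator_of_mem (by simpa using hη), zero_add]
    rw [h1] at h3
    exact (ENNReal.add_lt_top.2 ⟨lt_top_iff_ne_top.2 hne, h2⟩).ne h3.symm
  rw [← htop]
  refine lintegral_tendsto_of_tendsto_of_monotone
    (fun k => (measurable_tail m p R _).aemeasurable) ?_ ?_
  · refine Eventually.of_forall fun η i j hij => ?_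
    by_cases hη : R ≤ en m η
    · have h0 := en_pos hm η
      simp only
      rw [indicator_of_mem (by simpa using hη), indicator_of_mem (by simpa using hη)]
      refine ENNReal.ofReal_le_ofReal ?_
      have : 1 / ((j : ℝ) + 1) ≤ 1 / ((i : ℝ) + 1) := by
        have : (i : ℝ) ≤ j := by exact_mod_cast hij
        gcongr
      gcongr
    · simp only
      rw [indicator_of_notMem (by simpa using hη), indicator_of_notMem (by simpa using hη)]
  · refine Eventually.of_forall fun η => ?_
    by_cases hη : R ≤ en m η
    · rw [indicator_of_mem (by simpa using hη)]
      have h1 : Tendsto (fun k : ℕ => 1 / ((k : ℝ) + 1)) atTop (𝓝 0) :=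
        tendsto_one_div_add_atTop_nhds_zero_nat
      have h2 : Tendsto (fun k : ℕ => Real.exp (-(2 * (1 / ((k : ℝ) + 1))) * en m η) * en m η ^ p)
          atTop (𝓝 (Real.exp (-(2 * 0) * en m η) * en m η ^ p)) :=
        ((Real.continuous_exp.tendsto _).comp ((h1.const_mul 2).neg.mul_const _)).mul_const _
      have h3 := ENNReal.tendsto_ofReal h2
      rw [mul_zero, neg_zero, zero_mul, Real.exp_zero, one_mul] at h3
      refine h3.congr fun k => ?_
      rw [indicator_of_mem (by simpa using hη)]
    · rw [indicator_of_notMem (by simpa using hη)]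
      refine tendsto_const_nhds.congr fun k => ?_
      rw [indicator_of_notMem (by simpa using hη)]

end Concentration

/-! ### Optimality of the constant -/

section Sharpness

variable {n : ℕ} {m s β : ℝ}

/-- The profile `exp (-a E) / E`, for which the Cauchy-Schwarz inequality on the fibers is an
equality. -/
def testProfile (a x : ℝ) : ℝ := Real.exp (-a * x) * |x|⁻¹

theorem testProfile_nonneg (a x : ℝ) : 0 ≤ testProfile a x := by unfold testProfile; positivity

@[fun_prop]
theorem measurable_testProfile (a : ℝ) : Measurable (testProfile a) := by
  unfold testProfile; fun_prop

theorem sq_testProfile (a : ℝ) {x : ℝ} (hx : 0 < x) :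
    testProfile a x ^ 2 = Real.exp (-(2 * a) * x) * x ^ (-2 : ℝ) := by
  unfold testProfile
  rw [abs_of_pos hx, mul_pow, ← Real.exp_nat_mul, Real.rpow_neg hx.le, Real.rpow_two, inv_pow]
  congr 2
  push_cast
  ring

theorem energy_testProfile (hm : 0 < m) (a p : ℝ) :
    energy n m p (fun x => ENNReal.ofReal (testProfile a x) ^ 2) =
      ∫⁻ η : Space (n + 2), ENNReal.ofReal (Real.exp (-(2 * a) * en m η) * en m η ^ (p - 2)) := by
  unfold energy
  refine lintegral_congr fun η => ?_
  have h0 := en_pos hm η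
  beta_reduce
  rw [← ENNReal.ofReal_pow (testProfile_nonneg _ _), sq_testProfile a h0,
    ← ENNReal.ofReal_mul (by positivity), mul_assoc, ← Real.rpow_add h0]
  congr 3
  ring

/-- With `F(x) = exp (-bx)/x` one has `x F(x) = exp (-bτ) y F(y)` when `x - y = τ`. So on a fiber
both weighted squares are constant multiples of `F(x)F(y)`, with constants `exp (∓bτ)` of product
`1`. -/
theorem sq_fibInt_testProfile (hm : 0 < m) (b : ℝ) {a τ : ℝ} (h : |τ| < a) :
    fibInt n m a τ
        (fun x y => ENNReal.ofReal (testProfile b x) * ENNReal.ofReal (testProfile b y)) ^ 2 =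
      fibInt n m a τ
          (fun x y => ENNReal.ofReal (testProfile b x) ^ 2 * ENNReal.ofReal (x / y)) *
        fibInt n m a τ
          (fun x y => ENNReal.ofReal (testProfile b y) ^ 2 * ENNReal.ofReal (y / x)) := by
  simp only [fibInt_eq_lintegral hm h]
  have key : ∀ ρ : ℝ, fibWt n m a τ ρ = 0 ∨ (0 < fibE a τ (m ^ 2 + ρ ^ 2) ∧
      0 < fibE a τ (m ^ 2 + ρ ^ 2) - τ) := by
    intro ρ
    by_cases hρ : 0 < ρ
    · exact Or.inr ⟨fibE_pos h (by positivity), fibE_sub_pos h (by positivity)⟩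
    · exact Or.inl (by unfold fibWt; rw [if_neg (fun h => hρ h.2)])
  have e1 : ∀ ρ : ℝ, ENNReal.ofReal (fibWt n m a τ ρ) *
      (ENNReal.ofReal (testProfile b (fibE a τ (m ^ 2 + ρ ^ 2))) ^ 2 *
        ENNReal.ofReal (fibE a τ (m ^ 2 + ρ ^ 2) / (fibE a τ (m ^ 2 + ρ ^ 2) - τ))) =
      ENNReal.ofReal (Real.exp (-b * τ)) * (ENNReal.ofReal (fibWt n m a τ ρ) *
        (ENNReal.ofReal (testProfile b (fibE a τ (m ^ 2 + ρ ^ 2))) *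
          ENNReal.ofReal (testProfile b (fibE a τ (m ^ 2 + ρ ^ 2) - τ)))) := by
    intro ρ
    rcases key ρ with h0 | ⟨h1, h2⟩
    · rw [h0]; simp
    generalize fibE a τ (m ^ 2 + ρ ^ 2) = E at *
    have t1 := testProfile_nonneg b E
    rw [mul_left_comm (ENNReal.ofReal (Real.exp (-b * τ)))]
    congr 1
    rw [← ENNReal.ofReal_pow t1, ← ENNReal.ofReal_mul (by positivity), ← ENNReal.ofReal_mul t1,
      ← ENNReal.ofReal_mul (by positivity)]
    congr 1
    unfold testProfile
    rw [abs_of_pos h1, abs_of_pos h2, show -b * E = -b * τ + -b * (E - τ) by ring, Real.exp_add]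
    field_simp
  have e2 : ∀ ρ : ℝ, ENNReal.ofReal (fibWt n m a τ ρ) *
      (ENNReal.ofReal (testProfile b (fibE a τ (m ^ 2 + ρ ^ 2) - τ)) ^ 2 *
        ENNReal.ofReal ((fibE a τ (m ^ 2 + ρ ^ 2) - τ) / fibE a τ (m ^ 2 + ρ ^ 2))) =
      ENNReal.ofReal (Real.exp (b * τ)) * (ENNReal.ofReal (fibWt n m a τ ρ) *
        (ENNReal.ofReal (testProfile b (fibE a τ (m ^ 2 + ρ ^ 2))) *
          ENNReal.ofReal (testProfile b (fibE a τ (m ^ 2 + ρ ^ 2) - τ)))) := by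
    intro ρ
    rcases key ρ with h0 | ⟨h1, h2⟩
    · rw [h0]; simp
    generalize fibE a τ (m ^ 2 + ρ ^ 2) = E at *
    have t1 := testProfile_nonneg b E
    have t2 := testProfile_nonneg b (E - τ)
    rw [mul_left_comm (ENNReal.ofReal (Real.exp (b * τ)))]
    congr 1
    rw [← ENNReal.ofReal_pow t2, ← ENNReal.ofReal_mul (by positivity), ← ENNReal.ofReal_mul t1,
      ← ENNReal.ofReal_mul (by positivity)]
    congr 1
    unfold testProfile
    rw [abs_of_pos h1, abs_of_pos h2, show -b * (E - τ) = b * τ + -b * E by ring, Real.exp_add]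
    field_simp
  simp_rw [e1, e2]
  rw [lintegral_const_mul' _ _ ENNReal.ofReal_ne_top, lintegral_const_mul' _ _ ENNReal.ofReal_ne_top,
    mul_mul_mul_comm, ← ENNReal.ofReal_mul (by positivity), ← Real.exp_add, ← sq]
  simp

theorem exists_testData (hm : 0 < m) {a : ℝ} (ha : 0 < a) :
    ∃ f : L2 (n + 2), IsRadial f ∧
      ∀ᵐ η, (𝓕 f : L2 (n + 2)) η = (testProfile a (en m η) : ℂ) := by
  have hmeas : Measurable fun η : Space (n + 2) => (testProfile a (en m η) : ℂ) := by
    exact Complex.measurable_ofReal.comp (by fun_prop)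
  have hmem : MemLp (fun η : Space (n + 2) => (testProfile a (en m η) : ℂ)) 2 volume := by
    refine ⟨hmeas.aestronglyMeasurable, ?_⟩
    refine (ENNReal.pow_lt_top_iff (n := 2)).1 ?_ |>.resolve_right two_ne_zero
    rw [sq_eLpNorm_two]
    have e : ∀ η : Space (n + 2), ‖(testProfile a (en m η) : ℂ)‖ₑ ^ 2 =
        ENNReal.ofReal (Real.exp (-(2 * a) * en m η) * en m η ^ (-2 : ℝ)) := by
      intro η
      rw [← sq_testProfile a (en_pos hm η), ← ofReal_norm,
        Complex.norm_of_nonneg (testProfile_nonneg _ _), ENNReal.ofReal_pow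
          (testProfile_nonneg _ _)]
    simp_rw [e]
    exact lintegral_exp_en_lt_top hm (by positivity) _
  have hrad : hmem.toLp _ ∈ radialL2 (n + 2) := by
    refine mem_radialL2_of_ae (F := fun r => (testProfile a (phi m r) : ℂ)) ?_ hmem.coeFn_toLp
    exact Complex.measurable_ofReal.comp (by fun_prop)
  refine ⟨𝓕⁻ (hmem.toLp _), isRadial_iff.2 (fourierInv_mem_radialL2 hrad), ?_⟩
  rw [fourier_fourierInv_L2]
  exact hmem.coeFn_toLp

theorem enorm_sq_testProfile (a x : ℝ) :
    ‖(testProfile a x : ℂ)‖ₑ ^ 2 = ENNReal.ofReal (testProfile a x) ^ 2 := by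
  rw [← ofReal_norm, Complex.norm_of_nonneg (testProfile_nonneg _ _)]

/-- For test data `boxNorm` is given exactly by the null form, so an assumed estimate for `f = g`
bounds the null form itself. -/
theorem nullForm_testProfile_le (hs : 0 < s) (ha : 0 ≤ (n : ℝ) / 2 + 2 * β)
    (hne : ¬ (n = 0 ∧ β = 0)) (hβ : 0 < 2 * β + ((n : ℝ) + 1) / 2) {C : ℝ} (hC0 : 0 ≤ C)
    (hC : RadialEstimate (n + 2) s β C) {a : ℝ} (hapos : 0 < a) :
    angInt n 0 * nullForm n (s / (2 * Real.pi)) (fun v => ENNReal.ofReal (v ^ (2 * β)))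
        (fun x => ENNReal.ofReal (testProfile a x) ^ 2)
        (fun x => ENNReal.ofReal (testProfile a x) ^ 2) ≤
      ENNReal.ofReal ((2 * Real.pi) ^ (n + 1) * C ^ 2) * angInt n 0 *
        energy n (s / (2 * Real.pi)) (bExp n β + 1)
          (fun x => ENNReal.ofReal (testProfile a x) ^ 2) ^ 2 := by
  have hm : 0 < s / (2 * Real.pi) := by positivity
  obtain ⟨f, hrad, hf⟩ := exists_testData (n := n) hm hapos
  have h0 : angInt n 0 ≠ 0 := angInt_ne_zero (by positivity)
  have hAm : Measurable fun x => ENNReal.ofReal (testProfile a x) ^ 2 := by fun_prop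
  have hJ : energy n (s / (2 * Real.pi)) (bExp n β + 1)
      (fun x => ENNReal.ofReal (testProfile a x) ^ 2) < ∞ := by
    rw [energy_testProfile hm]
    exact lintegral_exp_en_lt_top hm (by positivity) _
  have h3 := sq_sobolevNorm hs (sobOrder n β) (F := fun x => (testProfile a x : ℂ)) hf
  simp only [enorm_sq_testProfile] at h3
  rw [two_mul_sobOrder] at h3
  have h5 := two_pi_rpow_sobOrder n β
  rw [two_mul_sobOrder] at h5
  have hdat : IsRadialData s (sobOrder n β) f := by
    refine ⟨hrad, (ENNReal.pow_lt_top_iff (n := 2)).1 ?_ |>.resolve_right two_ne_zero⟩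
    rw [h3]
    exact ENNReal.mul_lt_top ENNReal.ofReal_lt_top hJ
  obtain ⟨M, hMt, hM⟩ := exists_angB_le (bExp_add ha hne)
  have hW : nullForm n (s / (2 * Real.pi)) (fun v => ENNReal.ofReal (v ^ (2 * β)))
        (fun x => ENNReal.ofReal (testProfile a x) ^ 2)
        (fun x => ENNReal.ofReal (testProfile a x) ^ 2) ≠ ∞ := by
    intro htop
    have := angInt_mul_nullForm_le (n := n) (β := β) hm ha hne hAm hAm hM
    rw [htop, ENNReal.mul_top h0, top_le_iff] at this
    exact ENNReal.mul_ne_top (ENNReal.mul_ne_top (sph_ne_top n) (angInt_ne_top hβ))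
      (ENNReal.mul_ne_top (ENNReal.mul_ne_top ENNReal.ofReal_ne_top hMt)
        (ENNReal.mul_ne_top hJ.ne hJ.ne)) this
  have h6 := sq_boxNorm_self (β := β) hs (measurable_testProfile a) (testProfile_nonneg a) hf hW
    (fun _ _ h => sq_fibInt_testProfile hm a h)
  have h7 : boxNorm β (product s f f) ≤ ENNReal.ofReal C * sobolevNorm s (sobOrder n β) f *
    sobolevNorm s (sobOrder n β) f := hC f f hdat hdat
  have h8 := pow_le_pow_left' h7 2
  rw [mul_pow, mul_pow, h3, h6] at h8
  have hp0 : ENNReal.ofReal ((2 * Real.pi) ^ (4 * β)) ≠ 0 := by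
    have := Real.pi_pos
    simp only [ne_eq, ENNReal.ofReal_eq_zero, not_le]
    positivity
  rw [← ENNReal.mul_le_mul_iff_right hp0 ENNReal.ofReal_ne_top]
  set J := energy n (s / (2 * Real.pi)) (bExp n β + 1)
    (fun x => ENNReal.ofReal (testProfile a x) ^ 2)
  set N := nullForm n (s / (2 * Real.pi)) (fun v => ENNReal.ofReal (v ^ (2 * β)))
        (fun x => ENNReal.ofReal (testProfile a x) ^ 2)
        (fun x => ENNReal.ofReal (testProfile a x) ^ 2)
  calc ENNReal.ofReal ((2 * Real.pi) ^ (4 * β)) * (angInt n 0 * N)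
      = angInt n 0 * (ENNReal.ofReal ((2 * Real.pi) ^ (4 * β)) * N) := by ring
    _ ≤ _ := mul_le_mul_right h8 _
    _ = ENNReal.ofReal ((2 * Real.pi) ^ (bExp n β + 1)) *
        ENNReal.ofReal ((2 * Real.pi) ^ (bExp n β + 1)) *
          (angInt n 0 * ENNReal.ofReal C ^ 2 * J ^ 2) := by ring
    _ = _ := by
        rw [h5, ENNReal.ofReal_mul (by positivity : (0 : ℝ) ≤ (2 * Real.pi) ^ (n + 1)),
          ENNReal.ofReal_pow hC0]
        ring

/-- Everything is nonnegative, so both energies may be restricted to `E ≥ R`, where the asymptotic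
lower bound for the kernel holds. -/
theorem le_angInt_mul_nullForm_testProfile (hm : 0 < m) {c : ℝ≥0∞} {R : ℝ}
    (hR : ∀ p : ℝ × ℝ, R ≤ p.1 → R ≤ p.2 → c * ENNReal.ofReal ((p.1 * p.2) ^ bExp n β) ≤
      angAvg n m p.1 p.2 (fun X => ENNReal.ofReal (kern n β m X))) (a : ℝ) :
    sph n * angInt n (2 * β) * (c * tailEnergy n m (bExp n β - 1) R a ^ 2) ≤
      angInt n 0 * nullForm n m (fun v => ENNReal.ofReal (v ^ (2 * β)))
        (fun x => ENNReal.ofReal (testProfile a x) ^ 2)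
        (fun x => ENNReal.ofReal (testProfile a x) ^ 2) := by
  have hAm : Measurable fun x => ENNReal.ofReal (testProfile a x) ^ 2 := by fun_prop
  rw [angInt_mul_nullForm hm hAm hAm]
  refine mul_le_mul_right ?_ _
  set A : ℝ → ℝ≥0∞ := (Ici R).indicator fun x => ENNReal.ofReal (testProfile a x) ^ 2 with hA
  have htail : tailEnergy n m (bExp n β - 1) R a = energy n m (bExp n β + 1) A := by
    unfold tailEnergy energy
    refine lintegral_congr fun η => ?_
    have h0 := en_pos hm η
    by_cases h : R ≤ en m η
    · rw [indicator_of_mem (by simpa using h), hA, indicator_of_mem (by simpa using h),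
        ← ENNReal.ofReal_pow (testProfile_nonneg _ _), sq_testProfile a h0,
        ← ENNReal.ofReal_mul (by positivity), mul_assoc, ← Real.rpow_add h0]
      congr 3
      ring
    · rw [indicator_of_notMem (by simpa using h), hA, indicator_of_notMem (by simpa using h),
        zero_mul]
  rw [htail, sq, ← lintegral_energy_mul hm (hAm.indicator measurableSet_Ici)
    (hAm.indicator measurableSet_Ici)]
  refine lintegral_mono fun η => lintegral_mono fun x => ?_
  by_cases h1 : R ≤ en m η
  swap
  · rw [indicator_of_notMem (by simpa using h1)]
    simp
  by_cases h2 : R ≤ en m x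
  swap
  · rw [indicator_of_notMem (a := en m x) (by simpa using h2)]
    simp
  rw [indicator_of_mem (by simpa using h1), indicator_of_mem (by simpa using h2)]
  exact mul_le_mul_right (mul_le_mul_right (hR (en m η, en m x) h1 h2) _) _

theorem energy_testProfile_le_tail (hm : 0 < m) (p R : ℝ) {a : ℝ} (ha : 0 ≤ a) :
    energy n m (p + 1) (fun x => ENNReal.ofReal (testProfile a x) ^ 2) ≤
      tailEnergy n m (p - 1) R a + ∫⁻ η : Space (n + 2), {η | ¬ R ≤ en m η}.indicator
        (fun η => ENNReal.ofReal (en m η ^ (p - 1))) η := by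
  unfold tailEnergy
  rw [energy_testProfile hm, ← lintegral_add_left (measurable_tail m (p - 1) R a)]
  refine lintegral_mono fun η => ?_
  have h0 := en_pos hm η
  have e : p + 1 - 2 = p - 1 := by ring
  rw [e]
  by_cases h : R ≤ en m η
  · rw [indicator_of_mem (by simpa using h), indicator_of_notMem (by simpa using h), add_zero]
  · rw [indicator_of_notMem (by simpa using h), indicator_of_mem (by simpa using h), zero_add]
    refine ENNReal.ofReal_le_ofReal (mul_le_of_le_one_left (by positivity) ?_)
    rw [Real.exp_le_one_iff]
    nlinarith [mul_nonneg ha h0.le]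

theorem constF_le_sq (hs : 0 < s) (ha : 0 ≤ (n : ℝ) / 2 + 2 * β) (hne : ¬ (n = 0 ∧ β = 0))
    (hβ : 0 < 2 * β + ((n : ℝ) + 1) / 2) (hβ' : 0 < (n : ℝ) + 2 * β) {C : ℝ} (hC0 : 0 ≤ C)
    (hC : RadialEstimate (n + 2) s β C) : constF β (n + 2) ≤ C ^ 2 := by
  have hm : 0 < s / (2 * Real.pi) := by positivity
  have h0 : angInt n 0 ≠ 0 := angInt_ne_zero (by positivity)
  have h0' : angInt n 0 ≠ ∞ := angInt_ne_top (by positivity)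
  set D : ℝ≥0∞ := ENNReal.ofReal ((2 * Real.pi) ^ (n + 1) * C ^ 2) * angInt n 0 with hD
  set S : ℝ≥0∞ := sph n * angInt n (2 * β) with hS
  have hDt : D ≠ ∞ := ENNReal.mul_ne_top ENNReal.ofReal_ne_top h0'
  have hS0 : S ≠ 0 := mul_ne_zero (sph_pos n) (angInt_ne_zero hβ)
  have hSt : S ≠ ∞ := ENNReal.mul_ne_top (sph_ne_top n) (angInt_ne_top hβ)
  -- Equivalent to `n/2 + 2β ≥ 0`; this is the exponent for which `tendsto_tailEnergy` gives
  -- divergence.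
  have hb : -(3 / 2) ≤ bExp n β - 1 := by
    unfold bExp
    linarith
  have hcle : ∀ c < ENNReal.ofReal (kap n) * angInt n (bExp n β), c ≤ D / S := by
    intro c hc
    rw [ENNReal.le_div_iff_mul_le (Or.inl hS0) (Or.inl hSt)]
    have hev := eventually_lt_angAvg_kern (n := n) (β := β) hm hc
    rw [prod_atTop_atTop_eq, eventually_atTop] at hev
    obtain ⟨r, hr⟩ := hev
    set R := max r.1 r.2
    have hR : ∀ p : ℝ × ℝ, R ≤ p.1 → R ≤ p.2 → c * ENNReal.ofReal ((p.1 * p.2) ^ bExp n β) ≤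
        angAvg n (s / (2 * Real.pi)) p.1 p.2
          (fun X => ENNReal.ofReal (kern n β (s / (2 * Real.pi)) X)) := fun p h1 h2 =>
      hr p ⟨(le_max_left _ _).trans h1, (le_max_right _ _).trans h2⟩
    set L : ℝ≥0∞ := ∫⁻ η : Space (n + 2), {η | ¬ R ≤ en (s / (2 * Real.pi)) η}.indicator
      (fun η => ENNReal.ofReal (en (s / (2 * Real.pi)) η ^ (bExp n β - 1))) η with hL
    have hLt : L ≠ ∞ := (lintegral_low_lt_top hm _ _).ne
    set T : ℕ → ℝ≥0∞ := fun k =>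
      tailEnergy n (s / (2 * Real.pi)) (bExp n β - 1) R (1 / ((k : ℝ) + 1)) with hT
    have hTlim : Tendsto T atTop (𝓝 ∞) := tendsto_tailEnergy hm hb R
    -- The bounds combine to `S c T² ≤ D (T + L)²`, where `L` is the fixed low-energy part. As `T →
    -- ∞` this becomes `S c ≤ D`.
    have hlim : Tendsto (fun k => D * (1 + L * (T k)⁻¹) ^ 2) atTop (𝓝 D) := by
      have h1 : Tendsto (fun k => (T k)⁻¹) atTop (𝓝 0) := by
        have := tendsto_inv_iff.2 hTlim
        rwa [ENNReal.inv_top] at this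
      have h2 := ENNReal.Tendsto.const_mul (a := L) h1 (Or.inr hLt)
      rw [mul_zero] at h2
      have h3 := ENNReal.Tendsto.pow (n := 2) ((tendsto_const_nhds (x := (1 : ℝ≥0∞))).add h2)
      have h4 := ENNReal.Tendsto.const_mul (a := D) h3 (Or.inr hDt)
      simpa using h4
    refine ge_of_tendsto hlim ?_
    filter_upwards [hTlim.eventually_const_lt (ENNReal.zero_lt_top)] with k hk
    have hapos : (0 : ℝ) < 1 / ((k : ℝ) + 1) := by positivity
    have hTt : T k ≠ ∞ := by
      refine (lt_of_le_of_lt ?_ (lintegral_exp_en_lt_top (n := n) hm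
        (by positivity : 0 < 2 * (1 / ((k : ℝ) + 1))) (bExp n β - 1))).ne
      exact lintegral_mono fun η => indicator_le_self _ _ _
    have h1 := (le_angInt_mul_nullForm_testProfile hm hR (1 / ((k : ℝ) + 1))).trans
      (nullForm_testProfile_le hs ha hne hβ hC0 hC hapos)
    have h2 := energy_testProfile_le_tail (n := n) hm (bExp n β) R hapos.le
    have h3 : S * (c * T k ^ 2) ≤ D * (T k + L) ^ 2 :=
      h1.trans (mul_le_mul_right (pow_le_pow_left' h2 2) _)
    have h4 : T k ^ 2 ≠ 0 := pow_ne_zero 2 hk.ne'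
    have h5 : T k ^ 2 ≠ ∞ := ENNReal.pow_ne_top hTt
    rw [← ENNReal.mul_le_mul_iff_left h4 h5]
    calc c * S * T k ^ 2 = S * (c * T k ^ 2) := by ring
      _ ≤ D * (T k + L) ^ 2 := h3
      _ = D * (1 + L * (T k)⁻¹) ^ 2 * T k ^ 2 := by
          have e : T k + L = (1 + L * (T k)⁻¹) * T k := by
            rw [add_mul, one_mul, mul_assoc, ENNReal.inv_mul_cancel hk.ne' hTt, mul_one]
          rw [e, mul_pow, ← mul_assoc]
  have hfinal := le_of_forall_lt_imp_le_of_dense hcle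
  rw [ENNReal.le_div_iff_mul_le (Or.inl hS0) (Or.inl hSt), mul_comm, hS,
    sph_mul_angInt hβ' hβ, hD, ENNReal.mul_le_mul_iff_left h0 h0',
    ENNReal.ofReal_le_ofReal_iff (by positivity)] at hfinal
  exact le_of_mul_le_mul_left hfinal (by positivity)

end Sharpness

end KleinGordon
end

/-! ### The theorem -/

theorem mainTheorem4 (d : ℕ) (hd : 2 ≤ d) (β : ℝ) (hβ : (2 - (d : ℝ)) / 4 ≤ β)
    (hne : ¬ (d = 2 ∧ β = 0)) :
    (∃ C : ℝ, 0 < C ∧ ∀ s : ℝ, 0 < s → KleinGordon.RadialEstimate d s β C) ∧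
    (β ∈ Set.Icc ((2 - (d : ℝ)) / 4) ((3 - (d : ℝ)) / 4) ∪ Set.Ici ((5 - (d : ℝ)) / 4) →
      ∀ s : ℝ, 0 < s →
        IsLeast {C : ℝ | 0 ≤ C ∧ KleinGordon.RadialEstimate d s β C}
          (KleinGordon.constF β d ^ (1 / 2 : ℝ)) ∧
        ¬ ∃ f g : KleinGordon.L2 d,
          KleinGordon.IsRadialData s (((d : ℝ) - 1) / 4 + β) f ∧
          KleinGordon.IsRadialData s (((d : ℝ) - 1) / 4 + β) g ∧
          f ≠ 0 ∧ g ≠ 0 ∧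
          KleinGordon.boxNorm β (KleinGordon.product s f g) =
            ENNReal.ofReal (KleinGordon.constF β d ^ (1 / 2 : ℝ)) *
              KleinGordon.sobolevNorm s (((d : ℝ) - 1) / 4 + β) f *
              KleinGordon.sobolevNorm s (((d : ℝ) - 1) / 4 + β) g) := by
  obtain ⟨n, rfl⟩ : ∃ n, d = n + 2 := ⟨d - 2, by omega⟩
  have hne' : ¬ (n = 0 ∧ β = 0) := fun h => hne ⟨by omega, h.2⟩
  have ha : 0 ≤ (n : ℝ) / 2 + 2 * β := by
    push_cast at hβ
    linarith
  have hβ₁ : 0 < 2 * β + ((n : ℝ) + 1) / 2 := by linarith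
  have hb := KleinGordon.bExp_add ha hne'
  have hβ₂ : 0 < (n : ℝ) + 2 * β := by
    unfold KleinGordon.bExp at hb
    linarith
  refine ⟨KleinGordon.exists_radialEstimate ha hne' hβ₁, fun hβs s hs => ?_⟩
  -- With `d = n + 2`, `b ≤ 0` is `β ≤ (3 - d)/4` and `b ≥ 1` is `β ≥ (5 - d)/4`.
  have hcv : KleinGordon.bExp n β ≤ 0 ∨ 1 ≤ KleinGordon.bExp n β := by
    unfold KleinGordon.bExp
    rcases hβs with h | h
    · have h := h.2
      push_cast at h
      exact Or.inl (by linarith)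
    · have h := Set.mem_Ici.1 h
      push_cast at h
      exact Or.inr (by linarith)
  have hF := KleinGordon.constF_pos hβ₂ hβ₁
  have hsqrt : KleinGordon.constF β (n + 2) ^ (1 / 2 : ℝ) = √(KleinGordon.constF β (n + 2)) :=
    (Real.sqrt_eq_rpow _).symm
  rw [hsqrt]
  have hM : ∀ ν : ℝ, 0 ≤ ν → ν ≤ 1 →
      KleinGordon.angB n (KleinGordon.bExp n β) ν ≤ KleinGordon.angInt n (KleinGordon.bExp n β) :=
    fun ν h0 h1 => KleinGordon.angB_le_of_convex hcv h0 h1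
  have hC := (KleinGordon.sph_mul_angInt hβ₂ hβ₁).le
  rw [← Real.sq_sqrt hF.le] at hC
  refine ⟨⟨⟨Real.sqrt_nonneg _, KleinGordon.radialEstimate_of_le hs ha hne' hM
    (Real.sqrt_nonneg _) hC⟩, fun C hC' => ?_⟩, ?_⟩
  · exact (Real.sqrt_le_left hC'.1).2 (KleinGordon.constF_le_sq hs ha hne' hβ₁ hβ₂ hC'.1 hC'.2)
  · rintro ⟨f, g, hf, hg, hf0, hg0, heq⟩
    exact (KleinGordon.boxNorm_lt hs ha hne' hβ₁ hM (KleinGordon.angInt_ne_top hb)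
      (Real.sqrt_nonneg _) hC hf hg hf0 hg0).ne heq
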